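/- Let $Q$ be a flat, geodesically complete, Hausdorff, real-analytic Riemannian manifold of dimension $n$ (without boundary) with real-analytic metric $\sigma$, and let $\pi\colon P=T^*Q\to Q$ be its cotangent bundle. In local coordinates $(q^i)$ of $Q$, with the induced canonical coordinates $(q^i,p_i)$ of $P$, let $\sigma_{ij}$ be the matrix of the metric, $(\sigma^{ij})$ its inverse and $\Gamma^k_{ij}$ the Christoffel symbols of the Levi-Civita connection. For $m\in P$ and $V\in T_mP$ with components $(\dot q^i,\dot p_i)$ put $(DV)_i=\dot p_i-p_k\Gamma^k_{il}\dot q^l$ (the covariant derivative of the covector field $p(t)$ along a curve $(q(t),p(t))$ in $P$ with velocity $V$ at $m$). Equip $P$ with the lifted metric $$G_m(V,W)=\sigma_q(T\pi V,T\pi W)+\sigma_q\bigl(\sigma_q^\sharp DV,\sigma_q^\sharp DW\bigr),\qquad q=\pi(m),$$ where $\sigma^\sharp\colon T^*Q\to TQ$ is the isomorphism induced by $\sigma$. Let $\Omega$ be the Riemannian volume form of $G$ for the orientation of $P$ in which $dq^1\wedge\dots\wedge dq^n\wedge dp_1\wedge\dots\wedge dp_n$ is positive. Let $m\in P$. Then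 for every $V\in T_mP$ there is exactly one geodesic $\gamma\colon\mathbb R\to P$ of $G$ with $\gamma(0)=m$ and $\gamma'(0)=V$, so that the exponential map $\exp_m\colon T_mP\to P$, $\exp_m(V)=\gamma(1)$, is defined on all of $T_mP$; and $\exp_m$ is differentiable. Moreover, for every chart of the real-analytic structure of $Q$ whose domain contains $\pi(m)$, the complex coordinates $$z^i(V)=\dot q^i+\mathrm i\,\sigma^{ij}(\pi m)\,(DV)_j,\qquad i=1,\dots,n,$$ define a real-linear isomorphism $T_mP\cong\mathbb C^n$, in terms of which, for all $z\in\mathbb C^n$, $$\exp_m^*\Omega(z)=\sigma(\pi m)\,dz .$$ Here $\sigma(\pi m)=\det(\sigma_{ij}(\pi m))$ and $dz$ is the standard (Lebesgue) volume form $dx^1\wedge\dots\wedge dx^n\wedge dy^1\wedge\dots\wedge dy^n$ of $\mathbb C^n$, $z^j=x^j+\mathrm i y^j$. Consequently the measure on $\mathbb C^n$ defined by $\exp_m^*\Omega$ is $\sigma(\pi m)$ times Lebesgue measure. -/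

import Mathlib

open Bundle Manifold MeasureTheory
open scoped ContDiff

noncomputable section

namespace FlatPhaseSpace

/-! ### Riemannian geometry in local coordinates

`M` is a manifold without boundary modelled on the finite-dimensional space `E`, `b` is a basis of
`E` (it turns a chart `e` of `M` into a system of local coordinates `x^i`), and `g` is a field of
inner products on the tangent spaces of `M`.  Points `y : E` are coordinate representations of
points of `M`. -/

section Local

variable {E : Type*} [NormedAddCommGroup E] [NormedSpace ℝ E]
  {H : Type*} [TopologicalSpace H] (I : ModelWithCorners ℝ E H)
  {M : Type*} [TopologicalSpace M] [ChartedSpace H M]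
  {ι : Type*} [Fintype ι] [DecidableEq ι] (b : Module.Basis ι ℝ E)
  (g : ∀ x : M, TangentSpace I x → TangentSpace I x → ℝ)

/-- The coordinate vector field `∂/∂x^i` of the chart `e`, at the point with coordinates `y`. -/
def coordVector (e : OpenPartialHomeomorph M H) (y : E) (i : ι) :
    TangentSpace I ((e.extend I).symm y) :=
  mfderiv 𝓘(ℝ, E) I (e.extend I).symm y (b i)

/-- The matrix `g_{ij} = g(∂/∂x^i, ∂/∂x^j)` in the chart `e`. -/
def metricMatrix (e : OpenPartialHomeomorph M H) (y : E) : Matrix ι ι ℝ :=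
  Matrix.of fun i j => g ((e.extend I).symm y) (coordVector I b e y i) (coordVector I b e y j)

/-- The Christoffel symbols of the Levi-Civita connection of `g` in the chart `e`:
`Γ^k_{ij} = 1/2 g^{kl} (∂_i g_{jl} + ∂_j g_{il} - ∂_l g_{ij})`. -/
def christoffel (e : OpenPartialHomeomorph M H) (y : E) (k i j : ι) : ℝ :=
  (1 / 2) * ∑ l, (metricMatrix I b g e y)⁻¹ k l *
    (fderiv ℝ (fun y' => metricMatrix I b g e y' j l) y (b i)
      + fderiv ℝ (fun y' => metricMatrix I b g e y' i l) y (b j)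
      - fderiv ℝ (fun y' => metricMatrix I b g e y' i j) y (b l))

/-- The components of the Riemann curvature tensor in the chart `e`:
`R^l_{kij} = ∂_i Γ^l_{jk} - ∂_j Γ^l_{ik} + Γ^l_{im} Γ^m_{jk} - Γ^l_{jm} Γ^m_{ik}`. -/
def curvature (e : OpenPartialHomeomorph M H) (y : E) (l k i j : ι) : ℝ :=
  fderiv ℝ (fun y' => christoffel I b g e y' l j k) y (b i)
    - fderiv ℝ (fun y' => christoffel I b g e y' l i k) y (b j)
    + ∑ m, (christoffel I b g e y l i m * christoffel I b g e y m j k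
      - christoffel I b g e y l j m * christoffel I b g e y m i k)

/-- `g` is flat: its curvature tensor vanishes identically. -/
def IsFlat : Prop :=
  ∀ x₀ : M, ∀ y ∈ ((chartAt H x₀).extend I).target, ∀ l k i j : ι,
    curvature I b g (chartAt H x₀) y l k i j = 0

/-- The `k`-th coordinate of the curve `γ` in the chart `e`. -/
def curveCoord (e : OpenPartialHomeomorph M H) (γ : ℝ → M) (k : ι) (t : ℝ) : ℝ :=
  b.repr (e.extend I (γ t)) k

/-- `γ : ℝ → M` is a geodesic of `g`: it is `C²` and satisfies
`u''^k + Γ^k_{ij}(u) u'^i u'^j = 0` in the charts of `M`. -/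
def IsGeodesic (γ : ℝ → M) : Prop :=
  ContMDiff 𝓘(ℝ, ℝ) I 2 γ ∧
  ∀ (x₀ : M) (t : ℝ), γ t ∈ (chartAt H x₀).source → ∀ k : ι,
    deriv (deriv (curveCoord I b (chartAt H x₀) γ k)) t
      + ∑ i, ∑ j, christoffel I b g (chartAt H x₀) ((chartAt H x₀).extend I (γ t)) k i j
          * deriv (curveCoord I b (chartAt H x₀) γ i) t
          * deriv (curveCoord I b (chartAt H x₀) γ j) t = 0

/-- `γ` is a geodesic of `g`, defined for all times, with `γ(0) = x` and `γ'(0) = v`. -/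
def IsGeodesicFrom (x : M) (v : TangentSpace I x) (γ : ℝ → M) : Prop :=
  IsGeodesic I b g γ ∧
    (⟨γ 0, mfderiv 𝓘(ℝ, ℝ) I γ 0 (1 : ℝ)⟩ : TangentBundle I M) = ⟨x, v⟩

/-- `g` is geodesically complete: every tangent vector is the initial velocity of a geodesic
defined on the whole real line. -/
def IsGeodesicallyComplete : Prop :=
  ∀ (x : M) (v : TangentSpace I x), ∃ γ : ℝ → M, IsGeodesicFrom I b g x v γ

open Classical in
/-- The exponential map `exp_x v = γ(1)`, where `γ` is the geodesic with `γ(0) = x` and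
`γ'(0) = v` (with the value `x` if there is no such geodesic on the whole real line). -/
def expMap (x : M) (v : TangentSpace I x) : M :=
  if h : ∃ γ : ℝ → M, IsGeodesicFrom I b g x v γ then h.choose 1 else x

/-- The Riemannian volume form `√(det g_{ij}) dx^1 ∧ ⋯ ∧ dx^N` of `g`, at each point `x` in the
chart at `x`.  The orientation is the one given by the charts in the distinguished atlas of `M`,
so the definition is meant for an `M` whose distinguished charts are consistently oriented. -/
def volumeForm (x : M) : TangentSpace I x [⋀^ι]→ₗ[ℝ] ℝ :=
  Real.sqrt (metricMatrix I b g (chartAt H x) ((chartAt H x).extend I x)).det •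
    b.det.compLinearMap (mfderiv I 𝓘(ℝ, E) ((chartAt H x).extend I) x).toLinearMap

end Local

/-- The pullback `F^*Ω` at the point `z` of a field `Ω` of alternating forms on `M` by a map
`F : V → M` defined on a normed space. -/
def pullbackForm {V : Type*} [NormedAddCommGroup V] [NormedSpace ℝ V]
    {E : Type*} [NormedAddCommGroup E] [NormedSpace ℝ E]
    {H : Type*} [TopologicalSpace H] (I : ModelWithCorners ℝ E H)
    {M : Type*} [TopologicalSpace M] [ChartedSpace H M] {ι : Type*}
    (F : V → M) (Ω : ∀ x : M, TangentSpace I x [⋀^ι]→ₗ[ℝ] ℝ) (z : V) : V [⋀^ι]→ₗ[ℝ] ℝ :=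
  (Ω (F z)).compLinearMap (mfderiv 𝓘(ℝ, V) I F z).toLinearMap

/-! ### The space `ℂⁿ` -/

/-- The real coordinates `(x, y) = (Re z, Im z)` on `ℂⁿ`. -/
def realCoords (n : ℕ) : (Fin n → ℂ) →ₗ[ℝ] (Fin n ⊕ Fin n → ℝ) where
  toFun z := Sum.elim (fun i => (z i).re) (fun i => (z i).im)
  map_add' z w := by ext (i | i) <;> simp
  map_smul' c z := by ext (i | i) <;> simp

/-- The Lebesgue volume form `dz` of `ℂⁿ`: the determinant in the coordinates `(Re z, Im z)`. -/
def lebesgueForm (n : ℕ) : (Fin n → ℂ) [⋀^Fin n ⊕ Fin n]→ₗ[ℝ] ℝ :=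
  (Pi.basisFun ℝ (Fin n ⊕ Fin n)).det.compLinearMap (realCoords n)

/-- The standard real basis `e_1, …, e_n, i e_1, …, i e_n` of `ℂⁿ`; it spans a parallelepiped of
Lebesgue measure one. -/
def stdFrame (n : ℕ) : Fin n ⊕ Fin n → (Fin n → ℂ) :=
  Sum.elim (fun i => Pi.single i 1) (fun i => Pi.single i Complex.I)

/-- The measure `|η|` on `ℂⁿ` defined by a form `η` of top degree: its density with respect to
Lebesgue measure is the absolute value of `η` on the standard frame. -/
def formMeasure {n : ℕ} (η : (Fin n → ℂ) → (Fin n → ℂ) [⋀^Fin n ⊕ Fin n]→ₗ[ℝ] ℝ) :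
    Measure (Fin n → ℂ) :=
  (volume : Measure (Fin n → ℂ)).withDensity fun z => ENNReal.ofReal |η z (stdFrame n)|

/-! ### The cotangent bundle and the lifted metric -/

/-- The model space `ℝⁿ` of the base manifold. -/
abbrev Model (n : ℕ) : Type := EuclideanSpace ℝ (Fin n)

/-- The standard basis of `ℝⁿ`. -/
def stdBasis (n : ℕ) : Module.Basis (Fin n) ℝ (Model n) :=
  (EuclideanSpace.basisFun (Fin n) ℝ).toBasis

/-- The model with corners of the cotangent bundle of an `n`-manifold. -/
abbrev phaseModel (n : ℕ) := (𝓡 n).prod 𝓘(ℝ, Model n →L[ℝ] ℝ)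

/-- The basis of `ℝⁿ × (ℝⁿ)^*` formed by the standard basis of `ℝⁿ` and its dual basis, so that
the charts of a cotangent bundle become canonical coordinates `(q^1, …, q^n, p_1, …, p_n)`. -/
def phaseBasis (n : ℕ) :
    Module.Basis (Fin n ⊕ Fin n) ℝ (Model n × (Model n →L[ℝ] ℝ)) :=
  (stdBasis n).prod ((stdBasis n).dualBasis.map LinearMap.toContinuousLinearMap)

section Cotangent

variable {n : ℕ} {Q : Type*} [TopologicalSpace Q] [ChartedSpace (Model n) Q]

variable (n Q) in
/-- The cotangent bundle `P = T^*Q`; a point is a pair `(q, p)` with `p` a linear form on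
`T_q Q`. -/
abbrev Cotangent [IsManifold (𝓡 n) 1 Q] : Type _ :=
  TotalSpace (Model n →L[ℝ] ℝ)
    (fun q : Q => TangentSpace (𝓡 n) q →L[ℝ] Bundle.Trivial Q ℝ q)

variable [IsManifold (𝓡 n) ω Q]
  (σ : ContMDiffRiemannianMetric (𝓡 n) ω (Model n) (fun q : Q => TangentSpace (𝓡 n) q))
  (e : OpenPartialHomeomorph Q (Model n))

/-- The metric of `Q` as a field of functions of two tangent vectors. -/
def baseMetric (q : Q) (v w : TangentSpace (𝓡 n) q) : ℝ := σ.inner q v w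

/-- The matrix `σ_{ij}` in the chart `e`, at the point `q` of `Q`. -/
def baseMatrix (q : Q) : Matrix (Fin n) (Fin n) ℝ :=
  metricMatrix (𝓡 n) (stdBasis n) (baseMetric σ) e (e.extend (𝓡 n) q)

/-- The canonical coordinate `q^i` on `T^*Q` induced by the chart `e`. -/
def coordQ (i : Fin n) (m : Cotangent n Q) : ℝ :=
  (stdBasis n).repr (e.extend (𝓡 n) m.proj) i

/-- The `i`-th coordinate vector `∂/∂q^i` of the chart `e` at the point `q` of `Q`. -/
def baseVector (q : Q) (i : Fin n) : TangentSpace (𝓡 n) q :=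
  coordVector (𝓡 n) (stdBasis n) e (e.extend (𝓡 n) q) i

/-- The canonical coordinate `p_i = p(∂/∂q^i)` on `T^*Q` induced by the chart `e`. -/
def coordP (i : Fin n) (m : Cotangent n Q) : ℝ :=
  m.2 (baseVector e m.proj i)

/-- The component `\dot q^i` of a tangent vector of `T^*Q` in the canonical coordinates. -/
def dotQ (m : Cotangent n Q) (i : Fin n) : TangentSpace (phaseModel n) m →ₗ[ℝ] ℝ :=
  (mfderiv (phaseModel n) 𝓘(ℝ, ℝ) (coordQ e i) m).toLinearMap

/-- The component `\dot p_i` of a tangent vector of `T^*Q` in the canonical coordinates. -/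
def dotP (m : Cotangent n Q) (i : Fin n) : TangentSpace (phaseModel n) m →ₗ[ℝ] ℝ :=
  (mfderiv (phaseModel n) 𝓘(ℝ, ℝ) (coordP e i) m).toLinearMap

/-- The components `(Dp/dt)_i = \dot p_i - p_k Γ^k_{il} \dot q^l` of the covariant derivative of the
covector field `p(t)` along a curve `(q(t), p(t))` through `m`, as functions of the velocity of
that curve. -/
def covDeriv (m : Cotangent n Q) (i : Fin n) : TangentSpace (phaseModel n) m →ₗ[ℝ] ℝ :=
  dotP e m i - ∑ k, ∑ l, (coordP e k m * christoffel (𝓡 n) (stdBasis n) (baseMetric σ) e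
    (e.extend (𝓡 n) m.proj) k i l) • dotQ e m l

/-- The tangent vector `σ^♯ α = σ^{ij} α_j ∂/∂q^i` at `q` of the covector `α = α_j dq^j`. -/
def sharp (q : Q) (α : Fin n → ℝ) : TangentSpace (𝓡 n) q :=
  ∑ i, (∑ j, (baseMatrix σ e q)⁻¹ i j * α j) • baseVector e q i

/-- The lifted metric on `P = T^*Q`:
`G_m(V, W) = σ_q(Tπ V, Tπ W) + σ_q(σ^♯ Dp_1/dt, σ^♯ Dp_2/dt)`, where `q = π(m)` and the covariant
derivatives are computed in the chart of `Q` at `q`. -/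
def liftedMetric (m : Cotangent n Q) (V W : TangentSpace (phaseModel n) m) : ℝ :=
  σ.inner m.proj
      (mfderiv (phaseModel n) (𝓡 n) (fun m' : Cotangent n Q => m'.proj) m V)
      (mfderiv (phaseModel n) (𝓡 n) (fun m' : Cotangent n Q => m'.proj) m W)
    + σ.inner m.proj
      (sharp σ (chartAt (Model n) m.proj) m.proj
        (fun i => covDeriv σ (chartAt (Model n) m.proj) m i V))
      (sharp σ (chartAt (Model n) m.proj) m.proj
        (fun i => covDeriv σ (chartAt (Model n) m.proj) m i W))

/-- The complex coordinates
`z^i = \dot q^i + i σ^{ij} (\dot p_j - p_k Γ^k_{jl} \dot q^l)` of a tangent vector of `T^*Q` at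
`m`, with respect to the chart `e` of `Q`. -/
def complexCoord (m : Cotangent n Q) (V : TangentSpace (phaseModel n) m) : Fin n → ℂ :=
  fun i => (dotQ e m i V : ℂ)
    + Complex.I * ((∑ j, (baseMatrix σ e m.proj)⁻¹ i j * covDeriv σ e m j V : ℝ) : ℂ)

/-- The exponential map of the lifted metric at `m`. -/
def phaseExp (m : Cotangent n Q) (V : TangentSpace (phaseModel n) m) : Cotangent n Q :=
  expMap (phaseModel n) (phaseBasis n) (liftedMetric σ) m V

/-- The Riemannian volume form `Ω` of the lifted metric, for the canonical orientation of `T^*Q`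
(the one in which `dq^1 ∧ ⋯ ∧ dq^n ∧ dp_1 ∧ ⋯ ∧ dp_n` is positive). -/
def phaseVolume (m : Cotangent n Q) :
    TangentSpace (phaseModel n) m [⋀^Fin n ⊕ Fin n]→ₗ[ℝ] ℝ :=
  volumeForm (phaseModel n) (phaseBasis n) (liftedMetric σ) m

end Cotangent

end FlatPhaseSpace

end

noncomputable section

namespace FlatPhaseSpace

/-! ### Flat linear total differential equations -/

section Parallel

set_option maxSynthPendingDepth 3

open Set Metric Filter
open scoped Topology NNReal

variable {E : Type*} [NormedAddCommGroup E] [NormedSpace ℝ E]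
  {G : Type*} [NormedAddCommGroup G] [NormedSpace ℝ G]
  {𝔸 : Type*} [NormedRing 𝔸] [NormedAlgebra ℝ 𝔸]

/-! The proof reduces everything to Euclidean space. A flat metric has, near every point,
coordinates in which its matrix is constant; in them geodesics are straight lines. With completeness
these local pictures can be continued along rays, and the exponential map of `Q` at `π(m)` becomes a
smooth map `F : ℝⁿ → Q` that pulls `σ` back to a constant inner product `B` on all of `ℝⁿ`
(`exists_isFlatParam_univ`). No injectivity or covering property of `F` is needed: the pullback
property is local and already determines the geodesics.

The map `F` lifts to `f(x, b) = (F x, B(b, dF_x⁻¹ ·))` from `ℝⁿ × ℝⁿ` to `T^*Q`. In flat coordinates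
the covariant derivative of a covector field is the ordinary derivative, so `f` pulls the lifted
metric back to the constant form `B ⊕ B` (`isFlatParam_cotangentLift`). Hence the geodesics of `G`
are exactly the images under `f` of straight lines (`IsFlatParam.isGeodesicFrom_iff`), which gives
existence and uniqueness for all times and `exp_m(df u) = f((0, b) + u)` when `m = f(0, b)`.

If `F` is normalized so that `dF_0` is the coordinate frame of the given chart at `π(m)`, then `u =
(v, c)` has complex coordinates `v + i c`, and the Gram matrix of `B` is `σ_{ij}(π m)`. The volume
form of `B ⊕ B` is the square root of `det(B)²` times Lebesgue, that is `det(σ_{ij}(π m)) dz`; a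
block triangular Jacobian shows that `f` preserves the orientations
(`IsFlatParam.phaseVolume_comp`).

The local step, from vanishing curvature to flat coordinates, is a Frobenius theorem for linear
total differential equations (`exists_parallel`), applied to the equations of a parallel coframe and
of its primitive (`exists_parallel_coord`, `exists_flat_coord`). -/

theorem exists_linear_ode_solution [CompleteSpace 𝔸] {a : ℝ → 𝔸}
    (ha : ContinuousOn a (Icc 0 1)) (hbound : ∀ t ∈ Icc (0 : ℝ) 1, ‖a t‖ ≤ 1 / 2) (X₀ : 𝔸) :
    ∃ Z : ℝ → 𝔸, Z 0 = X₀ ∧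
      ∀ t ∈ Icc (0 : ℝ) 1, HasDerivWithinAt Z (a t * Z t) (Icc 0 1) t := by
  have h0 : (0 : ℝ) ∈ Icc (0 : ℝ) 1 := by simp
  -- On the ball of radius `‖X₀‖ + 1` about `X₀` the right-hand side is at most `(2‖X₀‖ + 1) / 2 ≤
  -- ‖X₀‖ + 1`, so no solution leaves the ball within time one. This is where the bound `1 / 2` on
  -- `a` is needed.
  have hPL : IsPicardLindelof (fun t X => a t * X) (⟨0, h0⟩ : Icc (0 : ℝ) 1) X₀ (‖X₀‖₊ + 1) 0
      (‖X₀‖₊ + 1) (1 / 2) := by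
    refine ⟨fun t ht => ?_, fun X _ => ?_, fun t ht X hX => ?_, ?_⟩
    · refine LipschitzOnWith.of_dist_le_mul fun X _ Y _ => ?_
      rw [dist_eq_norm, dist_eq_norm, ← mul_sub]
      refine (norm_mul_le _ _).trans ?_
      gcongr
      exact (hbound t ht).trans (by norm_num)
    · exact ha.mul continuousOn_const
    · have h1 : ‖a t * X‖ ≤ 1 / 2 * ‖X‖ :=
        (norm_mul_le _ _).trans (by gcongr; exact hbound t ht)
      have h2 : ‖X‖ ≤ ‖X₀‖ + (‖X₀‖ + 1) := by
        have := norm_le_norm_add_norm_sub X₀ X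
        have h3 : ‖X₀ - X‖ ≤ ‖X₀‖ + 1 := by
          rw [← dist_eq_norm, dist_comm]; simpa using hX
        linarith
      refine h1.trans ?_
      rw [NNReal.coe_add, coe_nnnorm, NNReal.coe_one]
      linarith
    · simp
  exact hPL.exists_eq_forall_mem_Icc_hasDerivWithinAt₀

/-- Grönwall's inequality with rate one on the unit interval, with a crude constant. It serves to
bound solutions, to show that an error is quadratic, and to identify a constant solution. -/
theorem norm_le_of_linear_ode {R R' : ℝ → G} {ε : ℝ}
    (hR : ∀ t ∈ Icc (0 : ℝ) 1, HasDerivWithinAt R (R' t) (Icc 0 1) t)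
    {δ : ℝ} (h0 : ‖R 0‖ ≤ δ) (hδ : 0 ≤ δ) (hε : 0 ≤ ε)
    (hbound : ∀ t ∈ Icc (0 : ℝ) 1, ‖R' t‖ ≤ ‖R t‖ + ε) :
    ∀ t ∈ Icc (0 : ℝ) 1, ‖R t‖ ≤ (δ + ε) * Real.exp 1 := by
  intro t ht
  have h := norm_le_gronwallBound_of_norm_deriv_right_le (f := R) (f' := R') (δ := δ) (K := 1)
    (ε := ε) (a := 0) (b := 1) (fun s hs => (hR s hs).continuousWithinAt)
    (fun s hs => ?_) h0 (fun s hs => by simpa using hbound s (Ico_subset_Icc_self hs)) t ht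
  · rw [gronwallBound_of_K_ne_0 one_ne_zero] at h
    have h1 : Real.exp t ≤ Real.exp 1 := Real.exp_le_exp.2 ht.2
    have h2 : 0 ≤ Real.exp 1 := (Real.exp_pos 1).le
    simp only [one_mul, sub_zero, div_one] at h
    nlinarith
  · exact ((hR s (Ico_subset_Icc_self hs)).mono_of_mem_nhdsWithin
      (mem_of_superset (Icc_mem_nhdsGE hs.2) (Icc_subset_Icc_left hs.1)))

set_option maxHeartbeats 400000 in
/-- The total differential equation `dX = A X` is solvable near `0` if it is flat. -/
theorem exists_parallel [CompleteSpace 𝔸] {A : E → E →L[ℝ] 𝔸} (hA : ContDiffAt ℝ 2 A 0)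
    (hflat : ∀ᶠ y in 𝓝 (0 : E), ∀ u v, fderiv ℝ A y u v + A y v * A y u =
      fderiv ℝ A y v u + A y u * A y v) :
    ∃ r > 0, ∀ X₀ : 𝔸, ∃ X : E → 𝔸, X 0 = X₀ ∧
      ∀ y ∈ ball (0 : E) r,
        HasFDerivAt X (((ContinuousLinearMap.mul ℝ 𝔸).flip (X y)) ∘L A y) y := by
  -- One constant `C ≥ 1` bounds `A`, its derivative and the Lipschitz constant of the derivative;
  -- taking it at least one later lets `C` be absorbed into `C ^ 2`.
  obtain ⟨C, hC1, ρ, hρ, hAb, hDb, hDl, hdiff, hfl⟩ : ∃ C : ℝ, 1 ≤ C ∧ ∃ ρ > 0,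
      (∀ y ∈ ball (0 : E) ρ, ‖A y‖ ≤ C) ∧ (∀ y ∈ ball (0 : E) ρ, ‖fderiv ℝ A y‖ ≤ C) ∧
      (∀ y ∈ ball (0 : E) ρ, ∀ z ∈ ball (0 : E) ρ,
        ‖fderiv ℝ A y - fderiv ℝ A z‖ ≤ C * ‖y - z‖) ∧
      (∀ y ∈ ball (0 : E) ρ, DifferentiableAt ℝ A y) ∧
      (∀ y ∈ ball (0 : E) ρ, ∀ u v, fderiv ℝ A y u v + A y v * A y u =
        fderiv ℝ A y v u + A y u * A y v) := by
    have hD : ContDiffAt ℝ 1 (fderiv ℝ A) 0 := hA.fderiv_right (by norm_num)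
    obtain ⟨K, s, hs, hK⟩ := hD.exists_lipschitzOnWith
    have e1 : ∀ᶠ y in 𝓝 (0 : E), ‖A y‖ < ‖A 0‖ + 1 :=
      hA.continuousAt.norm.eventually (gt_mem_nhds (by linarith))
    have e2 : ∀ᶠ y in 𝓝 (0 : E), ‖fderiv ℝ A y‖ < ‖fderiv ℝ A 0‖ + 1 :=
      (hD.continuousAt.eventually (ball_mem_nhds (fderiv ℝ A 0) one_pos)).mono
        fun y hy => norm_lt_of_mem_ball (E := E →L[ℝ] E →L[ℝ] 𝔸) hy
    have e3 : ∀ᶠ y in 𝓝 (0 : E), DifferentiableAt ℝ A y :=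
      (hA.eventually (by simp)).mono fun y hy => hy.differentiableAt (by norm_num)
    obtain ⟨ρ, hρ, hball⟩ := Metric.eventually_nhds_iff_ball.1
      (e1.and (e2.and (e3.and (hflat.and (eventually_mem_nhds_iff.2 hs)))))
    refine ⟨‖A 0‖ + 1 + (‖fderiv ℝ A 0‖ + 1) + K, ?_, ρ, hρ, fun y hy => ?_, fun y hy => ?_,
      fun y hy z hz => ?_, fun y hy => (hball y hy).2.2.1, fun y hy => (hball y hy).2.2.2.1⟩
    · have := norm_nonneg (A 0)
      have := norm_nonneg (fderiv ℝ A 0)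
      have := K.2
      simp only [NNReal.val_eq_coe] at this
      linarith
    · have := (hball y hy).1
      have := norm_nonneg (fderiv ℝ A 0)
      have := K.2
      simp only [NNReal.val_eq_coe] at this
      linarith
    · have := (hball y hy).2.1
      have := norm_nonneg (A 0)
      have := K.2
      simp only [NNReal.val_eq_coe] at this
      linarith
    · have h := hK.dist_le_mul y (mem_of_mem_nhds (hball y hy).2.2.2.2) z
        (mem_of_mem_nhds (hball z hz).2.2.2.2)
      rw [dist_eq_norm, dist_eq_norm] at h
      refine h.trans ?_
      gcongr
      have := norm_nonneg (A 0)
      have := norm_nonneg (fderiv ℝ A 0)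
      linarith
  have hC0 : 0 < C := by linarith
  have hlip : ∀ y ∈ ball (0 : E) ρ, ∀ z ∈ ball (0 : E) ρ, ‖A y - A z‖ ≤ C * ‖y - z‖ :=
    fun y hy z hz => (convex_ball 0 ρ).norm_image_sub_le_of_norm_fderiv_le hdiff hDb hz hy
  have htay : ∀ y ∈ ball (0 : E) ρ, ∀ z ∈ ball (0 : E) ρ,
      ‖A y - A z - fderiv ℝ A z (y - z)‖ ≤ C * ‖y - z‖ * ‖y - z‖ := by
    intro y hy z hz
    have hseg : segment ℝ z y ⊆ ball (0 : E) ρ := (convex_ball 0 ρ).segment_subset hz hy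
    refine (convex_segment z y).norm_image_sub_le_of_norm_fderiv_le' (fun x hx => hdiff x (hseg hx))
      (fun x hx => (hDl x (hseg hx) z hz).trans ?_) (left_mem_segment ℝ z y)
      (right_mem_segment ℝ z y)
    gcongr
    exact norm_sub_le_of_mem_segment hx
  -- With `‖y‖ < r` the coefficient `A(ty)y` along the ray through `y` has norm at most `1 / 2`, as
  -- the unit-time existence result requires.
  set r : ℝ := min ρ (1 / (2 * C)) with hr
  have hr0 : 0 < r := lt_min hρ (by positivity)
  have hrC : C * r ≤ 1 / 2 := by
    calc C * r ≤ C * (1 / (2 * C)) := by gcongr; exact min_le_right _ _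
      _ = 1 / 2 := by field_simp
  have hmem : ∀ y ∈ ball (0 : E) r, ∀ t ∈ Icc (0 : ℝ) 1, t • y ∈ ball (0 : E) ρ := by
    intro y hy t ht
    rw [mem_ball_zero_iff] at hy ⊢
    rw [norm_smul, Real.norm_of_nonneg ht.1]
    calc t * ‖y‖ ≤ 1 * ‖y‖ := by gcongr; exact ht.2
      _ < ρ := by rw [one_mul]; exact hy.trans_le (min_le_left _ _)
  have hab : ∀ y ∈ ball (0 : E) r, ∀ t ∈ Icc (0 : ℝ) 1, ‖A (t • y) y‖ ≤ 1 / 2 := by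
    intro y hy t ht
    refine ((A (t • y)).le_of_opNorm_le (hAb _ (hmem y hy t ht)) y).trans (le_trans ?_ hrC)
    rw [mem_ball_zero_iff] at hy
    gcongr
  refine ⟨r, hr0, fun X₀ => ?_⟩
  -- The equation is solved radially: `Z y` solves it along `t ↦ t y`, and the candidate solution is
  -- `X y = Z y 1`. Outside the ball `Z` is irrelevant.
  have hex : ∀ y : E, ∃ Z : ℝ → 𝔸, y ∈ ball (0 : E) r → (Z 0 = X₀ ∧
      ∀ t ∈ Icc (0 : ℝ) 1, HasDerivWithinAt Z (A (t • y) y * Z t) (Icc 0 1) t) := by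
    intro y
    by_cases hy : y ∈ ball (0 : E) r
    · have hc : ContinuousOn (fun t : ℝ => A (t • y) y) (Icc 0 1) := by
        intro t ht
        have h1 : ContinuousAt (fun t : ℝ => A (t • y)) t :=
          ContinuousAt.comp (f := fun t : ℝ => t • y) (g := A)
            (hdiff _ (hmem y hy t ht)).continuousAt (by fun_prop)
        exact (h1.clm_apply continuousAt_const).continuousWithinAt
      obtain ⟨Z, hZ⟩ := exists_linear_ode_solution hc (hab y hy) X₀
      exact ⟨Z, fun _ => hZ⟩
    · exact ⟨fun _ => 0, fun h => absurd h hy⟩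
  choose Z hZ using hex
  have hZb : ∀ y ∈ ball (0 : E) r, ∀ t ∈ Icc (0 : ℝ) 1, ‖Z y t‖ ≤ ‖X₀‖ * Real.exp 1 := by
    intro y hy t ht
    have h := norm_le_of_linear_ode (hZ y hy).2 (δ := ‖X₀‖) (ε := 0) (by rw [(hZ y hy).1])
      (norm_nonneg _) le_rfl (fun s hs => ?_) t ht
    · simpa using h
    · refine (norm_mul_le _ _).trans ?_
      have := norm_nonneg (Z y s)
      have := hab y hy s hs
      nlinarith
  set N : ℝ := ‖X₀‖ * Real.exp 1 with hN
  have hN0 : 0 ≤ N := by positivity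
  -- The expected variation of `Z y t` in direction `h = w - y` is `t A(ty)h Z y t`. The deviation
  -- from it vanishes at `t = 0` and satisfies a linear equation with an inhomogeneity of order
  -- `‖h‖²`, so Grönwall makes it quadratic in `h` at `t = 1`.
  have hkey : ∀ y ∈ ball (0 : E) r, ∀ w ∈ ball (0 : E) r,
      ‖Z w 1 - Z y 1 - A y (w - y) * Z y 1‖ ≤ (4 * C ^ 2 * N * Real.exp 1) * ‖w - y‖ ^ 2 := by
    intro y hy w hw
    set h : E := w - y with hh
    have hder : ∀ t ∈ Icc (0 : ℝ) 1, HasDerivWithinAt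
        (fun t => Z w t - Z y t - t • (A (t • y) h * Z y t))
        (A (t • w) w * Z w t - A (t • y) y * Z y t
          - (t • (fderiv ℝ A (t • y) y h * Z y t + A (t • y) h * (A (t • y) y * Z y t))
            + (1 : ℝ) • (A (t • y) h * Z y t)))
        (Icc 0 1) t := by
      intro t ht
      have d1 : HasDerivAt (fun t : ℝ => A (t • y)) (fderiv ℝ A (t • y) y) t := by
        have hd := (hdiff _ (hmem y hy t ht)).hasFDerivAt
        have hl : HasDerivAt (fun t : ℝ => t • y) y t := by
          simpa using (hasDerivAt_id t).smul_const y
        exact hd.comp_hasDerivAt t hl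
      have d2 : HasDerivAt (fun t : ℝ => A (t • y) h) (fderiv ℝ A (t • y) y h) t := by
        simpa using d1.clm_apply (hasDerivAt_const t h)
      have d3 := d2.hasDerivWithinAt.mul ((hZ y hy).2 t ht)
      exact (((hZ w hw).2 t ht).sub ((hZ y hy).2 t ht)).sub
        ((hasDerivAt_id' t).hasDerivWithinAt.smul d3)
    have hest : ∀ t ∈ Icc (0 : ℝ) 1,
        ‖A (t • w) w * Z w t - A (t • y) y * Z y t
          - (t • (fderiv ℝ A (t • y) y h * Z y t + A (t • y) h * (A (t • y) y * Z y t))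
            + (1 : ℝ) • (A (t • y) h * Z y t))‖
        ≤ ‖Z w t - Z y t - t • (A (t • y) h * Z y t)‖ + 4 * C ^ 2 * N * ‖h‖ ^ 2 := by
      intro t ht
      have hyt := hmem y hy t ht
      have hwt := hmem w hw t ht
      have hflt := congrArg (fun T : 𝔸 => T * Z y t) (hfl (t • y) hyt y h)
      simp only [add_mul, mul_assoc] at hflt
      have hsub : t • w - t • y = t • h := by rw [hh, smul_sub]
      have hnt : ‖t • h‖ ≤ ‖h‖ := by
        rw [norm_smul, Real.norm_of_nonneg ht.1]
        exact mul_le_of_le_one_left (norm_nonneg _) ht.2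
      have hy1 : ‖y‖ ≤ 1 / 2 := by
        have : ‖y‖ < r := by simpa using hy
        nlinarith
      have hT := htay _ hwt _ hyt
      have hLp := hlip _ hwt _ hyt
      rw [hsub] at hT hLp
      set z := Z y t
      have hz : ‖z‖ ≤ N := hZb y hy t ht
      have hw' : w = y + h := by rw [hh]; abel
      -- Flatness exchanges `y` and `h` in the derivative of `A`. What remains is the deviation
      -- multiplied by a bounded coefficient, plus a Taylor remainder of `A` and products of two
      -- factors of first order in `h`.
      have hsplit : A (t • w) w * Z w t - A (t • y) y * z
          - (t • (fderiv ℝ A (t • y) y h * z + A (t • y) h * (A (t • y) y * z))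
            + (1 : ℝ) • (A (t • y) h * z))
          = A (t • w) w * (Z w t - z - t • (A (t • y) h * z))
            + ((A (t • w) - A (t • y) - fderiv ℝ A (t • y) (t • h)) y * z
              + (A (t • w) - A (t • y)) h * z
              + ((A (t • w) - A (t • y)) y + A (t • w) h) * (t • (A (t • y) h * z))) := by
        rw [hflt]
        rw [show A (t • w) w = A (t • w) y + A (t • w) h by rw [← map_add, ← hw']]
        simp only [sub_apply, map_smul, smul_apply,
          smul_add, one_smul, mul_sub, sub_mul, add_mul, smul_sub, smul_mul_assoc, mul_smul_comm]
        abel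
      rw [hsplit]
      have b1 : ‖A (t • w) w * (Z w t - z - t • (A (t • y) h * z))‖ ≤
          ‖Z w t - z - t • (A (t • y) h * z)‖ := by
        refine (norm_mul_le _ _).trans ?_
        have := norm_nonneg (Z w t - z - t • (A (t • y) h * z))
        have := hab w hw t ht
        nlinarith
      have hn : 0 ≤ ‖h‖ := norm_nonneg h
      have b2 : ‖(A (t • w) - A (t • y) - fderiv ℝ A (t • y) (t • h)) y * z‖
          ≤ C * ‖h‖ * ‖h‖ * (1 / 2) * N := by
        refine (norm_mul_le _ _).trans ?_
        refine (mul_le_mul_of_nonneg_right (ContinuousLinearMap.le_opNorm _ _)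
          (norm_nonneg _)).trans ?_
        gcongr
        refine hT.trans ?_
        gcongr
      have b3 : ‖(A (t • w) - A (t • y)) h * z‖ ≤ C * ‖h‖ * ‖h‖ * N := by
        refine (norm_mul_le _ _).trans ?_
        refine (mul_le_mul_of_nonneg_right (ContinuousLinearMap.le_opNorm _ _)
          (norm_nonneg _)).trans ?_
        gcongr
        refine hLp.trans ?_
        gcongr
      have b4 : ‖t • (A (t • y) h * z)‖ ≤ C * ‖h‖ * N := by
        rw [norm_smul, Real.norm_of_nonneg ht.1]
        refine (mul_le_of_le_one_left (norm_nonneg _) ht.2).trans ?_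
        refine (norm_mul_le _ _).trans ?_
        refine (mul_le_mul_of_nonneg_right (ContinuousLinearMap.le_opNorm _ _)
          (norm_nonneg _)).trans ?_
        gcongr
        exact hAb _ hyt
      have b5 : ‖(A (t • w) - A (t • y)) y + A (t • w) h‖ ≤ C * ‖h‖ * (1 / 2) + C * ‖h‖ := by
        refine (norm_add_le _ _).trans (add_le_add ?_ ?_)
        · refine (ContinuousLinearMap.le_opNorm _ _).trans ?_
          gcongr
          refine hLp.trans ?_
          gcongr
        · refine (ContinuousLinearMap.le_opNorm _ _).trans ?_
          gcongr
          exact hAb _ hwt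
      have b6 : ‖((A (t • w) - A (t • y)) y + A (t • w) h) * (t • (A (t • y) h * z))‖
          ≤ (C * ‖h‖ * (1 / 2) + C * ‖h‖) * (C * ‖h‖ * N) := by
        refine (norm_mul_le _ _).trans ?_
        gcongr
      have hCC : C ≤ C ^ 2 := by nlinarith
      refine (norm_add_le _ _).trans (add_le_add b1 ?_)
      refine (norm_add₃_le).trans ?_
      have hq : 0 ≤ ‖h‖ ^ 2 * N := by positivity
      have hq2 : C * (‖h‖ ^ 2 * N) ≤ C ^ 2 * (‖h‖ ^ 2 * N) := by gcongr
      have e1 : C * ‖h‖ * ‖h‖ * (1 / 2) * N = 1 / 2 * (C * (‖h‖ ^ 2 * N)) := by ring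
      have e2 : C * ‖h‖ * ‖h‖ * N = C * (‖h‖ ^ 2 * N) := by ring
      have e3 : (C * ‖h‖ * (1 / 2) + C * ‖h‖) * (C * ‖h‖ * N) =
          3 / 2 * (C ^ 2 * (‖h‖ ^ 2 * N)) := by
        ring
      have e4 : 4 * C ^ 2 * N * ‖h‖ ^ 2 = 4 * (C ^ 2 * (‖h‖ ^ 2 * N)) := by ring
      have h5 : 0 ≤ C ^ 2 * (‖h‖ ^ 2 * N) := by positivity
      linarith
    have hfin := norm_le_of_linear_ode hder (δ := 0)
      (by simp [(hZ y hy).1, (hZ w hw).1]) le_rfl (by positivity) hest 1 (by simp)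
    simp only [one_smul, zero_add] at hfin
    refine hfin.trans (le_of_eq ?_)
    ring
  refine ⟨fun y => Z y 1, ?_, fun y hy => ?_⟩
  -- Along the degenerate ray at `0` the coefficient `A(0)0` vanishes, so the solution stays equal
  -- to `X₀`.
  · have h0 : (0 : E) ∈ ball (0 : E) r := by simpa using hr0
    have h := norm_le_of_linear_ode (R := fun t => Z 0 t - X₀) (R' := fun _ => 0) (δ := 0) (ε := 0)
      (fun t ht => by simpa using ((hZ 0 h0).2 t ht).sub_const X₀) (by simp [(hZ 0 h0).1]) le_rfl
      le_rfl (fun t _ => by simp) 1 (by simp)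
    simpa [sub_eq_zero] using h
  · rw [hasFDerivAt_iff_isLittleO]
    have hO : (fun w => Z w 1 - Z y 1 - ((ContinuousLinearMap.mul ℝ 𝔸).flip (Z y 1) ∘L A y) (w - y))
        =O[𝓝 y]
        fun w => ‖w - y‖ ^ 2 := by
      refine Asymptotics.IsBigO.of_bound (4 * C ^ 2 * N * Real.exp 1) ?_
      filter_upwards [isOpen_ball.mem_nhds hy] with w hw
      simpa [sub_mul] using hkey y hy w hw
    refine hO.trans_isLittleO ?_
    have := Asymptotics.isLittleO_norm_pow_id (E' := E) (one_lt_two)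
    have ht : Tendsto (fun w => w - y) (𝓝 y) (𝓝 0) := by
      simpa using (continuous_id.sub continuous_const).tendsto y (f := fun w : E => w - y)
    simpa [Function.comp_def] using this.comp_tendsto ht

end Parallel

/-! ### Regularity of parallel solutions -/

section ParallelSmooth

open Set Metric Filter
open scoped Topology

variable {E : Type*} [NormedAddCommGroup E] [NormedSpace ℝ E]
  {𝔸 : Type*} [NormedRing 𝔸] [NormedAlgebra ℝ 𝔸]

/-- Bootstrapping: the equation expresses the derivative of `X` through `X` and `A`, so each order
of differentiability of `X` yields the next. -/
theorem contDiffOn_of_parallel {A : E → E →L[ℝ] 𝔸} {s : Set E} (hs : IsOpen s)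
    (hA : ContDiffOn ℝ ∞ A s) {X : E → 𝔸}
    (hX : ∀ y ∈ s, HasFDerivAt X (((ContinuousLinearMap.mul ℝ 𝔸).flip (X y)) ∘L A y) y) :
    ContDiffOn ℝ ∞ X s := by
  rw [contDiffOn_infty]
  intro n
  induction n with
  | zero =>
    exact contDiffOn_zero.2 fun y hy => (hX y hy).continuousAt.continuousWithinAt
  | succ n ih =>
    have h1 : ContDiffOn ℝ n (fun y => ((ContinuousLinearMap.mul ℝ 𝔸).flip (X y)) ∘L A y) s :=
      ((ContinuousLinearMap.mul ℝ 𝔸).flip.contDiff.comp_contDiffOn ih).clm_comp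
        (hA.of_le (by exact_mod_cast le_top))
    rw [Nat.cast_succ, contDiffOn_succ_iff_fderiv_of_isOpen hs]
    refine ⟨fun y hy => (hX y hy).differentiableAt.differentiableWithinAt, by simp, ?_⟩
    exact h1.congr fun y hy => (hX y hy).fderiv

end ParallelSmooth

/-! ### Christoffel symbols of a matrix-valued function -/

section Christoffel

open Set Metric Filter
open scoped Topology

variable {E : Type*} [NormedAddCommGroup E] [NormedSpace ℝ E]
  {E' : Type*} [NormedAddCommGroup E'] [NormedSpace ℝ E']
  {ι : Type*} [Fintype ι] [DecidableEq ι] (b : Module.Basis ι ℝ E)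

/-- The Christoffel symbols of the metric with matrix `h` in the coordinates given by `b`. -/
def christoffelOf (h : E → Matrix ι ι ℝ) (y : E) (k i j : ι) : ℝ :=
  (1 / 2) * ∑ l, (h y)⁻¹ k l *
    (fderiv ℝ (fun y' => h y' j l) y (b i) + fderiv ℝ (fun y' => h y' i l) y (b j)
      - fderiv ℝ (fun y' => h y' i j) y (b l))

theorem christoffel_eq_christoffelOf {H : Type*} [TopologicalSpace H] (I : ModelWithCorners ℝ E H)
    {M : Type*} [TopologicalSpace M] [ChartedSpace H M]
    (g : ∀ x : M, TangentSpace I x → TangentSpace I x → ℝ) (e : OpenPartialHomeomorph M H) :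
    christoffel I b g e = christoffelOf b (metricMatrix I b g e) := rfl

theorem christoffelOf_symm {h : E → Matrix ι ι ℝ} {y : E} (hs : ∀ᶠ y' in 𝓝 y, (h y').IsSymm)
    (k i j : ι) : christoffelOf b h y k i j = christoffelOf b h y k j i := by
  have h1 : fderiv ℝ (fun y' => h y' i j) y = fderiv ℝ (fun y' => h y' j i) y :=
    Filter.EventuallyEq.fderiv_eq (hs.mono fun y' hy' => (hy'.apply i j).symm)
  simp only [christoffelOf, h1]
  congr 1
  refine Finset.sum_congr rfl fun l _ => ?_
  ring

/-- Lowering the upper index cancels the inverse matrix and leaves the Christoffel symbols of the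
first kind. -/
theorem sum_mul_christoffelOf {h : E → Matrix ι ι ℝ} {y : E} (hu : IsUnit (h y).det)
    (l i j : ι) : ∑ k, h y l k * christoffelOf b h y k i j =
      (1 / 2) * (fderiv ℝ (fun y' => h y' j l) y (b i) + fderiv ℝ (fun y' => h y' i l) y (b j)
        - fderiv ℝ (fun y' => h y' i j) y (b l)) := by
  set R : ι → ℝ := fun l => (1 / 2) * (fderiv ℝ (fun y' => h y' j l) y (b i)
    + fderiv ℝ (fun y' => h y' i l) y (b j) - fderiv ℝ (fun y' => h y' i j) y (b l)) with hR
  have hΓ : (fun k => christoffelOf b h y k i j) = Matrix.mulVec (h y)⁻¹ R := by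
    ext k
    simp only [christoffelOf, Matrix.mulVec, dotProduct, hR, Finset.mul_sum]
    refine Finset.sum_congr rfl fun l _ => ?_
    ring
  have := congrArg (fun v => Matrix.mulVec (h y) v l) hΓ
  simp only [Matrix.mulVec_mulVec, Matrix.mul_nonsing_inv _ hu, Matrix.one_mulVec] at this
  simpa only [Matrix.mulVec, dotProduct, hR] using this

/-- The Levi-Civita connection is compatible with the metric. -/
theorem fderiv_eq_sum_christoffelOf {h : E → Matrix ι ι ℝ} {y : E} (hu : IsUnit (h y).det)
    (hs : ∀ᶠ y' in 𝓝 y, (h y').IsSymm) (l i j : ι) :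
    fderiv ℝ (fun y' => h y' i j) y (b l) =
      ∑ k, h y j k * christoffelOf b h y k l i + ∑ k, h y i k * christoffelOf b h y k l j := by
  have h1 : ∀ i j, fderiv ℝ (fun y' => h y' i j) y = fderiv ℝ (fun y' => h y' j i) y :=
    fun i j => Filter.EventuallyEq.fderiv_eq (hs.mono fun y' hy' => (hy'.apply i j).symm)
  rw [sum_mul_christoffelOf b hu, sum_mul_christoffelOf b hu, h1 j i, h1 l i, h1 l j]
  ring

/-- A vector `a` in the kernel of `m` gives `x = ∑ a_j b_j` with `B(Tx, Tx) = 0`; definiteness and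
injectivity force `x = 0`. -/
theorem isUnit_det_of_pullback {m : Matrix ι ι ℝ} {B : E' →L[ℝ] E' →L[ℝ] ℝ}
    (hB : ∀ v, B v v = 0 → v = 0) {T : E →L[ℝ] E'} (hT : Function.Injective T)
    (hm : ∀ i j, m i j = B (T (b i)) (T (b j))) : IsUnit m.det := by
  rw [← Matrix.isUnit_iff_isUnit_det]
  refine Matrix.mulVec_injective_iff_isUnit.1 ?_
  refine (injective_iff_map_eq_zero (Matrix.mulVecLin m)).2 ?_
  intro a ha
  set x : E := ∑ j, a j • b j with hx
  have h1 : ∀ i, B (T (b i)) (T x) = 0 := by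
    intro i
    have := congrFun ha i
    simp only [Matrix.mulVecLin_apply, Matrix.mulVec, dotProduct, Pi.zero_apply, hm] at this
    rw [← this, hx, map_sum, map_sum]
    refine Finset.sum_congr rfl fun j _ => ?_
    rw [map_smul, map_smul, smul_eq_mul, mul_comm]
  have h2 : B (T x) (T x) = 0 := by
    have e1 : B (T x) = ∑ i, a i • B (T (b i)) := by simp [hx, map_sum]
    rw [e1, sum_apply]
    refine Finset.sum_eq_zero fun i _ => ?_
    rw [smul_apply, h1, smul_zero]
  have h3 : x = 0 := hT (by rw [hB _ h2, map_zero])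
  have h4 := congrArg b.repr h3
  ext j
  have := congrArg (fun f => f j) h4
  simpa only [hx, b.repr_sum_self, map_zero, Finsupp.coe_zero, Pi.zero_apply] using this

/-- In coordinates, the second derivative of a flat coordinate system is given by the Christoffel
symbols. -/
theorem fderiv_fderiv_eq_christoffelOf {h : E → Matrix ι ι ℝ} {y : E} {B : E' →L[ℝ] E' →L[ℝ] ℝ}
    (hBs : ∀ v w, B v w = B w v) (hB : ∀ v, B v v = 0 → v = 0) {χ : E → E'}
    (hχ : ContDiffAt ℝ 2 χ y) (hinj : Function.Injective (fderiv ℝ χ y))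
    (hsurj : Function.Surjective (fderiv ℝ χ y))
    (hh : ∀ᶠ y' in 𝓝 y, ∀ i j, h y' i j = B (fderiv ℝ χ y' (b i)) (fderiv ℝ χ y' (b j)))
    (i j : ι) : fderiv ℝ (fderiv ℝ χ) y (b i) (b j) =
      ∑ k, christoffelOf b h y k i j • fderiv ℝ χ y (b k) := by
  have hu : IsUnit (h y).det := isUnit_det_of_pullback b hB hinj hh.self_of_nhds
  have hD : HasFDerivAt (fderiv ℝ χ) (fderiv ℝ (fderiv ℝ χ) y) y :=
    ((hχ.fderiv_right (m := 1) (by norm_num)).differentiableAt one_ne_zero).hasFDerivAt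
  have hsym : ∀ u v, fderiv ℝ (fderiv ℝ χ) y u v = fderiv ℝ (fderiv ℝ χ) y v u :=
    fun u v => (hχ.isSymmSndFDerivAt (by simp)) u v
  have hdh : ∀ i j, ∀ u, fderiv ℝ (fun y' => h y' i j) y u =
      B (fderiv ℝ (fderiv ℝ χ) y u (b i)) (fderiv ℝ χ y (b j)) +
      B (fderiv ℝ χ y (b i)) (fderiv ℝ (fderiv ℝ χ) y u (b j)) := by
    intro i j u
    have e1 : (fun y' => h y' i j) =ᶠ[𝓝 y] fun y' =>
        B (fderiv ℝ χ y' (b i)) (fderiv ℝ χ y' (b j)) := hh.mono fun y' hy' => hy' i j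
    rw [e1.fderiv_eq]
    have hi := hD.clm_apply (hasFDerivAt_const (b i) y)
    have hj := hD.clm_apply (hasFDerivAt_const (b j) y)
    rw [(B.hasFDerivAt_of_bilinear hi hj).fderiv]
    simp [add_comm]
  -- The second derivative is written as `Dχ x`; the Koszul combination of the derivatives of `h`,
  -- together with the symmetry of the second derivative, then identifies the components of `x` with
  -- the Christoffel symbols.
  obtain ⟨x, hx⟩ := hsurj (fderiv ℝ (fderiv ℝ χ) y (b i) (b j))
  have hR : ∀ l, (1 / 2) * (fderiv ℝ (fun y' => h y' j l) y (b i)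
      + fderiv ℝ (fun y' => h y' i l) y (b j) - fderiv ℝ (fun y' => h y' i j) y (b l)) =
      ∑ k, h y l k * b.repr x k := by
    intro l
    have e1 : ∑ k, h y l k * b.repr x k = B (fderiv ℝ χ y (b l)) (fderiv ℝ χ y x) := by
      conv_rhs => rw [← b.sum_repr x, map_sum, map_sum]
      refine Finset.sum_congr rfl fun k _ => ?_
      rw [map_smul, map_smul, hh.self_of_nhds, smul_eq_mul, mul_comm]
    rw [e1, hx, hdh, hdh, hdh, hsym (b j) (b i), hsym (b l) (b i), hsym (b l) (b j),
      hBs (fderiv ℝ χ y (b l)), hBs (fderiv ℝ (fderiv ℝ χ) y (b i) (b l))]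
    ring
  have hΓ : ∀ k, christoffelOf b h y k i j = b.repr x k := by
    intro k
    have : christoffelOf b h y k i j =
        Matrix.mulVec (h y)⁻¹ (Matrix.mulVec (h y) (b.repr x)) k := by
      have e1 : Matrix.mulVec (h y) (b.repr x) = fun l => (1 / 2) *
          (fderiv ℝ (fun y' => h y' j l) y (b i) + fderiv ℝ (fun y' => h y' i l) y (b j)
            - fderiv ℝ (fun y' => h y' i j) y (b l)) := funext fun l => (hR l).symm
      rw [e1]
      simp only [christoffelOf, Matrix.mulVec, dotProduct, Finset.mul_sum]
      refine Finset.sum_congr rfl fun l _ => ?_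
      ring
    rw [this, Matrix.mulVec_mulVec, Matrix.nonsing_inv_mul _ hu, Matrix.one_mulVec]
  simp only [hΓ]
  rw [← hx]
  conv_lhs => rw [← b.sum_repr x, map_sum]
  simp only [map_smul]

theorem fderiv_fderiv_apply_eq_christoffelOf {h : E → Matrix ι ι ℝ} {y : E}
    {B : E' →L[ℝ] E' →L[ℝ] ℝ}
    (hBs : ∀ v w, B v w = B w v) (hB : ∀ v, B v v = 0 → v = 0) {χ : E → E'}
    (hχ : ContDiffAt ℝ 2 χ y) (hinj : Function.Injective (fderiv ℝ χ y))
    (hsurj : Function.Surjective (fderiv ℝ χ y))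
    (hh : ∀ᶠ y' in 𝓝 y, ∀ i j, h y' i j = B (fderiv ℝ χ y' (b i)) (fderiv ℝ χ y' (b j)))
    (u v : E) : fderiv ℝ (fderiv ℝ χ) y u v =
      ∑ k, (∑ i, ∑ j, christoffelOf b h y k i j * b.repr u i * b.repr v j) •
        fderiv ℝ χ y (b k) := by
  conv_lhs => rw [← b.sum_repr u, ← b.sum_repr v]
  simp only [map_sum, map_smul, sum_apply, smul_apply,
    fderiv_fderiv_eq_christoffelOf b hBs hB hχ hinj hsurj hh, Finset.smul_sum, Finset.sum_smul,
    smul_smul]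
  conv_rhs => rw [Finset.sum_comm]; enter [2, i]; rw [Finset.sum_comm]
  rw [Finset.sum_comm]
  refine Finset.sum_congr rfl fun i _ => Finset.sum_congr rfl fun j _ =>
    Finset.sum_congr rfl fun k _ => ?_
  congr 1
  ring

/-- A map between flat spaces that preserves the metrics is affine. -/
theorem fderiv_fderiv_eq_zero_of_isometry {B : E →L[ℝ] E →L[ℝ] ℝ} {B' : E' →L[ℝ] E' →L[ℝ] ℝ}
    (hBs : ∀ v w, B' v w = B' w v) (hB : ∀ v, B' v v = 0 → v = 0) {χ : E → E'} {y : E}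
    (hχ : ContDiffAt ℝ 2 χ y) (hsurj : Function.Surjective (fderiv ℝ χ y))
    (hh : ∀ᶠ y' in 𝓝 y, ∀ v w, B v w = B' (fderiv ℝ χ y' v) (fderiv ℝ χ y' w)) :
    fderiv ℝ (fderiv ℝ χ) y = 0 := by
  have hD : HasFDerivAt (fderiv ℝ χ) (fderiv ℝ (fderiv ℝ χ) y) y :=
    ((hχ.fderiv_right (m := 1) (by norm_num)).differentiableAt one_ne_zero).hasFDerivAt
  have hsym : ∀ u v, fderiv ℝ (fderiv ℝ χ) y u v = fderiv ℝ (fderiv ℝ χ) y v u :=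
    fun u v => (hχ.isSymmSndFDerivAt (by simp)) u v
  have hanti : ∀ u v w, B' (fderiv ℝ (fderiv ℝ χ) y u v) (fderiv ℝ χ y w) =
      - B' (fderiv ℝ (fderiv ℝ χ) y u w) (fderiv ℝ χ y v) := by
    intro u v w
    have hv := hD.clm_apply (hasFDerivAt_const v y)
    have hw := hD.clm_apply (hasFDerivAt_const w y)
    have h1 := (B'.hasFDerivAt_of_bilinear hv hw).fderiv
    have e1 : (fun y' => B' (fderiv ℝ χ y' v) (fderiv ℝ χ y' w)) =ᶠ[𝓝 y] fun _ => B v w :=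
      hh.mono fun y' hy' => (hy' v w).symm
    rw [e1.fderiv_eq, fderiv_fun_const] at h1
    have h2 := congrArg (fun T : E →L[ℝ] ℝ => T u) h1
    simp only [Pi.zero_apply, zero_apply, ContinuousLinearMap.precompR_apply, add_apply,
      ContinuousLinearMap.precompL_apply, ContinuousLinearMap.comp_zero, zero_add,
      ContinuousLinearMap.flip_apply, ContinuousLinearMap.compL_apply,
      ContinuousLinearMap.comp_apply] at h2
    rw [hBs (fderiv ℝ (fderiv ℝ χ) y u w)]
    linarith
  -- The trilinear form `B'(χ''(u, v), χ' w)` is symmetric in `u, v` and antisymmetric in `v, w`;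
  -- such a form vanishes.
  have h0 : ∀ u v w, B' (fderiv ℝ (fderiv ℝ χ) y u v) (fderiv ℝ χ y w) = 0 := by
    intro u v w
    have h1 := hanti u v w
    have h2 := hanti w u v
    have h3 := hanti v w u
    rw [hsym w u] at h2
    rw [hsym v w, hsym v u] at h3
    linarith
  ext u v
  obtain ⟨x, hx⟩ := hsurj (fderiv ℝ (fderiv ℝ χ) y u v)
  exact hB _ (by simpa only [hx] using h0 u v x)

omit [DecidableEq ι] in
/-- The equation of geodesics in coordinates: a curve satisfies it if and only if its second
derivative in a flat coordinate system vanishes. -/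
theorem deriv_deriv_comp_eq_zero_iff {Γ : ι → ι → ι → ℝ} {χ : E → E'} {u : ℝ → E} {t : ℝ}
    (hχ : ContDiffAt ℝ 2 χ (u t)) (hu : ContDiffAt ℝ 2 u t)
    (hinj : Function.Injective (fderiv ℝ χ (u t)))
    (hΓ : ∀ v w, fderiv ℝ (fderiv ℝ χ) (u t) v w =
      ∑ k, (∑ i, ∑ j, Γ k i j * b.repr v i * b.repr w j) • fderiv ℝ χ (u t) (b k)) :
    deriv (deriv (fun s => χ (u s))) t = 0 ↔
      ∀ k, deriv (deriv (fun s => b.repr (u s) k)) t +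
        ∑ i, ∑ j, Γ k i j * deriv (fun s => b.repr (u s) i) t
          * deriv (fun s => b.repr (u s) j) t = 0 := by
  have hu1 : ∀ᶠ s in 𝓝 t, DifferentiableAt ℝ u s :=
    (hu.eventually (by simp)).mono fun s hs => hs.differentiableAt (by norm_num)
  have hχ1 : ∀ᶠ s in 𝓝 t, DifferentiableAt ℝ χ (u s) :=
    hu.continuousAt.eventually
      ((hχ.eventually (by simp)).mono fun s hs => hs.differentiableAt (by norm_num))
  have hd1 : deriv (fun s => χ (u s)) =ᶠ[𝓝 t] fun s => fderiv ℝ χ (u s) (deriv u s) := by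
    filter_upwards [hu1, hχ1] with s h1 h2
    exact (h2.hasFDerivAt.comp_hasDerivAt s h1.hasDerivAt).deriv
  have hD : HasFDerivAt (fderiv ℝ χ) (fderiv ℝ (fderiv ℝ χ) (u t)) (u t) :=
    ((hχ.fderiv_right (m := 1) (by norm_num)).differentiableAt one_ne_zero).hasFDerivAt
  have hu2 : HasDerivAt (deriv u) (deriv (deriv u) t) t := by
    have h1 : ContDiffAt ℝ 1 (fderiv ℝ u) t := hu.fderiv_right (by norm_num)
    have h2 : DifferentiableAt ℝ (fun s => fderiv ℝ u s 1) t :=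
      (h1.differentiableAt one_ne_zero).clm_apply (differentiableAt_const _)
    exact (DifferentiableAt.hasDerivAt h2)
  have hd2 : deriv (deriv (fun s => χ (u s))) t =
      fderiv ℝ (fderiv ℝ χ) (u t) (deriv u t) (deriv u t) +
        fderiv ℝ χ (u t) (deriv (deriv u) t) := by
    rw [hd1.deriv_eq]
    exact ((hD.comp_hasDerivAt t hu1.self_of_nhds.hasDerivAt).clm_apply hu2).deriv
  have hfd : FiniteDimensional ℝ E := b.finiteDimensional_of_finite
  have hc : ∀ k, ∀ᶠ s in 𝓝 t, HasDerivAt (fun s => b.repr (u s) k) (b.repr (deriv u s) k) s := by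
    intro k
    filter_upwards [hu1] with s hs
    exact ((b.coord k).toContinuousLinearMap.hasFDerivAt (x := u s)).comp_hasDerivAt s
      hs.hasDerivAt
  have hc1 : ∀ k, deriv (fun s => b.repr (u s) k) t = b.repr (deriv u t) k :=
    fun k => (hc k).self_of_nhds.deriv
  have hc2 : ∀ k, deriv (deriv (fun s => b.repr (u s) k)) t = b.repr (deriv (deriv u) t) k := by
    intro k
    have : deriv (fun s => b.repr (u s) k) =ᶠ[𝓝 t] fun s => b.repr (deriv u s) k :=
      (hc k).mono fun s hs => hs.deriv
    rw [this.deriv_eq]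
    exact (((b.coord k).toContinuousLinearMap.hasFDerivAt (x := deriv u t)).comp_hasDerivAt t
      hu2).deriv
  -- The chain rule shows that `(χ ∘ u)''` is the image under `Dχ` of the left-hand side of the
  -- geodesic equation; injectivity of `Dχ` then gives both implications.
  have hsum : deriv (deriv (fun s => χ (u s))) t = fderiv ℝ χ (u t)
      (∑ k, (b.repr (deriv (deriv u) t) k +
        ∑ i, ∑ j, Γ k i j * b.repr (deriv u t) i * b.repr (deriv u t) j) • b k) := by
    rw [hd2, hΓ]
    conv_lhs => rw [← b.sum_repr (deriv (deriv u) t)]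
    simp only [map_sum, map_smul, add_smul, Finset.sum_add_distrib, map_add]
    rw [add_comm]
  rw [hsum, map_eq_zero_iff _ hinj]
  simp only [hc1, hc2]
  constructor
  · intro h0 k
    have := congrArg (fun x => b.repr x k) h0
    simpa only [b.repr_sum_self, map_zero, Finsupp.coe_zero, Pi.zero_apply] using this
  · intro h0
    simp [h0]

end Christoffel

/-! ### Flat coordinates -/

section FlatCoord

set_option maxSynthPendingDepth 3
set_option maxHeartbeats 400000

open Set Metric Filter
open scoped Topology

variable {E : Type*} [NormedAddCommGroup E] [NormedSpace ℝ E]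
  {ι : Type*} [Fintype ι] [DecidableEq ι]

theorem contDiffOn_matrix_det {n : WithTop ℕ∞} {m : E → Matrix ι ι ℝ} {s : Set E}
    (hm : ∀ i j, ContDiffOn ℝ n (fun y => m y i j) s) :
    ContDiffOn ℝ n (fun y => (m y).det) s := by
  simp only [Matrix.det_apply]
  refine ContDiffOn.sum fun p _ => ContDiffOn.const_smul _ ?_
  exact contDiffOn_prod fun i _ => hm _ _

theorem contDiffOn_matrix_inv {n : WithTop ℕ∞} {m : E → Matrix ι ι ℝ} {s : Set E}
    (hm : ∀ i j, ContDiffOn ℝ n (fun y => m y i j) s) (hu : ∀ y ∈ s, IsUnit (m y).det) (i j : ι) :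
    ContDiffOn ℝ n (fun y => (m y)⁻¹ i j) s := by
  have h1 : ContDiffOn ℝ n (fun y => ((m y).det)⁻¹ * (m y).adjugate i j) s := by
    refine ((contDiffOn_matrix_det hm).inv fun y hy => (hu y hy).ne_zero).mul ?_
    simp only [Matrix.adjugate_apply]
    refine contDiffOn_matrix_det fun k l => ?_
    by_cases hk : k = j
    · subst hk
      simpa using contDiffOn_const
    · simpa [Matrix.updateRow_ne hk] using hm k l
  refine h1.congr fun y _ => ?_
  simp [Matrix.inv_def]

variable (b : Module.Basis ι ℝ E)

omit [Fintype ι] [DecidableEq ι] in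
theorem basis_induction {p : E → Prop} (hb : ∀ i, p (b i)) (hadd : ∀ x y, p x → p y → p (x + y))
    (hsmul : ∀ (c : ℝ) x, p x → p (c • x)) (h0 : p 0) (x : E) : p x := by
  have hx : x ∈ Submodule.span ℝ (range b) := by rw [b.span_eq]; trivial
  induction hx using Submodule.span_induction with
  | mem x hx => obtain ⟨i, rfl⟩ := hx; exact hb i
  | zero => exact h0
  | add x y _ _ hx hy => exact hadd x y hx hy
  | smul c x _ hx => exact hsmul c x hx

/-- The components of the curvature tensor of the metric with matrix `h`. -/
def curvatureOf (h : E → Matrix ι ι ℝ) (y : E) (l k i j : ι) : ℝ :=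
  fderiv ℝ (fun y' => christoffelOf b h y' l j k) y (b i)
    - fderiv ℝ (fun y' => christoffelOf b h y' l i k) y (b j)
    + ∑ m, (christoffelOf b h y l i m * christoffelOf b h y m j k
      - christoffelOf b h y l j m * christoffelOf b h y m i k)

theorem contDiffOn_christoffelOf {h : E → Matrix ι ι ℝ} {s : Set E} (hs : IsOpen s)
    (hh : ∀ i j, ContDiffOn ℝ ∞ (fun y => h y i j) s) (hu : ∀ y ∈ s, IsUnit (h y).det)
    (k i j : ι) : ContDiffOn ℝ ∞ (fun y => christoffelOf b h y k i j) s := by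
  have hd : ∀ i j v, ContDiffOn ℝ ∞ (fun y => fderiv ℝ (fun y' => h y' i j) y v) s :=
    fun i j v => ((hh i j).fderiv_of_isOpen hs (by simp)).clm_apply contDiffOn_const
  refine contDiffOn_const.mul (ContDiffOn.sum fun l _ => ?_)
  exact (contDiffOn_matrix_inv hh hu k l).mul (((hd _ _ _).add (hd _ _ _)).sub (hd _ _ _))

variable [FiniteDimensional ℝ E]

/-- The bilinear form with a given matrix. -/
def bilinOf (m : Matrix ι ι ℝ) : E →L[ℝ] E →L[ℝ] ℝ :=
  ∑ i, ∑ j, m i j • (b.coord i).toContinuousLinearMap.smulRight (b.coord j).toContinuousLinearMap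

omit [DecidableEq ι] in
theorem bilinOf_apply (m : Matrix ι ι ℝ) (v w : E) :
    bilinOf b m v w = ∑ i, ∑ j, m i j * (b.repr v i * b.repr w j) := by
  simp [bilinOf, sum_apply]

theorem bilinOf_basis (m : Matrix ι ι ℝ) (i j : ι) : bilinOf b m (b i) (b j) = m i j := by
  rw [bilinOf_apply, Finset.sum_eq_single i, Finset.sum_eq_single j] <;>
    simp +contextual [Finsupp.single_apply, eq_comm]

/-- The bilinear map `(v, w) ↦ Γ^k_{ij} v^i w^j ∂/∂x^k`, as a linear function of `Γ`. -/
def christMap : (ι → ι → ι → ℝ) →L[ℝ] (E →L[ℝ] E →L[ℝ] E) :=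
  LinearMap.toContinuousLinearMap
    (∑ k, ∑ i, ∑ j, (LinearMap.proj (R := ℝ) (φ := fun _ : ι => ℝ) j ∘ₗ
      LinearMap.proj (R := ℝ) (φ := fun _ : ι => ι → ℝ) i ∘ₗ
      LinearMap.proj (R := ℝ) (φ := fun _ : ι => ι → ι → ℝ) k).smulRight
      ((b.coord i).toContinuousLinearMap.smulRight
        ((b.coord j).toContinuousLinearMap.smulRight (b k))))

theorem christMap_basis (Γ : ι → ι → ι → ℝ) (i j : ι) :
    christMap b Γ (b i) (b j) = ∑ k, Γ k i j • b k := by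
  simp only [christMap, LinearMap.coe_toContinuousLinearMap', LinearMap.sum_apply, sum_apply,
    LinearMap.smulRight_apply, smul_apply]
  refine Finset.sum_congr rfl fun k _ => ?_
  rw [Finset.sum_eq_single i, Finset.sum_eq_single j] <;>
    simp +contextual [Finsupp.single_apply, eq_comm]

omit [FiniteDimensional ℝ E] in
-- The system `dθ = θ ∘ Γ`, `dψ = θ` is linear in the pair `(θ, ψ)`, so it is one equation `dX = A
-- X` in an algebra acting on such pairs, with `A = S₁ ∘ Γ + S₂`. Here `S₁ C` stands for `(T, v) ↦
-- (T ∘ C, 0)`, `S₂ w` for `(T, v) ↦ (0, T w)`, and `p₁`, `p₂` read off the two components of the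
-- solution that starts at `(id, 0)`. Only the multiplication rules of these symbols matter.
theorem exists_parallel_coord_aux {𝔸 : Type*} [NormedRing 𝔸] [NormedAlgebra ℝ 𝔸] [CompleteSpace 𝔸]
    {S₁ : (E →L[ℝ] E) →L[ℝ] 𝔸} {S₂ : E →L[ℝ] 𝔸} {p₁ : 𝔸 →L[ℝ] (E →L[ℝ] E)} {p₂ : 𝔸 →L[ℝ] E}
    (h11 : ∀ C D, S₁ C * S₁ D = S₁ (D ∘L C)) (h21 : ∀ v C, S₂ v * S₁ C = S₂ (C v))
    (h12 : ∀ v C, S₁ C * S₂ v = 0) (h22 : ∀ v w, S₂ v * S₂ w = 0)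
    (hp11 : ∀ C X, p₁ (S₁ C * X) = p₁ X ∘L C) (hp21 : ∀ C X, p₂ (S₁ C * X) = 0)
    (hp12 : ∀ v X, p₁ (S₂ v * X) = 0) (hp22 : ∀ v X, p₂ (S₂ v * X) = p₁ X v)
    (hp1 : p₁ 1 = ContinuousLinearMap.id ℝ E) (hp2 : p₂ 1 = 0)
    {Γ : E → E →L[ℝ] E →L[ℝ] E} {s : Set E} (hs : IsOpen s) {y₀ : E}
    (hy₀ : y₀ ∈ s) (hΓ : ContDiffOn ℝ ∞ Γ s) (hsym : ∀ y ∈ s, ∀ u v, Γ y u v = Γ y v u)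
    (hflat : ∀ y ∈ s, ∀ u v w, fderiv ℝ Γ y u v w + Γ y u (Γ y v w) =
      fderiv ℝ Γ y v u w + Γ y v (Γ y u w)) :
    ∃ r > 0, ball y₀ r ⊆ s ∧ ∃ (θ : E → E →L[ℝ] E) (ψ : E → E),
      θ y₀ = ContinuousLinearMap.id ℝ E ∧ ψ y₀ = 0 ∧ ContDiffOn ℝ ∞ ψ (ball y₀ r) ∧
      (∀ y ∈ ball y₀ r, HasFDerivAt ψ (θ y) y) ∧
      ∀ y ∈ ball y₀ r, ∀ w, HasFDerivAt (fun y => θ y w) (θ y ∘L (Γ y).flip w) y := by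
  set A : E → E →L[ℝ] 𝔸 := fun z => S₁ ∘L Γ (y₀ + z) + S₂ with hA
  have hAv : ∀ z v, A z v = S₁ (Γ (y₀ + z) v) + S₂ v := fun z v => rfl
  obtain ⟨ρ, hρ, hball⟩ := Metric.isOpen_iff.1 hs y₀ hy₀
  have hmem : ∀ z ∈ ball (0 : E) ρ, y₀ + z ∈ s := fun z hz => hball (by simpa using hz)
  have hΓs : ContDiffOn ℝ ∞ (fun z => Γ (y₀ + z)) (ball (0 : E) ρ) :=
    hΓ.comp (contDiff_const.add contDiff_id).contDiffOn hmem
  have hAs : ContDiffOn ℝ ∞ A (ball (0 : E) ρ) :=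
    ((contDiffOn_const (c := S₁)).clm_comp hΓs).add contDiffOn_const
  have hdA : ∀ z ∈ ball (0 : E) ρ, ∀ u v, fderiv ℝ A z u v = S₁ (fderiv ℝ Γ (y₀ + z) u v) := by
    intro z hz u v
    have h1 : HasFDerivAt Γ (fderiv ℝ Γ (y₀ + z)) (y₀ + z) :=
      ((hΓ.contDiffAt (hs.mem_nhds (hmem z hz))).differentiableAt (by simp)).hasFDerivAt
    have h2 : HasFDerivAt (fun z => Γ (y₀ + z)) (fderiv ℝ Γ (y₀ + z)) z :=
      (hasFDerivAt_comp_add_left (F := E →L[ℝ] E →L[ℝ] E) (f := Γ) (f' := fderiv ℝ Γ (y₀ + z))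
        (x := z) y₀).2 h1
    have h3 := (((hasFDerivAt_const S₁ z).clm_comp h2).add_const S₂).fderiv
    rw [hA, h3, ContinuousLinearMap.comp_zero, add_zero]
    rfl
  -- Integrability of `A` splits in two: its `S₁` part is the vanishing of the curvature of `Γ`, its
  -- `S₂` part the vanishing of the torsion.
  obtain ⟨r, hr, hX⟩ := exists_parallel (A := A)
    ((hAs.contDiffAt (ball_mem_nhds 0 hρ)).of_le (by norm_cast)) (by
      filter_upwards [ball_mem_nhds (0 : E) hρ] with z hz u v
      rw [hdA z hz, hdA z hz, hAv, hAv]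
      simp only [add_mul, mul_add, h11, h12, h21, h22, add_zero, ← add_assoc, ← map_add]
      rw [hsym _ (hmem z hz) u v]
      congr 2
      exact ContinuousLinearMap.ext fun w => hflat _ (hmem z hz) u v w)
  obtain ⟨X, hX0, hX⟩ := hX 1
  set R := min r ρ with hR
  have hRr : ball (0 : E) R ⊆ ball 0 r := ball_subset_ball (min_le_left _ _)
  have hRρ : ball (0 : E) R ⊆ ball 0 ρ := ball_subset_ball (min_le_right _ _)
  have hXs : ContDiffOn ℝ ∞ X (ball (0 : E) R) :=
    contDiffOn_of_parallel isOpen_ball (hAs.mono hRρ) fun y hy => hX y (hRr hy)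
  have hmaps : ∀ y ∈ ball y₀ R, y - y₀ ∈ ball (0 : E) R := by
    intro y hy
    simpa [dist_eq_norm] using hy
  have hY : ∀ y ∈ ball y₀ R, HasFDerivAt (fun y => X (y - y₀))
        (((ContinuousLinearMap.mul ℝ _).flip (X (y - y₀))) ∘L A (y - y₀)) y := by
    intro y hy
    simpa using! (hX _ (hRr (hmaps y hy))).comp y ((hasFDerivAt_id y).sub_const y₀)
  refine ⟨R, lt_min hr hρ, fun y hy => ?_, fun y => p₁ (X (y - y₀)), fun y => p₂ (X (y - y₀)),
    by simp [hX0, hp1], by simp [hX0, hp2], ?_, fun y hy => ?_, fun y hy w => ?_⟩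
  · simpa using hmem _ (hRρ (hmaps y hy))
  · exact p₂.contDiff.comp_contDiffOn
      (hXs.comp (contDiff_id.sub contDiff_const).contDiffOn hmaps)
  · refine (p₂.hasFDerivAt.comp y (hY y hy)).congr_fderiv ?_
    refine ContinuousLinearMap.ext fun v => ?_
    simp [hAv, hp21, hp22]
  · refine ((p₁.hasFDerivAt.comp y (hY y hy)).clm_apply
      (hasFDerivAt_const w y)).congr_fderiv ?_
    refine ContinuousLinearMap.ext fun v => ?_
    simp [hAv, hp11, hp12]

/-- A flat torsion-free connection has parallel coordinates near every point. -/
theorem exists_parallel_coord {Γ : E → E →L[ℝ] E →L[ℝ] E} {s : Set E} (hs : IsOpen s) {y₀ : E}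
    (hy₀ : y₀ ∈ s) (hΓ : ContDiffOn ℝ ∞ Γ s) (hsym : ∀ y ∈ s, ∀ u v, Γ y u v = Γ y v u)
    (hflat : ∀ y ∈ s, ∀ u v w, fderiv ℝ Γ y u v w + Γ y u (Γ y v w) =
      fderiv ℝ Γ y v u w + Γ y v (Γ y u w)) :
    ∃ r > 0, ball y₀ r ⊆ s ∧ ∃ (θ : E → E →L[ℝ] E) (ψ : E → E),
      θ y₀ = ContinuousLinearMap.id ℝ E ∧ ψ y₀ = 0 ∧ ContDiffOn ℝ ∞ ψ (ball y₀ r) ∧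
      (∀ y ∈ ball y₀ r, HasFDerivAt ψ (θ y) y) ∧
      ∀ y ∈ ball y₀ r, ∀ w, HasFDerivAt (fun y => θ y w) (θ y ∘L (Γ y).flip w) y := by
  -- `G` is the space of pairs `(θ, ψ)`; its continuous endomorphisms form the algebra required by
  -- the auxiliary result.
  let G := (E →L[ℝ] E) × E
  let s₁ : (E →L[ℝ] E) →ₗ[ℝ] G →L[ℝ] G :=
    { toFun := fun C => LinearMap.toContinuousLinearMap
        (LinearMap.inl ℝ (E →L[ℝ] E) E ∘ₗ
          ((ContinuousLinearMap.compL ℝ E E E).flip C).toLinearMap ∘ₗ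
          LinearMap.fst ℝ (E →L[ℝ] E) E)
      map_add' := fun C D => ContinuousLinearMap.ext fun x => by simp
      map_smul' := fun c C => ContinuousLinearMap.ext fun x => by simp }
  let s₂ : E →ₗ[ℝ] G →L[ℝ] G :=
    { toFun := fun v => LinearMap.toContinuousLinearMap
        (LinearMap.inr ℝ (E →L[ℝ] E) E ∘ₗ
          (ContinuousLinearMap.apply ℝ E v).toLinearMap ∘ₗ LinearMap.fst ℝ (E →L[ℝ] E) E)
      map_add' := fun C D => ContinuousLinearMap.ext fun x => by simp
      map_smul' := fun c C => ContinuousLinearMap.ext fun x => by simp }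
  let x₀ : G := (ContinuousLinearMap.id ℝ E, 0)
  have e1 : ∀ C (x : G), s₁ C x = (x.1 ∘L C, 0) := fun C x => rfl
  have e2 : ∀ v (x : G), s₂ v x = (0, x.1 v) := fun C x => rfl
  refine exists_parallel_coord_aux (𝔸 := G →L[ℝ] G) (S₁ := LinearMap.toContinuousLinearMap s₁)
    (S₂ := LinearMap.toContinuousLinearMap s₂)
    (p₁ := (ContinuousLinearMap.fst ℝ (E →L[ℝ] E) E) ∘L ContinuousLinearMap.apply ℝ G x₀)
    (p₂ := (ContinuousLinearMap.snd ℝ (E →L[ℝ] E) E) ∘L ContinuousLinearMap.apply ℝ G x₀)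
    (fun C D => ContinuousLinearMap.ext fun x => ?_)
    (fun C D => ContinuousLinearMap.ext fun x => ?_)
    (fun C D => ContinuousLinearMap.ext fun x => ?_)
    (fun C D => ContinuousLinearMap.ext fun x => ?_)
    (fun C X => ?_) (fun C X => ?_) (fun C X => ?_) (fun C X => ?_) ?_ ?_ hs hy₀ hΓ hsym hflat <;>
  rfl

omit [DecidableEq ι] [FiniteDimensional ℝ E] in
theorem fderiv_clm_comp_array {F : Type*} [NormedAddCommGroup F] [NormedSpace ℝ F]
    (L : (ι → ι → ι → ℝ) →L[ℝ] F) {Γ : E → ι → ι → ι → ℝ} {y : E}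
    (hΓ : ∀ k i j, DifferentiableAt ℝ (fun y => Γ y k i j) y) (u : E) :
    fderiv ℝ (fun y => L (Γ y)) y u = L fun k i j => fderiv ℝ (fun y => Γ y k i j) y u := by
  have h1 : HasFDerivAt Γ (ContinuousLinearMap.pi fun k => ContinuousLinearMap.pi fun i =>
      ContinuousLinearMap.pi fun j => fderiv ℝ (fun y => Γ y k i j) y) y :=
    hasFDerivAt_pi.2 fun k => hasFDerivAt_pi.2 fun i => hasFDerivAt_pi.2 fun j =>
      (hΓ k i j).hasFDerivAt
  have h2 : HasFDerivAt (fun y => L (Γ y)) _ y := L.hasFDerivAt.comp y h1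
  rw [h2.fderiv]
  rfl

/-- A flat metric has flat coordinates near every point. -/
theorem exists_flat_coord {h : E → Matrix ι ι ℝ} {s : Set E} (hs : IsOpen s) {y₀ : E}
    (hy₀ : y₀ ∈ s) (hh : ∀ i j, ContDiffOn ℝ ∞ (fun y => h y i j) s)
    (hsymm : ∀ y, (h y).IsSymm) (hu : ∀ y ∈ s, IsUnit (h y).det)
    (hflat : ∀ y ∈ s, ∀ l k i j, curvatureOf b h y l k i j = 0) :
    ∃ r > 0, ball y₀ r ⊆ s ∧ ∃ ψ : E → E, ψ y₀ = 0 ∧ fderiv ℝ ψ y₀ = ContinuousLinearMap.id ℝ E ∧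
      ContDiffOn ℝ ∞ ψ (ball y₀ r) ∧ ∀ y ∈ ball y₀ r, ∀ i j,
        h y i j = bilinOf b (h y₀) (fderiv ℝ ψ y (b i)) (fderiv ℝ ψ y (b j)) := by
  have hc : ∀ k i j, ContDiffOn ℝ ∞ (fun y => christoffelOf b h y k i j) s :=
    contDiffOn_christoffelOf b hs hh hu
  set Γ : E → E →L[ℝ] E →L[ℝ] E := fun y => christMap b (christoffelOf b h y) with hΓdef
  have hΓs : ContDiffOn ℝ ∞ Γ s := by
    exact (ContinuousLinearMap.contDiff (F := E →L[ℝ] E →L[ℝ] E) (christMap b)).comp_contDiffOn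
      (contDiffOn_pi.2 fun k => contDiffOn_pi.2 fun i =>
      contDiffOn_pi.2 fun j => hc k i j)
  have hΓb : ∀ y i j, Γ y (b i) (b j) = ∑ k, christoffelOf b h y k i j • b k :=
    fun y i j => christMap_basis b _ i j
  have hΓsym : ∀ y ∈ s, ∀ u v, Γ y u v = Γ y v u := by
    intro y hy u v
    induction u using basis_induction b with
    | hb i =>
      induction v using basis_induction b with
      | hb j =>
        rw [hΓb, hΓb]
        exact Finset.sum_congr rfl fun k _ => by
          rw [christoffelOf_symm b (Eventually.of_forall hsymm)]
      | hadd x z hx hz => simp [hx, hz]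
      | hsmul c x hx => simp [hx]
      | h0 => simp
    | hadd x z hx hz => simp [hx, hz]
    | hsmul c x hx => simp [hx]
    | h0 => simp
  have hΓflat : ∀ y ∈ s, ∀ u v w, fderiv ℝ Γ y u v w + Γ y u (Γ y v w) =
      fderiv ℝ Γ y v u w + Γ y v (Γ y u w) := by
    intro y hy u v w
    induction u using basis_induction b with
    | hb i =>
      induction v using basis_induction b with
      | hb j =>
        induction w using basis_induction b with
        | hb k =>
          have hd := fderiv_clm_comp_array (F := E →L[ℝ] E →L[ℝ] E) (christMap b)
            (Γ := christoffelOf b h) (y := y) fun k i j =>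
            ((hc k i j).contDiffAt (hs.mem_nhds hy)).differentiableAt (by simp)
          have e1 : ∀ i j, Γ y (b i) (Γ y (b j) (b k)) =
              ∑ l, (∑ m, christoffelOf b h y l i m * christoffelOf b h y m j k) • b l := by
            intro i j
            simp only [hΓb, map_sum, map_smul, Finset.smul_sum, Finset.sum_smul, smul_smul]
            rw [Finset.sum_comm]
            refine Finset.sum_congr rfl fun l _ => Finset.sum_congr rfl fun m _ => ?_
            rw [mul_comm]
          rw [e1, e1, hΓdef, hd, hd, christMap_basis, christMap_basis,
            ← Finset.sum_add_distrib, ← Finset.sum_add_distrib]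
          refine Finset.sum_congr rfl fun l _ => ?_
          rw [← add_smul, ← add_smul]
          congr 1
          have := hflat y hy l k i j
          simp only [curvatureOf, Finset.sum_sub_distrib] at this
          linarith
        | hadd x z hx hz => simp only [map_add] at *; rw [add_add_add_comm, hx, hz]; abel
        | hsmul c x hx => simp only [map_smul] at *; rw [← smul_add, hx, smul_add]
        | h0 => simp
      | hadd x z hx hz =>
        simp only [map_add, add_apply] at *; rw [add_add_add_comm, hx, hz]; abel
      | hsmul c x hx => simp only [map_smul, smul_apply] at *; rw [← smul_add, hx, smul_add]
      | h0 => simp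
    | hadd x z hx hz =>
      simp only [map_add, add_apply] at *; rw [add_add_add_comm, hx, hz]; abel
    | hsmul c x hx => simp only [map_smul, smul_apply] at *; rw [← smul_add, hx, smul_add]
    | h0 => simp
  obtain ⟨r, hr, hrs, θ, ψ, hθ0, hψ0, hψs, hψ, hθ⟩ :=
    exists_parallel_coord hs hy₀ hΓs hΓsym hΓflat
  have hy₀r : y₀ ∈ ball y₀ r := mem_ball_self hr
  refine ⟨r, hr, hrs, ψ, hψ0, by rw [(hψ _ hy₀r).fderiv, hθ0], hψs, fun y hy => ?_⟩
  rw [(hψ y hy).fderiv]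
  set c := bilinOf b (h y₀) with hcdef
  set z := y - y₀ with hz
  have hseg : ∀ t ∈ Icc (0 : ℝ) 1, y₀ + t • z ∈ ball y₀ r := by
    intro t ht
    have hy' : ‖z‖ < r := by simpa [dist_eq_norm] using hy
    simp only [mem_ball, dist_self_add_left, norm_smul, Real.norm_of_nonneg ht.1]
    exact (mul_le_of_le_one_left (norm_nonneg _) ht.2).trans_lt hy'
  -- `C t` is the matrix of the endomorphism `Γ(z, ·)` at the point `y₀ + t z` of the segment from
  -- `y₀` to `y`.
  set C : ℝ → ι → ι → ℝ := fun t k i => ∑ l, b.repr z l * christoffelOf b h (y₀ + t • z) k l i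
    with hC
  have hCcont : ContinuousOn C (Icc 0 1) := by
    refine continuousOn_pi.2 fun k => continuousOn_pi.2 fun i => ?_
    refine continuousOn_finsetSum _ fun l _ => continuousOn_const.mul ?_
    refine (hc k l i).continuousOn.comp (f := fun t : ℝ => y₀ + t • z) (by fun_prop) ?_
    exact fun t ht => hrs (hseg t ht)
  obtain ⟨N, hN⟩ := isCompact_Icc.exists_bound_of_continuousOn hCcont
  have hCN : ∀ t ∈ Icc (0 : ℝ) 1, ∀ k i, |C t k i| ≤ N := fun t ht k i =>
    (norm_le_pi_norm (C t k) i).trans ((norm_le_pi_norm (C t) k).trans (hN t ht))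
  have hΓz : ∀ t i, Γ (y₀ + t • z) z (b i) = ∑ k, C t k i • b k := by
    intro t i
    have h1 : ∀ T : E →L[ℝ] E →L[ℝ] E, T z (b i) = ∑ l, b.repr z l • T (b l) (b i) := by
      intro T
      conv_lhs => rw [← b.sum_repr z]
      simp only [map_sum, map_smul, sum_apply, smul_apply]
    rw [h1]
    simp only [hΓb, hC, Finset.smul_sum, smul_smul, Finset.sum_smul]
    rw [Finset.sum_comm]
  have hline : ∀ t : ℝ, HasDerivAt (fun t : ℝ => y₀ + t • z) z t := by
    intro t
    simpa using ((hasDerivAt_id t).smul_const z).const_add y₀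
  -- `K` is the difference between the metric and the pullback of its value at `y₀` by `θ`. Both are
  -- parallel, one by metric compatibility and the other because `θ` is parallel, so `K` solves a
  -- homogeneous linear equation along the segment. It vanishes at `y₀`, hence at `y`.
  set K : ℝ → ι → ι → ℝ := fun t i j =>
    h (y₀ + t • z) i j - c (θ (y₀ + t • z) (b i)) (θ (y₀ + t • z) (b j)) with hK
  have hKd : ∀ t ∈ Icc (0 : ℝ) 1, HasDerivAt K
      (fun i j => ∑ k, C t k i * K t k j + ∑ k, C t k j * K t i k) t := by
    intro t ht
    refine hasDerivAt_pi.2 fun i => hasDerivAt_pi.2 fun j => ?_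
    have hyt := hseg t ht
    have d1 : HasDerivAt (fun t : ℝ => h (y₀ + t • z) i j)
        (∑ k, C t k i * h (y₀ + t • z) k j + ∑ k, C t k j * h (y₀ + t • z) i k) t := by
      have h1 := ((((hh i j).contDiffAt (hs.mem_nhds (hrs hyt))).differentiableAt
        (by simp)).hasFDerivAt).comp_hasDerivAt t (hline t)
      refine h1.congr_deriv ?_
      have h2 : ∀ T : E →L[ℝ] ℝ, T z = ∑ l, b.repr z l * T (b l) := by
        intro T
        conv_lhs => rw [← b.sum_repr z]
        simp only [map_sum, map_smul, smul_eq_mul]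
      rw [h2]
      simp only [fderiv_eq_sum_christoffelOf b (hu _ (hrs hyt))
        (Eventually.of_forall hsymm), hC, Finset.sum_mul, mul_add, Finset.mul_sum,
        Finset.sum_add_distrib]
      congr 1
      · rw [Finset.sum_comm]
        refine Finset.sum_congr rfl fun k _ => Finset.sum_congr rfl fun l _ => ?_
        rw [(hsymm (y₀ + t • z)).apply k j]
        ring
      · rw [Finset.sum_comm]
        refine Finset.sum_congr rfl fun k _ => Finset.sum_congr rfl fun l _ => ?_
        ring
    have dθ : ∀ i, HasDerivAt (fun t : ℝ => θ (y₀ + t • z) (b i))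
        (∑ k, C t k i • θ (y₀ + t • z) (b k)) t := by
      intro i
      refine ((hθ _ hyt (b i)).comp_hasDerivAt t (hline t)).congr_deriv ?_
      simp [hΓz]
    have d2 := (c.hasFDerivAt_of_bilinear (dθ i).hasFDerivAt (dθ j).hasFDerivAt).hasDerivAt
    refine (d1.sub d2).congr_deriv ?_
    simp only [hK, mul_sub, Finset.sum_sub_distrib]
    simp [map_sum, sum_apply]
    ring
  have hK0 : ∀ t ∈ Icc (0 : ℝ) 1, K t = 0 := by
    refine eq_zero_of_abs_deriv_le_mul_abs_self_of_eq_zero_right (K := 2 * (Fintype.card ι * N))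
      (fun t ht => (hKd t ht).continuousAt.continuousWithinAt)
      (fun t ht => (hKd t (Ico_subset_Icc_self ht)).hasDerivWithinAt) ?_ ?_
    · ext i j
      simp [hK, hθ0, hcdef, bilinOf_basis]
    · intro t ht
      have ht' := Ico_subset_Icc_self ht
      have hKt : ∀ i j, |K t i j| ≤ ‖K t‖ := fun i j =>
        (norm_le_pi_norm (K t i) j).trans (norm_le_pi_norm (K t) i)
      have hsumle : ∀ (f g : ι → ℝ), (∀ k, |f k| ≤ N) → (∀ k, |g k| ≤ ‖K t‖) →
          |∑ k, f k * g k| ≤ Fintype.card ι * N * ‖K t‖ := by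
        intro f g hf hg
        refine (Finset.abs_sum_le_sum_abs _ _).trans ?_
        refine (Finset.sum_le_sum (g := fun _ => N * ‖K t‖) fun k _ => ?_).trans ?_
        · rw [abs_mul]
          exact mul_le_mul (hf k) (hg k) (abs_nonneg _) ((abs_nonneg _).trans (hf k))
        · simp [mul_assoc]
      have hN0 : 0 ≤ N := (norm_nonneg _).trans (hN t ht')
      refine (pi_norm_le_iff_of_nonneg (by positivity)).2 fun i =>
        (pi_norm_le_iff_of_nonneg (by positivity)).2 fun j => ?_
      refine (norm_add_le _ _).trans ?_
      have h1 := hsumle (fun k => C t k i) (fun k => K t k j) (fun k => hCN t ht' k i)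
        fun k => hKt k j
      have h2 := hsumle (fun k => C t k j) (fun k => K t i k) (fun k => hCN t ht' k j)
        fun k => hKt i k
      rw [Real.norm_eq_abs, Real.norm_eq_abs]
      linarith
  intro i j
  have := congrFun (congrFun (hK0 1 (by simp)) i) j
  simpa [hK, hz, sub_eq_zero] using this

end FlatCoord

/-! ### Flat parametrizations and geodesics -/

section FlatParam

set_option maxSynthPendingDepth 3

open Set Metric Filter
open scoped Topology

variable {E : Type*} [NormedAddCommGroup E] [NormedSpace ℝ E]
  {H : Type*} [TopologicalSpace H] {I : ModelWithCorners ℝ E H}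
  {M : Type*} [TopologicalSpace M] [ChartedSpace H M]
  {E' : Type*} [NormedAddCommGroup E'] [NormedSpace ℝ E']
  {ι : Type*} [Fintype ι] [DecidableEq ι] {b : Module.Basis ι ℝ E}
  {g : ∀ x : M, TangentSpace I x → TangentSpace I x → ℝ}

variable (I g) in
/-- `f` is a smooth map on the open set `W` which pulls the metric `g` back to the constant inner
product `B`. -/
structure IsFlatParam (B : E' →L[ℝ] E' →L[ℝ] ℝ) (f : E' → M) (W : Set E') : Prop where
  isOpen : IsOpen W
  contMDiffOn : ContMDiffOn 𝓘(ℝ, E') I ∞ f W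
  symm : ∀ v w, B v w = B w v
  definite : ∀ v, B v v = 0 → v = 0
  isometry : ∀ x ∈ W, ∀ v w : E',
    g (f x) (mfderiv 𝓘(ℝ, E') I f x v) (mfderiv 𝓘(ℝ, E') I f x w) = B v w

/-- Tangent spaces at points that are only provably equal are different types with the same
underlying space `E`; this compares values of `g` by comparing the vectors in `E`. -/
theorem metric_congr {x x' : M} (h : x = x') {v w : TangentSpace I x} {v' w' : TangentSpace I x'}
    (hv : (v : E) = (v' : E)) (hw : (w : E) = (w' : E)) : g x v w = g x' v' w' := by
  subst h
  have hv' : v = v' := hv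
  have hw' : w = w' := hw
  rw [hv', hw']

variable {B : E' →L[ℝ] E' →L[ℝ] ℝ} {f : E' → M} {W : Set E'}

/-- A vector in the kernel is null for `B`. No bilinearity of `g` is available, so `g(0, 0) = 0` is
itself read off from the isometry property. -/
theorem IsFlatParam.injective_mfderiv (hf : IsFlatParam I g B f W) {x : E'} (hx : x ∈ W) :
    Function.Injective (mfderiv 𝓘(ℝ, E') I f x) := by
  refine (injective_iff_map_eq_zero (mfderiv 𝓘(ℝ, E') I f x)).2 fun v hv => ?_
  have h1 := hf.isometry x hx v v
  have h2 := hf.isometry x hx 0 0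
  refine hf.definite v ?_
  rw [← h1, hv]
  rw [map_zero (B 0)] at h2
  rw [← h2]
  have h3 : mfderiv 𝓘(ℝ, E') I f x (0 : E') = 0 := map_zero (mfderiv 𝓘(ℝ, E') I f x)
  rw [h3]

omit [Fintype ι] [DecidableEq ι] in
-- In equal dimensions `f` is a local diffeomorphism by the inverse function theorem; `χ` is the
-- local inverse of `f` expressed in the chart `e`. It is thus a system of flat coordinates, and the
-- last clauses express the metric matrix of the chart through `χ` and `B`.
theorem IsFlatParam.exists_coord [IsManifold I ∞ M] [I.Boundaryless] [FiniteDimensional ℝ E]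
    [FiniteDimensional ℝ E'] (hf : IsFlatParam I g B f W)
    (hdim : Module.finrank ℝ E' = Module.finrank ℝ E) {e : OpenPartialHomeomorph M H}
    (he : e ∈ IsManifold.maximalAtlas I ∞ M) {a : E'} (ha : a ∈ W) (hae : f a ∈ e.source) :
    ∃ χ : E → E', ContDiffAt ℝ ∞ χ (e.extend I (f a)) ∧ χ (e.extend I (f a)) = a ∧
      (∀ᶠ x in 𝓝 a, χ (e.extend I (f x)) = x) ∧
      (∀ᶠ y in 𝓝 (e.extend I (f a)), f (χ y) = (e.extend I).symm y) ∧
      ∀ᶠ y in 𝓝 (e.extend I (f a)), χ y ∈ W ∧ ContDiffAt ℝ 2 χ y ∧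
        Function.Bijective (fderiv ℝ χ y) ∧
        (∀ v : E, (mfderiv 𝓘(ℝ, E') I f (χ y) (fderiv ℝ χ y v) : E) =
          (mfderiv 𝓘(ℝ, E) I (e.extend I).symm y v : E)) ∧
        ∀ i j, metricMatrix I b g e y i j = B (fderiv ℝ χ y (b i)) (fderiv ℝ χ y (b j)) := by
  set ψ : E' → E := fun x => e.extend I (f x) with hψ
  have hfa : ContMDiffAt 𝓘(ℝ, E') I ∞ f a := hf.contMDiffOn.contMDiffAt (hf.isOpen.mem_nhds ha)
  have hψa : ContDiffAt ℝ ∞ ψ a :=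
    contMDiffAt_iff_contDiffAt.1 ((e.contMDiffAt_extend he hae).comp a hfa)
  have hsymm : ∀ y ∈ (e.extend I).target, ContMDiffAt 𝓘(ℝ, E) I ∞ (e.extend I).symm y := by
    intro y hy
    have h1 := (contMDiffOn_extend_symm he).contMDiffAt (x := y) ?_
    · exact h1
    · rw [← e.extend_target']
      exact e.isOpen_extend_target.mem_nhds hy
  have hsrc : ∀ᶠ x in 𝓝 a, f x ∈ e.source :=
    hfa.continuousAt.eventually (e.open_source.mem_nhds hae)
  have hψe : ∀ᶠ x in 𝓝 a, f x = (e.extend I).symm (ψ x) :=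
    hsrc.mono fun x hx => (e.extend_left_inv hx).symm
  have hta : ψ a ∈ (e.extend I).target := (e.extend I).map_source (by rwa [e.extend_source])
  have hinj : Function.Injective (fderiv ℝ ψ a) := by
    refine (injective_iff_map_eq_zero (fderiv ℝ ψ a)).2 fun v hv => ?_
    have h1 : HasMFDerivAt 𝓘(ℝ, E') I f a
        ((mfderiv 𝓘(ℝ, E) I (e.extend I).symm (ψ a)).comp (fderiv ℝ ψ a)) := by
      have h2 := ((hsymm _ hta).mdifferentiableAt (by simp)).hasMFDerivAt.comp a
        (hψa.differentiableAt (by simp)).hasFDerivAt.hasMFDerivAt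
      exact h2.congr_of_eventuallyEq hψe
    refine hf.injective_mfderiv ha ?_
    rw [h1.mfderiv]
    have h3 : (mfderiv 𝓘(ℝ, E) I (e.extend I).symm (ψ a)) (fderiv ℝ ψ a v) = 0 := by
      rw [hv]; exact map_zero (mfderiv 𝓘(ℝ, E) I (e.extend I).symm (ψ a))
    refine Eq.trans h3 ?_
    exact (map_zero ((mfderiv 𝓘(ℝ, E) I (e.extend I).symm (ψ a)).comp (fderiv ℝ ψ a))).symm
  set L : E' ≃L[ℝ] E :=
    (LinearMap.linearEquivOfInjective (fderiv ℝ ψ a).toLinearMap hinj hdim).toContinuousLinearEquiv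
    with hL
  have hLψ : HasFDerivAt ψ (L : E' →L[ℝ] E) a := by
    have : (L : E' →L[ℝ] E) = fderiv ℝ ψ a := by
      ext v; simp [hL]
    rw [this]
    exact (hψa.differentiableAt (by simp)).hasFDerivAt
  set Φ := hψa.toOpenPartialHomeomorph ψ hLψ (by simp) with hΦ
  have haΦ : a ∈ Φ.source := hψa.mem_toOpenPartialHomeomorph_source hLψ (by simp)
  have hχ : ContDiffAt ℝ ∞ Φ.symm (ψ a) := hψa.to_localInverse hLψ (by simp)
  have hχa : Φ.symm (ψ a) = a := Φ.left_inv haΦ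
  have ev1 : ∀ᶠ x in 𝓝 a, Φ.symm (ψ x) = x := Φ.eventually_left_inverse haΦ
  have ev2 : ∀ᶠ y in 𝓝 (ψ a), ψ (Φ.symm y) = y := Φ.eventually_right_inverse' haΦ
  have hχt : Tendsto Φ.symm (𝓝 (ψ a)) (𝓝 a) := by
    have := hχ.continuousAt.tendsto
    rwa [hχa] at this
  have ev3 : ∀ᶠ y in 𝓝 (ψ a), f (Φ.symm y) = (e.extend I).symm y := by
    filter_upwards [ev2, hχt.eventually hψe] with y h1 h2
    rw [h2, h1]
  refine ⟨Φ.symm, hχ, hχa, ev1, ev3, ?_⟩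
  have ev4 : ∀ᶠ y in 𝓝 (ψ a), ContDiffAt ℝ 2 Φ.symm y :=
    (hχ.of_le (by norm_cast)).eventually (by simp)
  filter_upwards [eventually_eventually_nhds.2 ev2, eventually_eventually_nhds.2 ev3, ev4,
    hχt.eventually (hf.isOpen.mem_nhds ha), hχt.eventually hsrc,
    e.isOpen_extend_target.mem_nhds hta] with y h2 h3 h4 h5 h6 h7
  have hd : DifferentiableAt ℝ Φ.symm y := h4.differentiableAt (by norm_num)
  have hfy : ContMDiffAt 𝓘(ℝ, E') I ∞ f (Φ.symm y) :=
    hf.contMDiffOn.contMDiffAt (hf.isOpen.mem_nhds h5)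
  have hψy : DifferentiableAt ℝ ψ (Φ.symm y) :=
    (contMDiffAt_iff_contDiffAt.1 ((e.contMDiffAt_extend he h6).comp _ hfy)).differentiableAt
      (by simp)
  have hinjχ : Function.Injective (fderiv ℝ Φ.symm y) := by
    have h8 : HasFDerivAt (fun y => ψ (Φ.symm y)) _ y := hψy.hasFDerivAt.comp y hd.hasFDerivAt
    have h9 : HasFDerivAt (fun y => ψ (Φ.symm y)) (ContinuousLinearMap.id ℝ E) y :=
      (hasFDerivAt_id y).congr_of_eventuallyEq h2
    have h10 := h8.unique h9
    intro v w hvw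
    have hv := congrArg (fun T : E →L[ℝ] E => T v) h10
    have hw := congrArg (fun T : E →L[ℝ] E => T w) h10
    simp only [ContinuousLinearMap.comp_apply, ContinuousLinearMap.id_apply] at hv hw
    rw [← hv, ← hw, hvw]
  have hmf : ∀ v : E, (mfderiv 𝓘(ℝ, E') I f (Φ.symm y) (fderiv ℝ Φ.symm y v) : E) =
      (mfderiv 𝓘(ℝ, E) I (e.extend I).symm y v : E) := by
    intro v
    have h8 : HasMFDerivAt 𝓘(ℝ, E) I (e.extend I).symm y
        ((mfderiv 𝓘(ℝ, E') I f (Φ.symm y)).comp (fderiv ℝ Φ.symm y)) :=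
      ((hfy.mdifferentiableAt (by simp)).hasMFDerivAt.comp y
        hd.hasFDerivAt.hasMFDerivAt).congr_of_eventuallyEq (h3.mono fun _ h => h.symm)
    rw [h8.mfderiv]
    rfl
  refine ⟨h5, h4, ⟨hinjχ, ?_⟩, hmf, fun i j => ?_⟩
  · exact (LinearMap.injective_iff_surjective_of_finrank_eq_finrank
      (f := (fderiv ℝ Φ.symm y).toLinearMap) hdim.symm).1 hinjχ
  · rw [← hf.isometry _ h5]
    exact metric_congr h3.self_of_nhds.symm (hmf _).symm (hmf _).symm

/-- The equation of geodesics at the point `t`, in the chart `e`. -/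
theorem geodesic_equation_iff [I.Boundaryless] {e : OpenPartialHomeomorph M H} {χ : E → E'}
    (hBs : ∀ v w, B v w = B w v) (hB : ∀ v, B v v = 0 → v = 0) {γ : ℝ → M} {t : ℝ}
    (hu : ContDiffAt ℝ 2 (fun s => e.extend I (γ s)) t)
    (hχ : ∀ᶠ y in 𝓝 (e.extend I (γ t)), ContDiffAt ℝ 2 χ y ∧ Function.Bijective (fderiv ℝ χ y) ∧
        ∀ i j, metricMatrix I b g e y i j = B (fderiv ℝ χ y (b i)) (fderiv ℝ χ y (b j))) :
    deriv (deriv (fun s => χ (e.extend I (γ s)))) t = 0 ↔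
      ∀ k : ι, deriv (deriv (curveCoord I b e γ k)) t
        + ∑ i, ∑ j, christoffel I b g e (e.extend I (γ t)) k i j
          * deriv (curveCoord I b e γ i) t * deriv (curveCoord I b e γ j) t = 0 := by
  obtain ⟨h1, h2, -⟩ := hχ.self_of_nhds
  rw [christoffel_eq_christoffelOf]
  exact deriv_deriv_comp_eq_zero_iff b h1 hu h2.1
    (fderiv_fderiv_apply_eq_christoffelOf b hBs hB h1 h2.1 h2.2 (hχ.mono fun y hy => hy.2.2))

theorem eventuallyEq_line_of_deriv_deriv {c : ℝ → E'} {t₀ : ℝ} (hc : ContDiffAt ℝ 2 c t₀)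
    (h : ∀ᶠ t in 𝓝 t₀, deriv (deriv c) t = 0) :
    ∀ᶠ t in 𝓝 t₀, c t = c t₀ + (t - t₀) • deriv c t₀ := by
  have hd : ∀ᶠ t in 𝓝 t₀, ContDiffAt ℝ 2 c t := hc.eventually (by simp)
  obtain ⟨ε, hε, hball⟩ := Metric.eventually_nhds_iff_ball.1 (h.and hd)
  have hd2 : ∀ t ∈ ball t₀ ε, HasDerivAt (deriv c) 0 t := by
    intro t ht
    have h1 : ContDiffAt ℝ 1 (fderiv ℝ c) t := (hball t ht).2.fderiv_right (by norm_num)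
    have h2 : DifferentiableAt ℝ (fun s => fderiv ℝ c s 1) t :=
      (h1.differentiableAt one_ne_zero).clm_apply (differentiableAt_const _)
    have h3 : HasDerivAt (deriv c) (deriv (deriv c) t) t := DifferentiableAt.hasDerivAt h2
    rwa [(hball t ht).1] at h3
  have ht₀ : t₀ ∈ ball t₀ ε := mem_ball_self hε
  have hconst : ∀ {F : ℝ → E'}, (∀ t ∈ ball t₀ ε, HasDerivAt F 0 t) → ∀ t ∈ ball t₀ ε,
      F t = F t₀ := by
    intro F hF t ht
    have := (convex_ball t₀ ε).norm_image_sub_le_of_norm_hasDerivWithin_le (f := F) (C := 0)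
      (fun s hs => (hF s hs).hasDerivWithinAt) (by simp) ht₀ ht
    simpa [sub_eq_zero] using this
  filter_upwards [ball_mem_nhds t₀ hε] with t ht
  have h4 := hconst (F := fun t => c t - (t - t₀) • deriv c t₀) (fun s hs => by
    have h5 : HasDerivAt c (deriv c s) s :=
      ((hball s hs).2.differentiableAt (by norm_num)).hasDerivAt
    rw [hconst hd2 s hs] at h5
    have h6 := h5.sub (((hasDerivAt_id s).sub_const t₀).smul_const (deriv c t₀))
    exact h6.congr_deriv (by simp)) t ht
  simp only [sub_self, zero_smul, sub_zero] at h4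
  rw [← h4]
  abel

section Geodesic

variable [IsManifold I ∞ M] [I.Boundaryless] [FiniteDimensional ℝ E] [FiniteDimensional ℝ E']

omit [IsManifold I ∞ M] [I.Boundaryless] [FiniteDimensional ℝ E] [FiniteDimensional ℝ E'] in
theorem contDiffAt_extend_comp {n : ℕ∞} {γ : ℝ → M} {t : ℝ} {e : OpenPartialHomeomorph M H}
    (he : e ∈ IsManifold.maximalAtlas I ∞ M) (hγ : ContMDiffAt 𝓘(ℝ, ℝ) I n γ t)
    (ht : γ t ∈ e.source) : ContDiffAt ℝ n (fun s => e.extend I (γ s)) t :=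
  contMDiffAt_iff_contDiffAt.1 (((e.contMDiffAt_extend he ht).of_le (by exact_mod_cast le_top)).comp
    t hγ)

omit [I.Boundaryless] [FiniteDimensional ℝ E] [FiniteDimensional ℝ E'] [IsManifold I ∞ M] in
theorem IsFlatParam.contMDiffAt_line (hf : IsFlatParam I g B f W) {p v : E'} {t : ℝ}
    (ht : p + t • v ∈ W) : ContMDiffAt 𝓘(ℝ, ℝ) I ∞ (fun s : ℝ => f (p + s • v)) t := by
  have h1 : ContMDiffAt 𝓘(ℝ, ℝ) 𝓘(ℝ, E') ∞ (fun s : ℝ => p + s • v) t :=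
    (contDiff_const.add (contDiff_id.smul contDiff_const)).contDiffAt.contMDiffAt
  exact ContMDiffAt.comp t (g := f) (hf.contMDiffOn.contMDiffAt (hf.isOpen.mem_nhds ht)) h1

/-- In the flat coordinates `χ` the curve is `t ↦ p + t v`, whose second derivative is zero. -/
theorem IsFlatParam.isGeodesic_line (hf : IsFlatParam I g B f univ)
    (hdim : Module.finrank ℝ E' = Module.finrank ℝ E) (p v : E') :
    IsGeodesic I b g (fun t => f (p + t • v)) := by
  refine ⟨fun t => (hf.contMDiffAt_line (mem_univ _)).of_le (by norm_cast), fun x₀ t ht => ?_⟩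
  have he := IsManifold.chart_mem_maximalAtlas (I := I) (n := ∞) x₀
  obtain ⟨χ, -, -, h1, -, h2⟩ := hf.exists_coord (b := b) hdim he (mem_univ (p + t • v)) ht
  refine (geodesic_equation_iff (χ := χ) hf.symm hf.definite
    (contDiffAt_extend_comp (n := 2) he
      ((hf.contMDiffAt_line (mem_univ _)).of_le (by norm_cast)) ht)
    (h2.mono fun y hy => ⟨hy.2.1, hy.2.2.1, hy.2.2.2.2⟩)).1 ?_
  have hc : ContinuousAt (fun s : ℝ => p + s • v) t := by fun_prop
  have h3 : (fun s => χ ((chartAt H x₀).extend I (f (p + s • v)))) =ᶠ[𝓝 t]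
      fun s => p + s • v := hc.eventually h1
  have h4 : deriv (fun s : ℝ => p + s • v) = fun _ => v := by
    ext s
    simpa using (((hasDerivAt_id s).smul_const v).const_add p).deriv
  rw [h3.deriv.deriv_eq, h4]
  simp

/-- Local uniqueness of geodesics: flat coordinates turn `γ` into a curve with vanishing second
derivative, fixed by position and velocity. Velocities are compared in a fixed chart because there
they pass to limits in `t`, which the continuation argument needs. -/
theorem IsGeodesic.eventuallyEq_line_of_deriv {γ : ℝ → M} (hγ : IsGeodesic I b g γ)
    (hf : IsFlatParam I g B f W) (hdim : Module.finrank ℝ E' = Module.finrank ℝ E) {p v : E'}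
    {t₀ : ℝ} (ht : p + t₀ • v ∈ W) (h0 : γ t₀ = f (p + t₀ • v))
    (h1 : deriv (fun s => extChartAt I (γ t₀) (γ s)) t₀ =
      deriv (fun s => extChartAt I (γ t₀) (f (p + s • v))) t₀) :
    ∀ᶠ t in 𝓝 t₀, γ t = f (p + t • v) := by
  set e := chartAt H (γ t₀) with hedef
  have he : e ∈ IsManifold.maximalAtlas I ∞ M := IsManifold.chart_mem_maximalAtlas (γ t₀)
  have hsrc : γ t₀ ∈ e.source := mem_chart_source H (γ t₀)
  have hsrc' : f (p + t₀ • v) ∈ e.source := by rw [← h0]; exact hsrc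
  obtain ⟨χ, hχ, hχa, ev1, ev2, ev3⟩ := hf.exists_coord (b := b) hdim he ht hsrc'
  rw [← h0] at hχ hχa ev2 ev3
  have hu := contDiffAt_extend_comp (n := 2) he (hγ.1 t₀) hsrc
  have hu2 := contDiffAt_extend_comp (n := 2) he
    ((hf.contMDiffAt_line ht).of_le (by norm_cast)) hsrc'
  have hγc : ContinuousAt γ t₀ := (hγ.1 t₀).continuousAt
  have evs : ∀ᶠ t in 𝓝 t₀, γ t ∈ e.source := hγc.eventually (e.open_source.mem_nhds hsrc)
  have hgeo : ∀ᶠ t in 𝓝 t₀, deriv (deriv (fun s => χ (e.extend I (γ s)))) t = 0 := by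
    filter_upwards [evs, hu.continuousAt.eventually (eventually_eventually_nhds.2 ev3)] with t h2 h3
    exact (geodesic_equation_iff (b := b) (g := g) hf.symm hf.definite
      (contDiffAt_extend_comp (n := 2) he (hγ.1 t) h2)
      (h3.mono fun y hy => ⟨hy.2.1, hy.2.2.1, hy.2.2.2.2⟩)).2 (hγ.2 _ t h2)
  have hχd : HasFDerivAt χ (fderiv ℝ χ (e.extend I (γ t₀))) (e.extend I (γ t₀)) :=
    (hχ.differentiableAt (by simp)).hasFDerivAt
  have hline : ∀ᶠ t in 𝓝 t₀, χ (e.extend I (γ t)) = χ (e.extend I (γ t₀)) +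
      (t - t₀) • deriv (fun s => χ (e.extend I (γ s))) t₀ := eventuallyEq_line_of_deriv_deriv
    (((hχ.of_le (by norm_cast)).comp t₀ hu : ContDiffAt ℝ 2 (fun s => χ (e.extend I (γ s))) t₀))
    hgeo
  have hderiv : deriv (fun s => χ (e.extend I (γ s))) t₀ = v := by
    have h2 : HasDerivAt (fun s => χ (e.extend I (γ s))) _ t₀ :=
      hχd.comp_hasDerivAt t₀ (hu.differentiableAt (by norm_num)).hasDerivAt
    have hχd' := hχd
    rw [h0] at hχd'
    have h3 : HasDerivAt (fun s => χ (e.extend I (f (p + s • v)))) _ t₀ :=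
      HasFDerivAt.comp_hasDerivAt (l := χ) t₀ hχd' (hu2.differentiableAt (by norm_num)).hasDerivAt
    have hc : ContinuousAt (fun s : ℝ => p + s • v) t₀ := by fun_prop
    have h4 : (fun s => χ (e.extend I (f (p + s • v)))) =ᶠ[𝓝 t₀] fun s => p + s • v :=
      hc.eventually ev1
    have h5 : HasDerivAt (fun s : ℝ => p + s • v) v t₀ := by
      simpa using ((hasDerivAt_id t₀).smul_const v).const_add p
    have h6 := h3.unique (h5.congr_of_eventuallyEq h4)
    rw [h2.deriv, ← h6, ← h0]
    exact congrArg _ h1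
  filter_upwards [hline, evs, hu.continuousAt.eventually ev2] with t h2 h3 h4
  rw [hderiv, hχa] at h2
  have h5 : (e.extend I).symm (e.extend I (γ t)) = γ t := e.extend_left_inv h3
  rw [← h5, ← h4, h2]
  congr 1
  rw [sub_smul]
  abel

theorem IsGeodesic.eventuallyEq_line {γ : ℝ → M} (hγ : IsGeodesic I b g γ)
    (hf : IsFlatParam I g B f W) (hdim : Module.finrank ℝ E' = Module.finrank ℝ E) {p v : E'}
    {t₀ : ℝ} (ht : p + t₀ • v ∈ W) (h0 : γ t₀ = f (p + t₀ • v))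
    (h1 : (mfderiv 𝓘(ℝ, ℝ) I γ t₀ (1 : ℝ) : E) = (mfderiv 𝓘(ℝ, E') I f (p + t₀ • v) v : E)) :
    ∀ᶠ t in 𝓝 t₀, γ t = f (p + t • v) := by
  refine hγ.eventuallyEq_line_of_deriv hf hdim ht h0 ?_
  have hK := (mdifferentiableAt_extChartAt (I := I) (x := γ t₀)
    (mem_chart_source H (γ t₀))).hasMFDerivAt
  have h2 : HasMFDerivAt 𝓘(ℝ, ℝ) 𝓘(ℝ, E) (fun s => extChartAt I (γ t₀) (γ s)) t₀ _ :=
    hK.comp t₀ ((hγ.1 t₀).mdifferentiableAt (by norm_num)).hasMFDerivAt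
  have hK' : HasMFDerivAt I 𝓘(ℝ, E) (extChartAt I (γ t₀)) (f (p + t₀ • v))
      (mfderiv I 𝓘(ℝ, E) (extChartAt I (γ t₀)) (γ t₀) : E →L[ℝ] E) := by
    rw [← h0]; exact hK
  have hf' := ((hf.contMDiffOn.contMDiffAt (hf.isOpen.mem_nhds ht)).mdifferentiableAt
    (by simp)).hasMFDerivAt
  have h5 : HasDerivAt (fun s : ℝ => p + s • v) v t₀ := by
    simpa using ((hasDerivAt_id t₀).smul_const v).const_add p
  have h3 : HasMFDerivAt 𝓘(ℝ, ℝ) 𝓘(ℝ, E) (fun s => extChartAt I (γ t₀) (f (p + s • v))) t₀ _ :=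
    HasMFDerivAt.comp (g := extChartAt I (γ t₀)) t₀ hK'
      (HasMFDerivAt.comp (g := f) (f := fun s : ℝ => p + s • v) t₀ hf' h5.hasFDerivAt.hasMFDerivAt)
  have hd : ∀ {u : ℝ → E} {T : ℝ →L[ℝ] E}, HasFDerivAt u T t₀ → deriv u t₀ = T 1 :=
    fun h => h.hasDerivAt.deriv
  refine (hd h2.hasFDerivAt).trans (Eq.trans ?_ (hd h3.hasFDerivAt).symm)
  have h6 : (ContinuousLinearMap.toSpanSingleton ℝ v) (1 : ℝ) = v := by simp
  change (mfderiv I 𝓘(ℝ, E) (extChartAt I (γ t₀)) (γ t₀)) (mfderiv 𝓘(ℝ, ℝ) I γ t₀ (1 : ℝ)) =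
    (mfderiv I 𝓘(ℝ, E) (extChartAt I (γ t₀)) (γ t₀) : E →L[ℝ] E)
      ((mfderiv 𝓘(ℝ, E') I f (p + t₀ • v) : E' →L[ℝ] E)
        ((ContinuousLinearMap.toSpanSingleton ℝ v) (1 : ℝ)))
  rw [h6]
  exact congrArg _ h1

/-- A geodesic that agrees with the image of a straight line near one point agrees with it as long
as the line stays in the domain of the flat parametrization. -/
theorem IsGeodesic.eventuallyEq_line_of_isPreconnected [T2Space M] {γ : ℝ → M}
    (hγ : IsGeodesic I b g γ)
    (hf : IsFlatParam I g B f W) (hdim : Module.finrank ℝ E' = Module.finrank ℝ E) {p v : E'}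
    {t₀ : ℝ} (h0 : ∀ᶠ t in 𝓝 t₀, γ t = f (p + t • v)) {J : Set ℝ} (hJ : IsPreconnected J)
    (ht₀ : t₀ ∈ J) (hJW : ∀ t ∈ J, p + t • v ∈ W) :
    ∀ t ∈ J, ∀ᶠ s in 𝓝 t, γ s = f (p + s • v) := by
  -- The set of times of local agreement is open by definition. At a limit time in `J` the positions
  -- agree because `M` is Hausdorff and the coordinate velocities agree by continuity, so local
  -- uniqueness puts the limit in `S`.
  set S : Set ℝ := {t | ∀ᶠ s in 𝓝 t, γ s = f (p + s • v)} with hS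
  have hSo : IsOpen S := isOpen_setOfPred_eventually_nhds
  refine hJ.subset_of_closure_inter_subset hSo ⟨t₀, ht₀, h0⟩ ?_
  rintro t ⟨htS, htJ⟩
  have hfr : ∃ᶠ s in 𝓝 t, s ∈ S := mem_closure_iff_frequently.1 htS
  have hW := hJW t htJ
  have hline := hf.contMDiffAt_line (v := v) hW
  have hpt : γ t = f (p + t • v) := tendsto_nhds_unique_of_frequently_eq
    (hγ.1 t).continuousAt.tendsto hline.continuousAt.tendsto
    (hfr.mono fun s hs => hs.self_of_nhds)
  refine hγ.eventuallyEq_line_of_deriv hf hdim hW hpt ?_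
  have he : chartAt H (γ t) ∈ IsManifold.maximalAtlas I ∞ M :=
    IsManifold.chart_mem_maximalAtlas (γ t)
  have hsrc : γ t ∈ (chartAt H (γ t)).source := mem_chart_source H (γ t)
  have hsrc' : f (p + t • v) ∈ (chartAt H (γ t)).source := by rw [← hpt]; exact hsrc
  have hcont : ∀ {u : ℝ → E}, ContDiffAt ℝ 2 u t → Tendsto (deriv u) (𝓝 t) (𝓝 (deriv u t)) := by
    intro u hu
    have h1 : ContDiffAt ℝ 1 (fderiv ℝ u) t := hu.fderiv_right (by norm_num)
    have h2 : ContinuousAt (fun s => fderiv ℝ u s 1) t :=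
      h1.continuousAt.clm_apply continuousAt_const
    exact h2
  exact tendsto_nhds_unique_of_frequently_eq
    (hcont (contDiffAt_extend_comp (n := 2) he (hγ.1 t) hsrc))
    (hcont (contDiffAt_extend_comp (n := 2) he (hline.of_le (by norm_cast)) hsrc'))
    (hfr.mono fun s hs => Filter.EventuallyEq.deriv_eq (hs.mono fun r hr => by
      change extChartAt I (γ t) (γ r) = extChartAt I (γ t) (f (p + r • v))
      rw [hr]))

end Geodesic

end FlatParam

/-! ### The exponential map of a flat complete manifold -/

section GlobalParam

set_option maxSynthPendingDepth 3

open Set Metric Filter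
open scoped Topology

variable {E : Type*} [NormedAddCommGroup E] [NormedSpace ℝ E] [FiniteDimensional ℝ E]
  {H : Type*} [TopologicalSpace H] {I : ModelWithCorners ℝ E H} [I.Boundaryless]
  {M : Type*} [TopologicalSpace M] [ChartedSpace H M] [IsManifold I ∞ M]
  {E' : Type*} [NormedAddCommGroup E'] [NormedSpace ℝ E'] [FiniteDimensional ℝ E']
  {g : ∀ x : M, TangentSpace I x → TangentSpace I x → ℝ}
  {ι : Type*} [Fintype ι] [DecidableEq ι]
  {B B' : E' →L[ℝ] E' →L[ℝ] ℝ} {f φ : E' → M} {W W' : Set E'}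

omit [FiniteDimensional ℝ E] [I.Boundaryless] [IsManifold I ∞ M] [FiniteDimensional ℝ E'] in
theorem IsFlatParam.mdifferentiableAt (hf : IsFlatParam I g B f W) {x : E'} (hx : x ∈ W) :
    MDifferentiableAt 𝓘(ℝ, E') I f x :=
  (hf.contMDiffOn.contMDiffAt (hf.isOpen.mem_nhds hx)).mdifferentiableAt (by simp)

theorem exists_continuousLinearEquiv_of_injective {E : Type*} [NormedAddCommGroup E]
    [NormedSpace ℝ E] [FiniteDimensional ℝ E] {T : E →L[ℝ] E} (hT : Function.Injective T) :
    ∃ K : E ≃L[ℝ] E, (K : E →L[ℝ] E) = T :=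
  ⟨(LinearEquiv.ofBijective T.toLinearMap
    ⟨hT, LinearMap.injective_iff_surjective.1 hT⟩).toContinuousLinearEquiv, rfl⟩

omit [FiniteDimensional ℝ E] [I.Boundaryless] [IsManifold I ∞ M] [FiniteDimensional ℝ E'] in
/-- Composition of a flat parametrization with an affine map. -/
theorem IsFlatParam.comp_affine (hφ : IsFlatParam I g B' φ W') (D : E' →L[ℝ] E') (c : E')
    (hD : Function.Injective D) :
    IsFlatParam I g ((B'.comp D).flip.comp D).flip (fun x => φ (D x + c))
      ((fun x => D x + c) ⁻¹' W') where
  isOpen := hφ.isOpen.preimage (by fun_prop)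
  contMDiffOn := hφ.contMDiffOn.comp (t := W')
    (D.contDiff.add contDiff_const).contMDiff.contMDiffOn (fun x hx => hx)
  symm v w := hφ.symm _ _
  definite v hv := by
    have h1 : D v = 0 := hφ.definite _ hv
    exact hD (h1.trans (map_zero D).symm)
  isometry x hx v w := by
    have h1 : HasMFDerivAt 𝓘(ℝ, E') I (fun x => φ (D x + c)) x _ :=
      HasMFDerivAt.comp (g := φ) x (hφ.mdifferentiableAt hx).hasMFDerivAt
        (D.hasFDerivAt.add_const c).hasMFDerivAt
    rw [h1.mfderiv]
    exact hφ.isometry _ hx _ _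

/-- A flat parametrization is locally injective. -/
theorem IsFlatParam.exists_injOn (hφ : IsFlatParam I g B' φ W')
    (hdim : Module.finrank ℝ E' = Module.finrank ℝ E) {a : E'} (ha : a ∈ W') :
    ∃ V ∈ 𝓝 a, InjOn φ V := by
  obtain ⟨χ, -, -, h1, -⟩ := hφ.exists_coord (b := Module.finBasis ℝ E) hdim
    (IsManifold.chart_mem_maximalAtlas (I := I) (n := ∞) (φ a)) ha (mem_chart_source H _)
  refine ⟨_, h1, fun x hx y hy hxy => ?_⟩
  have hx' : χ ((chartAt H (φ a)).extend I (φ x)) = x := hx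
  have hy' : χ ((chartAt H (φ a)).extend I (φ y)) = y := hy
  rw [← hx', ← hy', hxy]

/-- Two flat parametrizations of a neighbourhood of a point differ by an affine map. -/
theorem IsFlatParam.exists_affine (hf : IsFlatParam I g B f W) (hφ : IsFlatParam I g B' φ W')
    (hdim : Module.finrank ℝ E' = Module.finrank ℝ E) {x x' : E'} (hx : x ∈ W) (hx' : x' ∈ W')
    (h : f x = φ x') :
    ∃ D : E' →L[ℝ] E', (∀ v w, B v w = B' (D v) (D w)) ∧
      ∀ᶠ z in 𝓝 x, f z = φ (x' + D (z - x)) := by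
  set e := chartAt H (φ x') with hedef
  have he : e ∈ IsManifold.maximalAtlas I ∞ M := IsManifold.chart_mem_maximalAtlas _
  have hsrc : φ x' ∈ e.source := mem_chart_source H _
  obtain ⟨χ, hχ, hχa, -, ev2, -⟩ := hφ.exists_coord (b := Module.finBasis ℝ E) hdim he hx' hsrc
  rw [← h] at hχ hχa ev2 hsrc
  have hfx : ContMDiffAt 𝓘(ℝ, E') I ∞ f x := hf.contMDiffOn.contMDiffAt (hf.isOpen.mem_nhds hx)
  have hef : ContDiffAt ℝ ∞ (fun z => e.extend I (f z)) x :=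
    contMDiffAt_iff_contDiffAt.1 ((e.contMDiffAt_extend he hsrc).comp x hfx)
  -- `κ` is the transition map from `f` to `φ`. It carries the constant form `B` to the constant
  -- form `B'`, so its second derivative vanishes near `x` and it is affine there.
  set κ : E' → E' := fun z => χ (e.extend I (f z)) with hκdef
  have hκ : ContDiffAt ℝ 2 κ x := ((hχ.comp x hef).of_le (by norm_cast) : ContDiffAt ℝ 2 _ x)
  have hκx : κ x = x' := hχa
  have hfκ : ∀ᶠ z in 𝓝 x, f z = φ (κ z) := by
    filter_upwards [hfx.continuousAt.eventually (e.open_source.mem_nhds hsrc),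
      hef.continuousAt.eventually ev2] with z h1 h2
    rw [hκdef]
    simp only
    rw [h2, e.extend_left_inv h1]
  have hiso : ∀ᶠ z in 𝓝 x, ContDiffAt ℝ 2 κ z ∧
      ∀ v w, B v w = B' (fderiv ℝ κ z v) (fderiv ℝ κ z w) := by
    have hκW : ∀ᶠ z in 𝓝 x, κ z ∈ W' :=
      hκ.continuousAt.eventually (hφ.isOpen.mem_nhds (by rwa [hκx]))
    filter_upwards [eventually_eventually_nhds.2 hfκ, hκW, hf.isOpen.mem_nhds hx,
      hκ.eventually (by simp)] with z h1 h2 h3 h4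
    refine ⟨h4, fun v w => ?_⟩
    have h5 : HasMFDerivAt 𝓘(ℝ, E') I f z
        ((mfderiv 𝓘(ℝ, E') I φ (κ z)).comp (fderiv ℝ κ z)) :=
      ((hφ.mdifferentiableAt h2).hasMFDerivAt.comp z
        (h4.differentiableAt (by norm_num)).hasFDerivAt.hasMFDerivAt).congr_of_eventuallyEq h1
    rw [← hf.isometry z h3, ← hφ.isometry (κ z) h2, h5.mfderiv]
    exact metric_congr h1.self_of_nhds rfl rfl
  obtain ⟨ε, hε, hball⟩ := Metric.eventually_nhds_iff_ball.1
    ((eventually_eventually_nhds.2 hiso).and hfκ)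
  have hball' : ∀ z ∈ ball x ε, ContDiffAt ℝ 2 κ z ∧
      ∀ v w, B v w = B' (fderiv ℝ κ z v) (fderiv ℝ κ z w) :=
    fun z hz => (hball z hz).1.self_of_nhds
  have hd2 : ∀ z ∈ ball x ε, HasFDerivAt (fderiv ℝ κ) (0 : E' →L[ℝ] E' →L[ℝ] E') z := by
    intro z hz
    obtain ⟨h1, h2⟩ := hball' z hz
    have hinj : Function.Injective (fderiv ℝ κ z) := by
      refine (injective_iff_map_eq_zero (fderiv ℝ κ z)).2 fun v hv => hf.definite v ?_
      rw [h2 v v, hv, map_zero]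
    have hsurj : Function.Surjective (fderiv ℝ κ z) :=
      (LinearMap.injective_iff_surjective (f := (fderiv ℝ κ z).toLinearMap)).1 hinj
    have h3 := fderiv_fderiv_eq_zero_of_isometry hφ.symm hφ.definite h1 hsurj
      ((hball z hz).1.mono fun y hy => hy.2)
    have h4 := ((h1.fderiv_right (m := 1) (by norm_num)).differentiableAt one_ne_zero).hasFDerivAt
    rwa [h3] at h4
  have hx0 : x ∈ ball x ε := mem_ball_self hε
  have hD : ∀ z ∈ ball x ε, fderiv ℝ κ z = fderiv ℝ κ x := by
    intro z hz
    have := (convex_ball x ε).norm_image_sub_le_of_norm_hasFDerivWithin_le (f := fderiv ℝ κ)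
      (C := 0) (fun s hs => (hd2 s hs).hasFDerivWithinAt) (by simp) hx0 hz
    simpa [sub_eq_zero] using this
  refine ⟨fderiv ℝ κ x, (hball' x hx0).2, ?_⟩
  filter_upwards [ball_mem_nhds x hε] with z hz
  have h6 := (convex_ball x ε).norm_image_sub_le_of_norm_hasFDerivWithin_le
    (f := fun z => κ z - fderiv ℝ κ x z) (f' := fun _ => 0) (C := 0) (fun s hs => by
      have h7 := ((hball' s hs).1.differentiableAt (by norm_num)).hasFDerivAt
      rw [hD s hs] at h7
      exact ((h7.sub (fderiv ℝ κ x).hasFDerivAt).congr_fderiv (by simp)).hasFDerivWithinAt)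
    (by simp) hx0 hz
  have h8 : κ z - fderiv ℝ κ x z = κ x - fderiv ℝ κ x x := by simpa [sub_eq_zero] using h6
  rw [(hball z hz).2, map_sub, ← hκx]
  congr 1
  rw [eq_add_of_sub_eq h8]
  abel

/-- The restriction to a ray of a family of geodesics that is given by a flat parametrization near
one time is given by flat parametrizations near neighbouring times. -/
theorem exists_isFlatParam_ray_of_mem_ball [T2Space M] {b : Module.Basis ι ℝ E}
    (hdim : Module.finrank ℝ E' = Module.finrank ℝ E)
    {γ : E' → ℝ → M} (hγ : ∀ y, IsGeodesic I b g (γ y)) {x u : E'} {t ρ : ℝ}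
    (hφ : IsFlatParam I g B' φ (ball 0 ρ))
    (hline : ∀ s ∈ ball t (ρ / (‖u‖ + 1)), ∀ᶠ r in 𝓝 s, γ x r = φ (-(t • u) + r • u))
    {s s' : ℝ} (hs : s ∈ ball t (ρ / (‖u‖ + 1))) (hs' : s' ∈ ball t (ρ / (‖u‖ + 1)))
    (h : ∃ (f : E' → M) (W : Set E'), IsFlatParam I g B f W ∧ s • x ∈ W ∧
      ∀ᶠ y in 𝓝 x, ∀ᶠ r in 𝓝 s, γ y r = f (r • y)) :
    ∃ (f : E' → M) (W : Set E'), IsFlatParam I g B f W ∧ s' • x ∈ W ∧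
      ∀ᶠ y in 𝓝 x, ∀ᶠ r in 𝓝 s', γ y r = f (r • y) := by
  obtain ⟨f, W, hf, hsx, hfγ⟩ := h
  have hball : ∀ r ∈ ball t (ρ / (‖u‖ + 1)), -(t • u) + r • u ∈ ball (0 : E') ρ := by
    intro r hr
    rw [mem_ball_zero_iff]
    have h1 : -(t • u) + r • u = (r - t) • u := by rw [sub_smul]; abel
    rw [h1, norm_smul]
    rw [mem_ball, dist_eq_norm, lt_div_iff₀ (by positivity)] at hr
    nlinarith [norm_nonneg (r - t)]
  have hfx : f (s • x) = φ (-(t • u) + s • u) := by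
    rw [← (hline s hs).self_of_nhds, ← hfγ.self_of_nhds.self_of_nhds]
  obtain ⟨D, hBD, hD⟩ := hf.exists_affine hφ hdim hsx (hball s hs) hfx
  -- Along the ray through `x`, both `f` and `φ` describe the geodesic `γ x`. Since `φ` is locally
  -- injective, comparison at a single time `r ≠ s` near `s` gives `(r - s) D x = (r - s) u`.
  have hDx : D x = u := by
    obtain ⟨V, hV, hinj⟩ := hφ.exists_injOn hdim (hball s hs)
    have hc1 : ContinuousAt (fun r : ℝ => -(t • u) + r • u) s := by fun_prop
    have hc2 : ContinuousAt (fun r : ℝ => -(t • u) + s • u + D (r • x - s • x)) s := by fun_prop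
    have hc3 : ContinuousAt (fun r : ℝ => r • x) s := by fun_prop
    have hV2 : V ∈ 𝓝 (-(t • u) + s • u + D (s • x - s • x)) := by
      rwa [sub_self, map_zero, add_zero]
    have hev : ∀ᶠ r in 𝓝 s, -(t • u) + r • u = -(t • u) + s • u + D (r • x - s • x) := by
      filter_upwards [hc1.eventually hV, hc2.eventually hV2, hc3.eventually hD, hline s hs,
        hfγ.self_of_nhds] with r h1 h2 h3 h4 h5
      exact hinj h1 h2 (by rw [← h3, ← h5, h4])
    have hne : ∃ r, r ≠ s ∧ -(t • u) + r • u = -(t • u) + s • u + D (r • x - s • x) := by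
      obtain ⟨r, h1, h2⟩ := ((eventually_mem_nhdsWithin (a := s) (s := {s}ᶜ)).and
        (hev.filter_mono nhdsWithin_le_nhds)).exists
      exact ⟨r, h1, h2⟩
    obtain ⟨r, hr, h1⟩ := hne
    rw [← sub_smul, map_smul, add_assoc, add_right_inj] at h1
    have h2 : (r - s) • u = (r - s) • D x := by
      rw [sub_smul r s u, h1]
      abel
    exact (smul_right_injective E' (sub_ne_zero.2 hr) h2).symm
  have hDinj : Function.Injective D := by
    refine (injective_iff_map_eq_zero D).2 fun v hv => hf.definite v ?_
    rw [hBD v v, hv, map_zero]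
  have hBeq : ((B'.comp D).flip.comp D).flip = B := by
    ext v w
    exact (hBD v w).symm
  -- The map `z ↦ φ(D z - t u)` agrees with `f` near `s x`, has the same form `B`, and is defined on
  -- a set that contains `r x` for all times `r` near `t`; it is the continuation of `f`.
  have hf' := hφ.comp_affine D (-(t • u)) hDinj
  rw [hBeq] at hf'
  have hmem : ∀ r ∈ ball t (ρ / (‖u‖ + 1)),
      r • x ∈ (fun z => D z + -(t • u)) ⁻¹' ball (0 : E') ρ := by
    intro r hr
    rw [mem_preimage, map_smul, hDx, add_comm]
    exact hball r hr
  have hff' : ∀ᶠ z in 𝓝 (s • x), f z = φ (D z + -(t • u)) := by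
    filter_upwards [hD] with z hz
    rw [hz, map_sub, map_smul, hDx]
    congr 1
    abel
  refine ⟨_, _, hf', hmem s' hs', ?_⟩
  have hcy : ∀ r : ℝ, ContinuousAt (fun y : E' => r • y) x := fun r => by fun_prop
  filter_upwards [hfγ, (hcy s).eventually (eventually_eventually_nhds.2 hff'),
    (hcy s).eventually (hf'.isOpen.mem_nhds (hmem s hs)),
    (hcy s').eventually (hf'.isOpen.mem_nhds (hmem s' hs'))] with y h1 h2 h3 h4
  -- For fixed `y` the times at which `r y` lies in the new domain form an interval containing `s`
  -- and `s'`, along which agreement with the geodesic propagates.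
  have hJ : IsPreconnected
      ((fun r : ℝ => r • D y) ⁻¹' ball (t • u) ρ) :=
    ((convex_ball (t • u) ρ).is_linear_preimage
      (IsLinearMap.isLinearMap_smul' (D y))).isPreconnected
  have hJeq : ∀ r : ℝ, r • D y ∈ ball (t • u) ρ ↔
      0 + r • y ∈ (fun z => D z + -(t • u)) ⁻¹' ball (0 : E') ρ := by
    intro r
    rw [zero_add, mem_preimage, map_smul, mem_ball_zero_iff, mem_ball, dist_eq_norm, sub_eq_add_neg]
  have hcr : ContinuousAt (fun r : ℝ => r • y) s := by fun_prop
  have h5 := (hγ y).eventuallyEq_line_of_isPreconnected hf' hdim (p := 0) (v := y) (t₀ := s)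
    (by filter_upwards [h1, hcr.eventually h2] with r h6 h7; rw [zero_add, h6, h7]) hJ
    ((hJeq s).2 (by rwa [zero_add])) (fun r hr => (hJeq r).1 hr) s'
    ((hJeq s').2 (by rwa [zero_add]))
  simpa only [zero_add] using h5

/-- The exponential map of a flat complete manifold is a flat parametrization on the whole tangent
space. -/
theorem exists_isFlatParam_univ [T2Space M] {b : Module.Basis ι ℝ E}
    (hchart : ∀ q : M, ∃ (B : E →L[ℝ] E →L[ℝ] ℝ) (φ : E → M) (ρ : ℝ), 0 < ρ ∧
      IsFlatParam I g B φ (ball 0 ρ) ∧ φ 0 = q)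
    (hcomplete : IsGeodesicallyComplete I b g) (q : M) (L : E →L[ℝ] TangentSpace I q)
    (hL : Function.Injective L) :
    ∃ (B : E →L[ℝ] E →L[ℝ] ℝ) (F : E → M), IsFlatParam I g B F univ ∧ F 0 = q ∧
      ∀ v : E, (mfderiv 𝓘(ℝ, E) I F 0 v : E) = (L v : E) := by
  have hbij : ∀ T : E →L[ℝ] E, Function.Injective T → Function.Bijective T := fun T hT =>
    ⟨hT, (LinearMap.injective_iff_surjective (f := T.toLinearMap)).1 hT⟩
  obtain ⟨B₀, φ₀, ρ₀, hρ₀, hφ₀, rfl⟩ := hchart q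
  have h0 : (0 : E) ∈ ball (0 : E) ρ₀ := mem_ball_self hρ₀
  -- A linear change of variables makes the derivative of the parametrization at the origin equal to
  -- the prescribed map `L`.
  obtain ⟨T, hTinj, hT⟩ : ∃ T : E →L[ℝ] E, Function.Injective T ∧
      ∀ v, mfderiv 𝓘(ℝ, E) I φ₀ 0 (T v) = L v := by
    obtain ⟨K, hK⟩ := exists_continuousLinearEquiv_of_injective (E := E)
      (hφ₀.injective_mfderiv h0)
    refine ⟨(K.symm : E →L[ℝ] E) ∘L (L : E →L[ℝ] E), K.symm.injective.comp hL, fun v => ?_⟩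
    exact (congrArg (fun S : E →L[ℝ] E => S (K.symm (L v))) hK).symm.trans
      (K.apply_symm_apply (L v))
  have hf₀ := hφ₀.comp_affine T 0 hTinj
  set B : E →L[ℝ] E →L[ℝ] ℝ := ((B₀.comp T).flip.comp T).flip with hB
  set f₀ : E → M := fun x => φ₀ (T x + 0) with hf₀def
  set W₀ : Set E := (fun x => T x + 0) ⁻¹' ball 0 ρ₀ with hW₀
  have h0W : (0 : E) ∈ W₀ := by simpa [hW₀] using hρ₀
  have hf₀0 : f₀ 0 = φ₀ 0 := by simp [hf₀def]
  have hdf₀ : ∀ v : E, (mfderiv 𝓘(ℝ, E) I f₀ 0 v : E) = (L v : E) := by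
    intro v
    have h2 : T 0 + 0 = 0 := by simp
    have h3 : HasMFDerivAt 𝓘(ℝ, E) I φ₀ (T 0 + 0) (mfderiv 𝓘(ℝ, E) I φ₀ 0 : E →L[ℝ] E) := by
      rw [h2]; exact (hφ₀.mdifferentiableAt h0).hasMFDerivAt
    have h1 : HasMFDerivAt 𝓘(ℝ, E) I f₀ 0 _ :=
      HasMFDerivAt.comp (g := φ₀) (f := fun x => T x + 0) (0 : E) h3
        (T.hasFDerivAt.add_const 0).hasMFDerivAt
    rw [h1.mfderiv]
    exact hT v
  choose γ hγ using fun y : E => hcomplete (φ₀ 0) (L y)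
  have hγ0 : ∀ y, ∀ᶠ r in 𝓝 (0 : ℝ), γ y r = f₀ (0 + r • y) := by
    intro y
    have h1 := TotalSpace.mk.inj (hγ y).2
    have h2 : (0 : E) + (0 : ℝ) • y = 0 := by simp
    have h3 : (0 : E) + (0 : ℝ) • y ∈ W₀ := by rw [h2]; exact h0W
    refine (hγ y).1.eventuallyEq_line hf₀ rfl h3 ?_ ?_
    · rw [h2, hf₀0, h1.1]
    · have h4 : (mfderiv 𝓘(ℝ, ℝ) I (γ y) 0 (1 : ℝ) : E) = (L y : E) := eq_of_heq h1.2
      rw [h4, h2]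
      exact (hdf₀ y).symm
  -- For each ray the set of times near which the family `γ y r` has the form `f(r y)`, with `y`
  -- near `x` and `f` a flat parametrization, contains `0`. It is open and closed because around
  -- each time there is an interval on which the property spreads from any time to any other.
  have hray : ∀ (x : E) (t : ℝ), ∃ (f : E → M) (W : Set E), IsFlatParam I g B f W ∧ t • x ∈ W ∧
      ∀ᶠ y in 𝓝 x, ∀ᶠ r in 𝓝 t, γ y r = f (r • y) := by
    intro x
    have hstep : ∀ t : ℝ, ∃ δ > 0, ∀ s ∈ ball t δ, ∀ s' ∈ ball t δ,
        (∃ (f : E → M) (W : Set E), IsFlatParam I g B f W ∧ s • x ∈ W ∧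
          ∀ᶠ y in 𝓝 x, ∀ᶠ r in 𝓝 s, γ y r = f (r • y)) →
        ∃ (f : E → M) (W : Set E), IsFlatParam I g B f W ∧ s' • x ∈ W ∧
          ∀ᶠ y in 𝓝 x, ∀ᶠ r in 𝓝 s', γ y r = f (r • y) := by
      intro t
      obtain ⟨B', φ, ρ, hρ, hφ, hφ0⟩ := hchart (γ x t)
      have h0ρ : (0 : E) ∈ ball (0 : E) ρ := mem_ball_self hρ
      obtain ⟨u, hu⟩ := (hbij (mfderiv 𝓘(ℝ, E) I φ 0 : E →L[ℝ] E)
        (hφ.injective_mfderiv h0ρ)).2 (mfderiv 𝓘(ℝ, ℝ) I (γ x) t (1 : ℝ))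
      have hcancel : -(t • u) + t • u = 0 := by abel
      have hnear : ∀ᶠ r in 𝓝 t, γ x r = φ (-(t • u) + r • u) := by
        refine (hγ x).1.eventuallyEq_line hφ rfl (by rwa [hcancel]) (by rw [hcancel, hφ0]) ?_
        rw [hcancel]
        exact hu.symm
      -- This radius keeps `(r - t) u` in the ball of radius `ρ`; the `+ 1` covers `u = 0`.
      have hδ : 0 < ρ / (‖u‖ + 1) := by positivity
      refine ⟨_, hδ, fun s hs s' hs' h => exists_isFlatParam_ray_of_mem_ball rfl
        (fun y => (hγ y).1) hφ
        ?_ hs hs' h⟩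
      refine (hγ x).1.eventuallyEq_line_of_isPreconnected hφ rfl hnear
        (convex_ball t _).isPreconnected (mem_ball_self hδ) fun r hr => ?_
      rw [mem_ball_zero_iff]
      have h1 : -(t • u) + r • u = (r - t) • u := by rw [sub_smul]; abel
      rw [h1, norm_smul]
      rw [mem_ball, dist_eq_norm, lt_div_iff₀ (by positivity)] at hr
      nlinarith [norm_nonneg (r - t)]
    set S : Set ℝ := {t | ∃ (f : E → M) (W : Set E), IsFlatParam I g B f W ∧ t • x ∈ W ∧
      ∀ᶠ y in 𝓝 x, ∀ᶠ r in 𝓝 t, γ y r = f (r • y)} with hS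
    have hSclopen : IsClopen S := by
      constructor
      · refine isClosed_of_closure_subset fun t ht => ?_
        obtain ⟨δ, hδ, h⟩ := hstep t
        obtain ⟨s, hsS, hs⟩ := Metric.mem_closure_iff.1 ht δ hδ
        exact h s (by rwa [mem_ball, dist_comm]) t (mem_ball_self hδ) hsS
      · refine Metric.isOpen_iff.2 fun t ht => ?_
        obtain ⟨δ, hδ, h⟩ := hstep t
        exact ⟨δ, hδ, fun s hs => h t (mem_ball_self hδ) s hs ht⟩
    have h0S : (0 : ℝ) ∈ S :=
      ⟨f₀, W₀, hf₀, by rwa [zero_smul], Eventually.of_forall fun y => by simpa using hγ0 y⟩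
    have hSu : S = univ := hSclopen.eq_univ ⟨0, h0S⟩
    intro t
    exact (hSu ▸ mem_univ t : t ∈ S)
  -- At time one the family is `F y = γ y 1`, which therefore coincides near each point with some
  -- flat parametrization for the same form `B`.
  have hF : ∀ x, ∃ (f : E → M) (W : Set E), IsFlatParam I g B f W ∧ x ∈ W ∧
      (fun y => γ y 1) =ᶠ[𝓝 x] f := by
    intro x
    obtain ⟨f, W, h1, h2, h3⟩ := hray x 1
    rw [one_smul] at h2
    exact ⟨f, W, h1, h2, h3.mono fun y hy => by simpa using hy.self_of_nhds⟩
  have hF0 : (fun y => γ y 1) =ᶠ[𝓝 0] f₀ := by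
    filter_upwards [hf₀.isOpen.mem_nhds h0W] with y hy
    have hconv : Convex ℝ W₀ := by
      have := (convex_ball (0 : E) ρ₀).is_linear_preimage T.toLinearMap.isLinear
      simpa [hW₀] using this
    have hJ : IsPreconnected ((fun r : ℝ => r • y) ⁻¹' W₀) :=
      (hconv.is_linear_preimage (IsLinearMap.isLinearMap_smul' y)).isPreconnected
    have h1 := (hγ y).1.eventuallyEq_line_of_isPreconnected hf₀ rfl (hγ0 y) hJ
      (by simpa using h0W) (fun r hr => by simpa using hr) 1 (by simpa using hy)
    simpa using h1.self_of_nhds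
  refine ⟨B, fun y => γ y 1, ⟨isOpen_univ, fun x _ => ?_, hf₀.symm, hf₀.definite,
    fun x _ v w => ?_⟩, ?_, fun v => ?_⟩
  · obtain ⟨f, W, h1, h2, h3⟩ := hF x
    exact ((h1.contMDiffOn.contMDiffAt (h1.isOpen.mem_nhds h2)).congr_of_eventuallyEq
      h3).contMDiffWithinAt
  · obtain ⟨f, W, h1, h2, h3⟩ := hF x
    rw [← h1.isometry x h2 v w]
    exact metric_congr h3.self_of_nhds (by rw [h3.mfderiv_eq]; rfl) (by rw [h3.mfderiv_eq]; rfl)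
  · exact hF0.self_of_nhds.trans hf₀0
  · rw [hF0.mfderiv_eq]
    exact hdf₀ v

end GlobalParam

/-! ### The base manifold -/

section Charts

set_option maxSynthPendingDepth 3

open Set Metric Filter
open scoped Topology

variable {E : Type*} [NormedAddCommGroup E] [NormedSpace ℝ E]
  {H : Type*} [TopologicalSpace H] {I : ModelWithCorners ℝ E H} [I.Boundaryless]
  {M : Type*} [TopologicalSpace M] [ChartedSpace H M] [IsManifold I ∞ M]
  {e : OpenPartialHomeomorph M H}

omit [IsManifold I ∞ M] in
theorem contMDiffAt_extend_symm (he : e ∈ IsManifold.maximalAtlas I ∞ M) {y : E}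
    (hy : y ∈ (e.extend I).target) : ContMDiffAt 𝓘(ℝ, E) I ∞ (e.extend I).symm y := by
  refine (contMDiffOn_extend_symm he).contMDiffAt (x := y) ?_
  rw [← e.extend_target']
  exact e.isOpen_extend_target.mem_nhds hy

omit [IsManifold I ∞ M] in
theorem mfderiv_extend_symm_right (he : e ∈ IsManifold.maximalAtlas I ∞ M) {y : E}
    (hy : y ∈ (e.extend I).target) (v : E) :
    mfderiv I 𝓘(ℝ, E) (e.extend I) ((e.extend I).symm y)
      (mfderiv 𝓘(ℝ, E) I (e.extend I).symm y v) = v := by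
  have hsrc : (e.extend I).symm y ∈ e.source := by
    rw [← e.extend_source (I := I)]; exact (e.extend I).map_target hy
  have h1 : HasMFDerivAt 𝓘(ℝ, E) 𝓘(ℝ, E) (e.extend I ∘ (e.extend I).symm) y _ :=
    (((e.contMDiffAt_extend he hsrc)).mdifferentiableAt
    (by simp)).hasMFDerivAt.comp y
    ((contMDiffAt_extend_symm he hy).mdifferentiableAt (by simp)).hasMFDerivAt
  have h2 : HasMFDerivAt 𝓘(ℝ, E) 𝓘(ℝ, E) (e.extend I ∘ (e.extend I).symm) y _ :=
    (hasMFDerivAt_id y).congr_of_eventuallyEq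
    (by
      filter_upwards [e.isOpen_extend_target.mem_nhds hy] with z hz
      exact (e.extend I).right_inv hz)
  have h3 := hasMFDerivAt_unique h1 h2
  exact congrArg (fun T : E →L[ℝ] E => T v) h3

variable {E' : Type*} [NormedAddCommGroup E'] [NormedSpace ℝ E']

omit [I.Boundaryless] in
-- The vector field `y ↦ df_y v` along `f` is the tangent map composed with the constant section
-- `v`. It gives smoothness of metric coefficients and of coordinate vector fields.
theorem contMDiffOn_mfderiv_apply {f : E' → M} {s : Set E'} (hs : IsOpen s)
    (hf : ContMDiffOn 𝓘(ℝ, E') I ∞ f s) (v : E') :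
    ContMDiffOn 𝓘(ℝ, E') I.tangent ∞
      (fun y => (⟨f y, mfderiv 𝓘(ℝ, E') I f y v⟩ : TangentBundle I M)) s := by
  have h1 := hf.contMDiffOn_tangentMapWithin (m := ∞) (by simp) hs.uniqueMDiffOn
  have h2 : ContMDiffOn 𝓘(ℝ, E') 𝓘(ℝ, E').tangent ∞
      (fun y => (⟨y, v⟩ : TangentBundle 𝓘(ℝ, E') E')) s :=
    contMDiffOn_vectorSpace_iff_contDiffOn.2 contDiffOn_const
  refine (h1.comp h2 fun y hy => hy).congr fun y hy => ?_
  change _ = (⟨f y, mfderivWithin 𝓘(ℝ, E') I f s y v⟩ : TangentBundle I M)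
  rw [mfderivWithin_of_isOpen hs hy]

theorem bilinOf_eq_comp [FiniteDimensional ℝ E] {ι : Type*} [Fintype ι] [DecidableEq ι]
    (b : Module.Basis ι ℝ E) {m : Matrix ι ι ℝ} {B : E' →L[ℝ] E' →L[ℝ] ℝ} {T : E →L[ℝ] E'}
    (h : ∀ i j, m i j = B (T (b i)) (T (b j))) (v w : E) : bilinOf b m v w = B (T v) (T w) := by
  have h1 : bilinOf b m = ((B.comp T).flip.comp T).flip := by
    refine ContinuousLinearMap.coe_injective (b.ext fun i => ?_)
    refine ContinuousLinearMap.coe_injective (b.ext fun j => ?_)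
    simpa using (bilinOf_basis b m i j).trans (h i j)
  rw [h1]
  rfl

end Charts

/-! ### Flat parametrizations of the base -/

section Base

set_option maxSynthPendingDepth 3

open Set Metric Filter
open scoped Topology

variable {n : ℕ} {Q : Type*} [TopologicalSpace Q] [ChartedSpace (Model n) Q]
  [IsManifold (𝓡 n) ω Q]
  (σ : ContMDiffRiemannianMetric (𝓡 n) ω (Model n) (fun q : Q => TangentSpace (𝓡 n) q))

theorem baseMetric_definite {q : Q} {v : TangentSpace (𝓡 n) q} (h : baseMetric σ q v v = 0) :
    v = 0 := by
  by_contra hv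
  exact (σ.pos q v hv).ne' h

theorem contDiffOn_baseMetric {E' : Type*} [NormedAddCommGroup E'] [NormedSpace ℝ E'] {f : E' → Q}
    {s : Set E'} (hs : IsOpen s) (hf : ContMDiffOn 𝓘(ℝ, E') (𝓡 n) ∞ f s) (v w : E') :
    ContDiffOn ℝ ∞ (fun y => baseMetric σ (f y) (mfderiv 𝓘(ℝ, E') (𝓡 n) f y v)
      (mfderiv 𝓘(ℝ, E') (𝓡 n) f y w)) s := by
  intro x hx
  have hb := hf x hx
  have : ContMDiffWithinAt 𝓘(ℝ, E') ((𝓡 n).prod 𝓘(ℝ)) ∞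
      (fun m ↦ TotalSpace.mk' ℝ (E := Bundle.Trivial Q ℝ) (f m)
        (σ.inner (f m) (mfderiv 𝓘(ℝ, E') (𝓡 n) f m v) (mfderiv 𝓘(ℝ, E') (𝓡 n) f m w))) s x := by
    apply ContMDiffWithinAt.clm_bundle_apply₂ (F₁ := Model n) (F₂ := Model n)
    · exact ContMDiffAt.comp_contMDiffWithinAt x
        ((σ.contMDiff.of_le (by exact le_top)).contMDiffAt (n := ∞)) hb
    · exact contMDiffOn_mfderiv_apply hs hf v x hx
    · exact contMDiffOn_mfderiv_apply hs hf w x hx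
  simp only [contMDiffWithinAt_totalSpace] at this
  exact this.2.contDiffWithinAt

theorem metricMatrix_bilinOf {e : OpenPartialHomeomorph Q (Model n)} (y v w : Model n) :
    baseMetric σ ((e.extend (𝓡 n)).symm y)
      (mfderiv 𝓘(ℝ, Model n) (𝓡 n) (e.extend (𝓡 n)).symm y v)
      (mfderiv 𝓘(ℝ, Model n) (𝓡 n) (e.extend (𝓡 n)).symm y w) =
    bilinOf (stdBasis n) (metricMatrix (𝓡 n) (stdBasis n) (baseMetric σ) e y) v w := by
  refine (bilinOf_eq_comp (stdBasis n) (E' := Model n) (B := (σ.inner ((e.extend (𝓡 n)).symm y) :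
    Model n →L[ℝ] Model n →L[ℝ] ℝ)) (T := mfderiv 𝓘(ℝ, Model n) (𝓡 n) (e.extend (𝓡 n)).symm y)
    (fun i j => ?_) v w).symm
  rfl

/-- This holds at every `y`, also outside the target of the chart, because `σ` is symmetric on any
two tangent vectors. -/
theorem metricMatrix_isSymm {e : OpenPartialHomeomorph Q (Model n)} (y : Model n) :
    (metricMatrix (𝓡 n) (stdBasis n) (baseMetric σ) e y).IsSymm := by
  ext i j
  exact σ.symm _ _ _

theorem isUnit_det_metricMatrix {e : OpenPartialHomeomorph Q (Model n)}
    (he : e ∈ IsManifold.maximalAtlas (𝓡 n) ∞ Q) {y : Model n}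
    (hy : y ∈ (e.extend (𝓡 n)).target) :
    IsUnit (metricMatrix (𝓡 n) (stdBasis n) (baseMetric σ) e y).det := by
  refine isUnit_det_of_pullback (stdBasis n)
    (B := bilinOf (stdBasis n) (metricMatrix (𝓡 n) (stdBasis n) (baseMetric σ) e y))
    (T := ContinuousLinearMap.id ℝ (Model n)) (fun v hv => ?_) Function.injective_id
    fun i j => (bilinOf_basis _ _ i j).symm
  rw [← metricMatrix_bilinOf] at hv
  have h1 := baseMetric_definite σ hv
  rw [← mfderiv_extend_symm_right he hy v, h1, map_zero]
  rfl

/-- A flat metric has flat parametrizations near every point. -/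
theorem exists_isFlatParam_baseMetric (hflat : IsFlat (𝓡 n) (stdBasis n) (baseMetric σ)) (q : Q) :
    ∃ (B : Model n →L[ℝ] Model n →L[ℝ] ℝ) (φ : Model n → Q) (ρ : ℝ), 0 < ρ ∧
      IsFlatParam (𝓡 n) (baseMetric σ) B φ (ball 0 ρ) ∧ φ 0 = q := by
  set e := chartAt (Model n) q with hedef
  have he : e ∈ IsManifold.maximalAtlas (𝓡 n) ∞ Q := IsManifold.chart_mem_maximalAtlas _
  set b := stdBasis n
  set h := metricMatrix (𝓡 n) b (baseMetric σ) e with hh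
  set y₀ := e.extend (𝓡 n) q with hy₀
  set s := (e.extend (𝓡 n)).target with hs
  have hy₀s : y₀ ∈ s := (e.extend (𝓡 n)).map_source (by
    rw [e.extend_source]; exact mem_chart_source _ q)
  have hso : IsOpen s := e.isOpen_extend_target
  have hsm : ContMDiffOn 𝓘(ℝ, Model n) (𝓡 n) ∞ (e.extend (𝓡 n)).symm s :=
    fun y hy => (contMDiffAt_extend_symm he hy).contMDiffWithinAt
  obtain ⟨r, hr, hrs, ψ, hψ0, hψd, hψ, hψh⟩ := exists_flat_coord b hso hy₀s (h := h)
    (fun i j => contDiffOn_baseMetric σ hso hsm (b i) (b j)) (metricMatrix_isSymm σ)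
    (fun y hy => isUnit_det_metricMatrix σ he hy) (fun y hy l k i j => hflat q y hy l k i j)
  have hballr : y₀ ∈ ball y₀ r := mem_ball_self hr
  have hψa : ContDiffAt ℝ ∞ ψ y₀ := hψ.contDiffAt (isOpen_ball.mem_nhds hballr)
  have hψd' : HasFDerivAt ψ
      ((ContinuousLinearEquiv.refl ℝ (Model n) : Model n ≃L[ℝ] Model n) : Model n →L[ℝ] Model n)
      y₀ := by
    have := (hψa.differentiableAt (by simp)).hasFDerivAt
    rw [hψd] at this
    exact this
  -- The parametrization is the inverse of the chart composed with the local inverse of the flat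
  -- coordinates `ψ`.
  set Φ := hψa.toOpenPartialHomeomorph ψ hψd' (by simp) with hΦ
  have hΦs : y₀ ∈ Φ.source := hψa.mem_toOpenPartialHomeomorph_source hψd' (by simp)
  have h0t : (0 : Model n) ∈ Φ.target := by
    rw [← hψ0]; exact Φ.map_source hΦs
  have hΦ0 : Φ.symm 0 = y₀ := by
    rw [← hψ0]; exact Φ.left_inv hΦs
  have hVo : IsOpen (Φ.target ∩ Φ.symm ⁻¹' ball y₀ r) := Φ.isOpen_inter_preimage_symm isOpen_ball
  obtain ⟨ρ, hρ, hρV⟩ := Metric.isOpen_iff.1 hVo 0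
    ⟨h0t, by rw [mem_preimage, hΦ0]; exact hballr⟩
  have hpull : ∀ y ∈ ball y₀ r, ∀ v w, bilinOf b (h y) v w =
      bilinOf b (h y₀) (fderiv ℝ ψ y v) (fderiv ℝ ψ y w) := by
    intro y hy v w
    exact bilinOf_eq_comp b (hψh y hy) v w
  -- `ψ` has invertible derivative on the whole ball, since a kernel vector would be null for the
  -- metric; this makes the inverse smooth near `0` and not only at `0`.
  have hequiv : ∀ y ∈ ball y₀ r, ∃ K : Model n ≃L[ℝ] Model n,
      HasFDerivAt ψ (K : Model n →L[ℝ] Model n) y := by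
    intro y hy
    have hinj : Function.Injective (fderiv ℝ ψ y) := by
      refine (injective_iff_map_eq_zero (fderiv ℝ ψ y)).2 fun v hv => ?_
      have h1 := hpull y hy v v
      rw [hv, map_zero, ← metricMatrix_bilinOf] at h1
      rw [← mfderiv_extend_symm_right he (hrs hy) v, baseMetric_definite σ h1, map_zero]
      rfl
    obtain ⟨K, hK⟩ := exists_continuousLinearEquiv_of_injective hinj
    refine ⟨K, hK ▸ ?_⟩
    exact ((hψ.contDiffAt (isOpen_ball.mem_nhds hy)).differentiableAt (by simp)).hasFDerivAt
  have hΦsm : ∀ x ∈ ball (0 : Model n) ρ, ContDiffAt ℝ ∞ Φ.symm x := by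
    intro x hx
    obtain ⟨h1, h2⟩ := hρV hx
    obtain ⟨K, hK⟩ := hequiv _ h2
    exact Φ.contDiffAt_symm h1 hK (hψ.contDiffAt (isOpen_ball.mem_nhds h2))
  have hφsm : ∀ x ∈ ball (0 : Model n) ρ,
      ContMDiffAt 𝓘(ℝ, Model n) (𝓡 n) ∞ (fun x => (e.extend (𝓡 n)).symm (Φ.symm x)) x := by
    intro x hx
    exact ContMDiffAt.comp (g := (e.extend (𝓡 n)).symm) x
      (contMDiffAt_extend_symm he (hrs (hρV hx).2)) (hΦsm x hx).contMDiffAt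
  refine ⟨bilinOf b (h y₀), fun x => (e.extend (𝓡 n)).symm (Φ.symm x), ρ, hρ,
    ⟨isOpen_ball, fun x hx => (hφsm x hx).contMDiffWithinAt, fun v w => ?_, fun v hv => ?_,
      fun x hx v w => ?_⟩, ?_⟩
  · rw [← metricMatrix_bilinOf, ← metricMatrix_bilinOf]
    exact σ.symm _ _ _
  · rw [← metricMatrix_bilinOf] at hv
    rw [← mfderiv_extend_symm_right he hy₀s v, baseMetric_definite σ hv, map_zero]
    rfl
  · have hΦd := ((hΦsm x hx).differentiableAt (by simp)).hasFDerivAt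
    have h1 : HasMFDerivAt 𝓘(ℝ, Model n) (𝓡 n) (fun x => (e.extend (𝓡 n)).symm (Φ.symm x)) x _ :=
      HasMFDerivAt.comp (g := (e.extend (𝓡 n)).symm) x
        ((contMDiffAt_extend_symm he (hrs (hρV hx).2)).mdifferentiableAt (by simp)).hasMFDerivAt
        hΦd.hasMFDerivAt
    have h2 : ∀ v, fderiv ℝ ψ (Φ.symm x) (fderiv ℝ Φ.symm x v) = v := by
      intro v
      have h3 := (((hψ.contDiffAt (isOpen_ball.mem_nhds (hρV hx).2)).differentiableAt
        (by simp)).hasFDerivAt).comp x hΦd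
      have h4 : HasFDerivAt (ψ ∘ Φ.symm) (ContinuousLinearMap.id ℝ (Model n)) x :=
        (hasFDerivAt_id x).congr_of_eventuallyEq (Φ.eventually_right_inverse (hρV hx).1)
      exact congrArg (fun T : Model n →L[ℝ] Model n => T v) (h3.unique h4)
    rw [h1.mfderiv]
    refine (metricMatrix_bilinOf σ (e := e) (Φ.symm x) (fderiv ℝ Φ.symm x v)
      (fderiv ℝ Φ.symm x w)).trans ?_
    rw [hpull _ (hρV hx).2, h2, h2]
  · simp only
    rw [hΦ0]
    exact e.extend_left_inv (mem_chart_source _ q)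

end Base

/-! ### The cotangent bundle -/

section CotangentBundle

set_option maxSynthPendingDepth 3

open Set Metric Filter
open scoped Topology

variable {n : ℕ} {Q : Type*} [TopologicalSpace Q] [ChartedSpace (Model n) Q]
  [IsManifold (𝓡 n) ω Q]

/-- Points over different base points are separated by the projection, points of one fibre by a
trivialization. Uniqueness of geodesics in `T^*Q` depends on this. -/
instance [T2Space Q] : T2Space (Cotangent n Q) := by
  refine ⟨fun x y hxy => ?_⟩
  have hc : Continuous (fun m : Cotangent n Q => m.proj) := FiberBundle.continuous_proj _ _
  by_cases h : x.proj = y.proj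
  · set τ := trivializationAt (Model n →L[ℝ] ℝ)
      (fun q : Q => TangentSpace (𝓡 n) q →L[ℝ] Bundle.Trivial Q ℝ q) x.proj with hτ
    have hx : x ∈ τ.source := FiberBundle.mem_trivializationAt_proj_source
    have hy : y ∈ τ.source := by
      rw [τ.mem_source, ← h, ← τ.mem_source]; exact hx
    have hne : τ x ≠ τ y := fun h' => hxy (τ.injOn hx hy h')
    obtain ⟨u, v, hu, hv, hxu, hyv, huv⟩ := t2_separation hne
    refine ⟨τ.source ∩ τ ⁻¹' u, τ.source ∩ τ ⁻¹' v,
      τ.toOpenPartialHomeomorph.isOpen_inter_preimage hu,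
      τ.toOpenPartialHomeomorph.isOpen_inter_preimage hv, ⟨hx, hxu⟩, ⟨hy, hyv⟩, ?_⟩
    exact (huv.preimage τ).mono inter_subset_right inter_subset_right
  · obtain ⟨u, v, hu, hv, hxu, hyv, huv⟩ := t2_separation h
    exact ⟨_, _, hu.preimage hc, hv.preimage hc, hxu, hyv, huv.preimage _⟩

/-- The fibre component of the bundle trivialization evaluates the covector on the frame of the
chart at `q₀`; so the charts of the total space are the canonical coordinates `(q, p)`. -/
theorem cotangent_trivializationAt_apply (q₀ : Q) (m : Cotangent n Q)
    (hm : m.proj ∈ (chartAt (Model n) q₀).source) (v : Model n) :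
    (trivializationAt (Model n →L[ℝ] ℝ)
      (fun q : Q => TangentSpace (𝓡 n) q →L[ℝ] Bundle.Trivial Q ℝ q) q₀ m).2 v =
    (m.2 : Model n →L[ℝ] ℝ) (mfderiv 𝓘(ℝ, Model n) (𝓡 n) (extChartAt (𝓡 n) q₀).symm
        (extChartAt (𝓡 n) q₀ m.proj) v) := by
  rw [hom_trivializationAt_apply]
  have h1 := TangentBundle.symmL_trivializationAt (I := 𝓡 n) hm
  rw [(𝓡 n).range_eq_univ, mfderivWithin_univ] at h1
  simp only [ContinuousLinearMap.inCoordinates, h1]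
  simp
  rfl

theorem inverse_apply_of_injective {E : Type*} [NormedAddCommGroup E]
    [NormedSpace ℝ E] [FiniteDimensional ℝ E] {T : E →L[ℝ] E} (hT : Function.Injective T) (v : E) :
    T.inverse (T v) = v := by
  obtain ⟨K, rfl⟩ := exists_continuousLinearEquiv_of_injective hT
  rw [ContinuousLinearMap.inverse_equiv]
  exact K.symm_apply_apply v

/-- The fibrewise linear lift to the cotangent bundle of a map `F`, which uses the inner product
`B` to identify the second argument with a covector. -/
def cotangentLift (B : Model n →L[ℝ] Model n →L[ℝ] ℝ) (F : Model n → Q)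
    (z : Model n × Model n) : Cotangent n Q :=
  ⟨F z.1, ((B z.2 : Model n →L[ℝ] ℝ).comp (ContinuousLinearMap.inverse (R := ℝ) (M := Model n)
    (M₂ := Model n) (mfderiv 𝓘(ℝ, Model n) (𝓡 n) F z.1)) : Model n →L[ℝ] ℝ)⟩

variable {σ : ContMDiffRiemannianMetric (𝓡 n) ω (Model n) (fun q : Q => TangentSpace (𝓡 n) q)}
  {B : Model n →L[ℝ] Model n →L[ℝ] ℝ} {F : Model n → Q}

/-- `dF_x` is injective between spaces of equal dimension, so the `inverse` in the lift is a genuine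
inverse and not the default value. -/
theorem IsFlatParam.cotangentLift_apply (hF : IsFlatParam (𝓡 n) (baseMetric σ) B F univ)
    (x b v : Model n) :
    ((cotangentLift B F (x, b)).2 : Model n →L[ℝ] ℝ)
      (mfderiv 𝓘(ℝ, Model n) (𝓡 n) F x v) = B b v := by
  exact congrArg (B b) (inverse_apply_of_injective (E := Model n)
    (hF.injective_mfderiv (mem_univ x)) v)

/-- Canonical coordinates of the lift of a flat parametrization. -/
theorem IsFlatParam.exists_coord_cotangent (hF : IsFlatParam (𝓡 n) (baseMetric σ) B F univ)
    {e : OpenPartialHomeomorph Q (Model n)} (he : e ∈ IsManifold.maximalAtlas (𝓡 n) ∞ Q)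
    {x : Model n} (hx : F x ∈ e.source) :
    ∃ χ : Model n → Model n, ContDiffAt ℝ ∞ χ (e.extend (𝓡 n) (F x)) ∧
      (∀ᶠ y in 𝓝 (e.extend (𝓡 n) (F x)), ContDiffAt ℝ 2 χ y ∧ Function.Bijective (fderiv ℝ χ y) ∧
        ∀ i j, metricMatrix (𝓡 n) (stdBasis n) (baseMetric σ) e y i j =
          B (fderiv ℝ χ y (stdBasis n i)) (fderiv ℝ χ y (stdBasis n j))) ∧
      ∀ᶠ x' in 𝓝 x, F x' ∈ e.source ∧
        (∀ v : Model n, fderiv ℝ χ (e.extend (𝓡 n) (F x'))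
          (fderiv ℝ (fun x => e.extend (𝓡 n) (F x)) x' v) = v) ∧
        (∀ v : Model n, (mfderiv 𝓘(ℝ, Model n) (𝓡 n) F x'
            (fderiv ℝ χ (e.extend (𝓡 n) (F x')) v) : Model n) =
          mfderiv 𝓘(ℝ, Model n) (𝓡 n) (e.extend (𝓡 n)).symm (e.extend (𝓡 n) (F x')) v) ∧
        ∀ b v : Model n, ((cotangentLift B F (x', b)).2 : Model n →L[ℝ] ℝ)
          (mfderiv 𝓘(ℝ, Model n) (𝓡 n) (e.extend (𝓡 n)).symm (e.extend (𝓡 n) (F x')) v) =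
          B b (fderiv ℝ χ (e.extend (𝓡 n) (F x')) v) := by
  obtain ⟨χ, hχ, hχa, ev1, ev2, ev3⟩ := hF.exists_coord (b := stdBasis n) rfl he (mem_univ x) hx
  have hFx : ContMDiffAt 𝓘(ℝ, Model n) (𝓡 n) ∞ F x :=
    hF.contMDiffOn.contMDiffAt (hF.isOpen.mem_nhds (mem_univ x))
  have hψ : ∀ x', F x' ∈ e.source → ContDiffAt ℝ ∞ (fun x => e.extend (𝓡 n) (F x)) x' :=
    fun x' hx' => contMDiffAt_iff_contDiffAt.1 ((e.contMDiffAt_extend he hx').comp x'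
      (hF.contMDiffOn.contMDiffAt (hF.isOpen.mem_nhds (mem_univ x'))))
  refine ⟨χ, hχ, ev3.mono fun y hy => ⟨hy.2.1, hy.2.2.1, hy.2.2.2.2⟩, ?_⟩
  filter_upwards [hFx.continuousAt.eventually (e.open_source.mem_nhds hx),
    eventually_eventually_nhds.2 ev1, (hψ x hx).continuousAt.eventually ev3] with x' h1 h2 h3
  have h4 : ∀ v : Model n, (mfderiv 𝓘(ℝ, Model n) (𝓡 n) F x'
      (fderiv ℝ χ (e.extend (𝓡 n) (F x')) v) : Model n) =
        mfderiv 𝓘(ℝ, Model n) (𝓡 n) (e.extend (𝓡 n)).symm (e.extend (𝓡 n) (F x')) v := by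
    have h5 := h3.2.2.2.1
    rw [h2.self_of_nhds] at h5
    exact h5
  refine ⟨h1, fun v => ?_, h4, fun b v => ?_⟩
  · have h5 : HasFDerivAt (fun x => χ (e.extend (𝓡 n) (F x))) _ x' :=
      HasFDerivAt.comp (g := χ) x' (h3.2.1.differentiableAt (by norm_num)).hasFDerivAt
        ((hψ x' h1).differentiableAt (by simp)).hasFDerivAt
    have h6 : HasFDerivAt (fun x => χ (e.extend (𝓡 n) (F x))) (ContinuousLinearMap.id ℝ _) x' :=
      (hasFDerivAt_id x').congr_of_eventuallyEq h2
    exact congrArg (fun T : Model n →L[ℝ] Model n => T v) (h5.unique h6)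
  · rw [← hF.cotangentLift_apply x' b]
    exact congrArg _ (h4 v).symm

/-- In the canonical coordinates of a chart the fibre component of the lift is `B(b, Dχ ·)`, with
`χ` the smooth local inverse of `F` in that chart; this avoids differentiating the inverse of `dF`.
-/
theorem IsFlatParam.contMDiff_cotangentLift (hF : IsFlatParam (𝓡 n) (baseMetric σ) B F univ) :
    ContMDiff 𝓘(ℝ, Model n × Model n) (phaseModel n) ∞ (cotangentLift B F) := by
  intro z
  set e := chartAt (Model n) (F z.1) with hedef
  have he : e ∈ IsManifold.maximalAtlas (𝓡 n) ∞ Q := IsManifold.chart_mem_maximalAtlas _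
  have hsrc : F z.1 ∈ e.source := mem_chart_source _ _
  obtain ⟨χ, hχ, -, ev⟩ := hF.exists_coord_cotangent he hsrc
  have hFz : ContMDiffAt 𝓘(ℝ, Model n) (𝓡 n) ∞ F z.1 :=
    hF.contMDiffOn.contMDiffAt (hF.isOpen.mem_nhds (mem_univ _))
  refine contMDiffAt_totalSpace.2 ⟨?_, ?_⟩
  · exact ContMDiffAt.comp (g := F) z hFz contDiff_fst.contMDiff.contMDiffAt
  · have hψ : ContDiffAt ℝ ∞ (fun x => e.extend (𝓡 n) (F x)) z.1 :=
      contMDiffAt_iff_contDiffAt.1 ((e.contMDiffAt_extend he hsrc).comp z.1 hFz)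
    have hD : ContDiffAt ℝ ∞ (fderiv ℝ χ) (e.extend (𝓡 n) (F z.1)) := hχ.fderiv_right (by simp)
    have h1 : ContDiffAt ℝ ∞ (fun z : Model n × Model n =>
        (B z.2).comp (fderiv ℝ χ (e.extend (𝓡 n) (F z.1)))) z := by
      refine ContDiffAt.clm_comp (B.contDiff.comp contDiff_snd).contDiffAt ?_
      exact ContDiffAt.comp (g := fderiv ℝ χ) z hD
        (ContDiffAt.comp (g := fun x => e.extend (𝓡 n) (F x)) z hψ contDiffAt_fst)
    refine h1.contMDiffAt.congr_of_eventuallyEq ?_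
    filter_upwards [continuousAt_fst.eventually ev] with z' hz'
    ext v
    exact (cotangent_trivializationAt_apply (F z.1) (cotangentLift B F z') hz'.1 v).trans
      (hz'.2.2.2 z'.2 v)

end CotangentBundle

/-! ### Canonical coordinates and the lifted metric -/

section CanonicalCoordinates

set_option maxSynthPendingDepth 3

open Set Metric Filter
open scoped Topology

variable {n : ℕ} {Q : Type*} [TopologicalSpace Q] [ChartedSpace (Model n) Q]
  [IsManifold (𝓡 n) ω Q]

theorem contMDiff_cotangent_proj :
    ContMDiff (phaseModel n) (𝓡 n) ∞ (fun m : Cotangent n Q => m.proj) :=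
  contMDiff_proj _

theorem mdifferentiableAt_coordQ {e : OpenPartialHomeomorph Q (Model n)}
    (he : e ∈ IsManifold.maximalAtlas (𝓡 n) ∞ Q) (i : Fin n) {m : Cotangent n Q}
    (hm : m.proj ∈ e.source) : MDifferentiableAt (phaseModel n) 𝓘(ℝ, ℝ) (coordQ e i) m := by
  have h1 : ContMDiffAt (phaseModel n) 𝓘(ℝ, Model n) ∞
      (fun m : Cotangent n Q => e.extend (𝓡 n) m.proj) m :=
    ContMDiffAt.comp (g := e.extend (𝓡 n)) m (e.contMDiffAt_extend he hm)
      (contMDiff_cotangent_proj m)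
  have h2 : ContDiff ℝ ∞ ((stdBasis n).coord i).toContinuousLinearMap :=
    ContinuousLinearMap.contDiff _
  exact (ContMDiffAt.comp (g := ((stdBasis n).coord i).toContinuousLinearMap) m
    h2.contMDiff.contMDiffAt h1).mdifferentiableAt (by simp)

theorem mdifferentiableAt_coordP {e : OpenPartialHomeomorph Q (Model n)}
    (he : e ∈ IsManifold.maximalAtlas (𝓡 n) ∞ Q) (i : Fin n) {m : Cotangent n Q}
    (hm : m.proj ∈ e.source) : MDifferentiableAt (phaseModel n) 𝓘(ℝ, ℝ) (coordP e i) m := by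
  have h1 : ContMDiffAt (phaseModel n) 𝓘(ℝ, Model n) ∞
      (fun m : Cotangent n Q => e.extend (𝓡 n) m.proj) m :=
    ContMDiffAt.comp (g := e.extend (𝓡 n)) m (e.contMDiffAt_extend he hm)
      (contMDiff_cotangent_proj m)
  have ht : e.extend (𝓡 n) m.proj ∈ (e.extend (𝓡 n)).target :=
    (e.extend (𝓡 n)).map_source (by rwa [e.extend_source])
  have h2 := (contMDiffOn_mfderiv_apply e.isOpen_extend_target (I := 𝓡 n)
    (fun y hy => (contMDiffAt_extend_symm he hy).contMDiffWithinAt)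
    (stdBasis n i)).contMDiffAt (e.isOpen_extend_target.mem_nhds ht)
  have h3 : ContMDiffAt (phaseModel n) (𝓡 n).tangent ∞
      (fun m : Cotangent n Q => (⟨m.proj, baseVector e m.proj i⟩ : TangentBundle (𝓡 n) Q)) m := by
    refine (ContMDiffAt.comp m h2 h1).congr_of_eventuallyEq ?_
    filter_upwards [(contMDiff_cotangent_proj m).continuousAt.eventually
      (e.open_source.mem_nhds hm)] with m' hm'
    -- The coordinate vector is produced at the point obtained by going to the chart and back, which
    -- equals the original point only on the source of the chart.
    have hmk : ∀ {q q' : Q} (w : Model n), q = q' →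
        (⟨q, w⟩ : TangentBundle (𝓡 n) Q) = ⟨q', w⟩ := by
      rintro q _ w rfl
      rfl
    exact hmk _ (e.extend_left_inv hm').symm
  have h4 : ContMDiffAt (phaseModel n) ((𝓡 n).prod 𝓘(ℝ)) ∞
      (fun m : Cotangent n Q ↦ TotalSpace.mk' ℝ (E := Bundle.Trivial Q ℝ) m.proj
        (m.2 (baseVector e m.proj i))) m := by
    apply ContMDiffAt.clm_bundle_apply (F₁ := Model n) (F₂ := ℝ)
    · exact contMDiffAt_id
    · exact h3
  simp only [contMDiffAt_totalSpace] at h4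
  exact h4.2.mdifferentiableAt (by simp)

/-- Raising an index: the numbers `B(D w, D b_j)` are the matrix `m` applied to the components of
`w`, and the inverse matrix recovers those components. -/
theorem sum_inv_mul_eq_repr {E E' ι : Type*} [NormedAddCommGroup E] [NormedSpace ℝ E]
    [NormedAddCommGroup E'] [NormedSpace ℝ E'] [Fintype ι] [DecidableEq ι]
    (b : Module.Basis ι ℝ E) {m : Matrix ι ι ℝ} {B : E' →L[ℝ] E' →L[ℝ] ℝ} {D : E →L[ℝ] E'}
    (hBs : ∀ v w, B v w = B w v) (hu : IsUnit m.det)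
    (hm : ∀ i j, m i j = B (D (b i)) (D (b j))) (w : E) (i : ι) :
    ∑ j, m⁻¹ i j * B (D w) (D (b j)) = b.repr w i := by
  have h1 : (fun j => B (D w) (D (b j))) = m.mulVec (b.repr w) := by
    ext j
    conv_lhs => rw [← b.sum_repr w]
    simp only [map_sum, map_smul, sum_apply, smul_apply, Matrix.mulVec, dotProduct, hm]
    exact Finset.sum_congr rfl fun k _ => by rw [hBs (D (b j)), smul_eq_mul, mul_comm]
  have h2 : m⁻¹.mulVec (fun j => B (D w) (D (b j))) = b.repr w := by
    rw [h1, Matrix.mulVec_mulVec, Matrix.nonsing_inv_mul _ hu, Matrix.one_mulVec]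
  exact congrFun h2 i

variable {σ : ContMDiffRiemannianMetric (𝓡 n) ω (Model n) (fun q : Q => TangentSpace (𝓡 n) q)}
  {B : Model n →L[ℝ] Model n →L[ℝ] ℝ} {F : Model n → Q}

/-- The components of the velocities of the lift of a flat parametrization. -/
theorem IsFlatParam.exists_velocity_formula (hF : IsFlatParam (𝓡 n) (baseMetric σ) B F univ)
    {e : OpenPartialHomeomorph Q (Model n)} (he : e ∈ IsManifold.maximalAtlas (𝓡 n) ∞ Q)
    {x : Model n} (hx : F x ∈ e.source) (b : Model n) :
    ∃ D : Model n →L[ℝ] Model n, Function.Bijective D ∧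
      (∀ v : Model n, D (fderiv ℝ (fun x => e.extend (𝓡 n) (F x)) x v) = v) ∧
      (∀ i j, baseMatrix σ e (F x) i j = B (D (stdBasis n i)) (D (stdBasis n j))) ∧
      (∀ v : Model n, (mfderiv 𝓘(ℝ, Model n) (𝓡 n) F x (D v) : Model n) =
          mfderiv 𝓘(ℝ, Model n) (𝓡 n) (e.extend (𝓡 n)).symm (e.extend (𝓡 n) (F x)) v) ∧
      ∀ (v c : Model n) (i : Fin n),
        dotQ e (cotangentLift B F (x, b)) i (mfderiv 𝓘(ℝ, Model n × Model n) (phaseModel n)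
          (cotangentLift B F) (x, b) ((v, c) : Model n × Model n)) =
          (stdBasis n).repr (fderiv ℝ (fun x => e.extend (𝓡 n) (F x)) x v) i ∧
        covDeriv σ e (cotangentLift B F (x, b)) i (mfderiv 𝓘(ℝ, Model n × Model n) (phaseModel n)
          (cotangentLift B F) (x, b) ((v, c) : Model n × Model n)) = B c (D (stdBasis n i)) := by
  obtain ⟨χ, hχ, hev, ev⟩ := hF.exists_coord_cotangent he hx
  have hFx : ContMDiffAt 𝓘(ℝ, Model n) (𝓡 n) ∞ F x :=
    hF.contMDiffOn.contMDiffAt (hF.isOpen.mem_nhds (mem_univ _))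
  set ψ : Model n → Model n := fun x => e.extend (𝓡 n) (F x) with hψdef
  have hψ : HasFDerivAt ψ (fderiv ℝ ψ x) x :=
    ((contMDiffAt_iff_contDiffAt.1 ((e.contMDiffAt_extend he hx).comp x hFx)).differentiableAt
      (by simp)).hasFDerivAt
  obtain ⟨hχ2, hbij, hmat⟩ := hev.self_of_nhds
  obtain ⟨-, hD, hmf, hlift⟩ := ev.self_of_nhds
  have hDχ : HasFDerivAt (fderiv ℝ χ) (fderiv ℝ (fderiv ℝ χ) (ψ x)) (ψ x) :=
    ((hχ2.fderiv_right (m := 1) (by norm_num)).differentiableAt one_ne_zero).hasFDerivAt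
  have hlm := (hF.contMDiff_cotangentLift (x, b)).mdifferentiableAt (by simp)
  have hdotQ : ∀ (v c : Model n) (i : Fin n),
      dotQ e (cotangentLift B F (x, b)) i (mfderiv 𝓘(ℝ, Model n × Model n) (phaseModel n)
          (cotangentLift B F) (x, b) ((v, c) : Model n × Model n)) =
          (stdBasis n).repr (fderiv ℝ ψ x v) i := by
    intro v c i
    have h1 := (mdifferentiableAt_coordQ he i (m := cotangentLift B F (x, b))
      hx).hasMFDerivAt.comp (x, b) hlm.hasMFDerivAt
    have h2 : HasFDerivAt (fun z : Model n × Model n =>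
        ((stdBasis n).coord i).toContinuousLinearMap (ψ z.1)) _ (x, b) :=
      ((stdBasis n).coord i).toContinuousLinearMap.hasFDerivAt.comp (x, b)
        (HasFDerivAt.comp (g := ψ) (x, b) hψ hasFDerivAt_fst)
    have h3 := hasMFDerivAt_unique h1 h2.hasMFDerivAt
    exact congrArg (fun T : Model n × Model n →L[ℝ] ℝ => T (v, c)) h3
  -- Along the lift `p_i = B(b, Dχ ∂_i)`; differentiating produces a term with the second derivative
  -- of `χ` and a term with the increment `c` of `b`.
  have hcoordP : ∀ᶠ z in 𝓝 (x, b), ∀ i, coordP e i (cotangentLift B F z) =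
      B z.2 (fderiv ℝ χ (ψ z.1) (stdBasis n i)) := by
    filter_upwards [continuousAt_fst.eventually ev] with z hz i
    exact hz.2.2.2 z.2 (stdBasis n i)
  have hdotP : ∀ (v c : Model n) (i : Fin n),
      dotP e (cotangentLift B F (x, b)) i (mfderiv 𝓘(ℝ, Model n × Model n) (phaseModel n)
          (cotangentLift B F) (x, b) ((v, c) : Model n × Model n)) =
          B b (fderiv ℝ (fderiv ℝ χ) (ψ x) (fderiv ℝ ψ x v) (stdBasis n i)) +
          B c (fderiv ℝ χ (ψ x) (stdBasis n i)) := by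
    intro v c i
    have h1 := (mdifferentiableAt_coordP he i (m := cotangentLift B F (x, b))
      hx).hasMFDerivAt.comp (x, b) hlm.hasMFDerivAt
    have h2 : HasFDerivAt (fun z : Model n × Model n => fderiv ℝ χ (ψ z.1) (stdBasis n i)) _
        (x, b) :=
      (HasFDerivAt.comp (g := fderiv ℝ χ) (x, b) hDχ
        (HasFDerivAt.comp (g := ψ) (x, b) hψ hasFDerivAt_fst)).clm_apply
        (hasFDerivAt_const (stdBasis n i) (x, b))
    have h3 := (B.hasFDerivAt_of_bilinear (hasFDerivAt_snd (p := (x, b))) h2)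
    have h4 := hasMFDerivAt_unique h1
      (h3.congr_of_eventuallyEq (hcoordP.mono fun z hz => hz i)).hasMFDerivAt
    have h5 := congrArg (fun T : Model n × Model n →L[ℝ] ℝ => T (v, c)) h4
    refine h5.trans ?_
    simp
  refine ⟨fderiv ℝ χ (ψ x), hbij, hD, hmat, hmf, fun v c i => ⟨hdotQ v c i, ?_⟩⟩
  have hsymm := christoffelOf_symm (b := stdBasis n) (y := ψ x)
    (h := metricMatrix (𝓡 n) (stdBasis n) (baseMetric σ) e)
    (Eventually.of_forall fun y => metricMatrix_isSymm σ y)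
  -- The second derivative of the flat coordinates is given by the Christoffel symbols, so its
  -- contribution to `\dot p_i` is precisely the correction subtracted in the covariant derivative.
  -- Only `B(c, D ∂_i)` survives.
  have h6 := fderiv_fderiv_apply_eq_christoffelOf (stdBasis n) hF.symm hF.definite hχ2 hbij.1
    hbij.2 (hev.mono fun y hy => hy.2.2) (fderiv ℝ ψ x v) (stdBasis n i)
  change dotP e (cotangentLift B F (x, b)) i _ - (∑ k, ∑ l, (coordP e k (cotangentLift B F (x, b)) *
    christoffel (𝓡 n) (stdBasis n) (baseMetric σ) e (ψ x) k i l) •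
      dotQ e (cotangentLift B F (x, b)) l) _ = _
  rw [hdotP, h6, LinearMap.sum_apply]
  simp only [LinearMap.sum_apply, LinearMap.smul_apply, hdotQ, hcoordP.self_of_nhds,
    christoffel_eq_christoffelOf, map_sum, map_smul, smul_eq_mul, Module.Basis.repr_self,
    Finsupp.single_apply, mul_ite, mul_one, mul_zero, Finset.sum_ite_eq, Finset.mem_univ, if_true]
  rw [add_sub_right_comm, add_eq_right, sub_eq_zero]
  refine Finset.sum_congr rfl fun k _ => ?_
  rw [Finset.sum_mul]
  refine Finset.sum_congr rfl fun l _ => ?_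
  rw [hsymm k l i]
  ring

end CanonicalCoordinates

/-! ### The lifted metric in flat coordinates -/

section LiftedMetric

set_option maxSynthPendingDepth 3

open Set Metric Filter
open scoped Topology

variable {n : ℕ} {Q : Type*} [TopologicalSpace Q] [ChartedSpace (Model n) Q]
  [IsManifold (𝓡 n) ω Q]
  {σ : ContMDiffRiemannianMetric (𝓡 n) ω (Model n) (fun q : Q => TangentSpace (𝓡 n) q)}
  {B : Model n →L[ℝ] Model n →L[ℝ] ℝ} {F : Model n → Q}

/-- The orthogonal sum of two copies of the bilinear form `B`. -/
def sumForm (B : Model n →L[ℝ] Model n →L[ℝ] ℝ) :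
    (Model n × Model n) →L[ℝ] (Model n × Model n) →L[ℝ] ℝ :=
  ((B.comp (ContinuousLinearMap.fst ℝ _ _)).flip.comp (ContinuousLinearMap.fst ℝ _ _)).flip +
    ((B.comp (ContinuousLinearMap.snd ℝ _ _)).flip.comp (ContinuousLinearMap.snd ℝ _ _)).flip

theorem sumForm_apply (B : Model n →L[ℝ] Model n →L[ℝ] ℝ) (v w : Model n × Model n) :
    sumForm B v w = B v.1 w.1 + B v.2 w.2 := rfl

/-- A flat parametrization records only that `B` has no null vectors; positivity is inherited from
`σ` at the point `F 0`. It is what makes `B ⊕ B` free of null vectors as well. -/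
theorem IsFlatParam.form_nonneg (hF : IsFlatParam (𝓡 n) (baseMetric σ) B F univ) (v : Model n) :
    0 ≤ B v v := by
  rw [← hF.isometry 0 (mem_univ _) v v]
  by_cases h : (mfderiv 𝓘(ℝ, Model n) (𝓡 n) F 0 v) = 0
  · rw [h]
    exact (congrArg (fun S => S (0 : Model n)) (map_zero (σ.inner (F 0)))).ge
  · exact (σ.pos _ _ h).le

theorem mfderiv_proj_cotangentLift (hF : IsFlatParam (𝓡 n) (baseMetric σ) B F univ)
    (x b v c : Model n) :
    (mfderiv (phaseModel n) (𝓡 n) (fun m' : Cotangent n Q => m'.proj) (cotangentLift B F (x, b))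
      (mfderiv 𝓘(ℝ, Model n × Model n) (phaseModel n) (cotangentLift B F) (x, b)
        ((v, c) : Model n × Model n)) : Model n) =
      (mfderiv 𝓘(ℝ, Model n) (𝓡 n) F x v : Model n) := by
  have h1 := ((contMDiff_cotangent_proj (cotangentLift B F (x, b))).mdifferentiableAt
    (by simp)).hasMFDerivAt.comp (x, b)
    ((hF.contMDiff_cotangentLift (x, b)).mdifferentiableAt (by simp)).hasMFDerivAt
  have h2 : HasMFDerivAt 𝓘(ℝ, Model n × Model n) (𝓡 n) (fun z : Model n × Model n => F z.1)
      (x, b) _ := HasMFDerivAt.comp (g := F) (x, b)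
    (hF.mdifferentiableAt (mem_univ x)).hasMFDerivAt (hasFDerivAt_fst (𝕜 := ℝ)).hasMFDerivAt
  exact congrArg (fun T : Model n × Model n →L[ℝ] Model n => T (v, c)) (hasMFDerivAt_unique h1 h2)

/-- The covariant derivative of the lift in direction `(v, c)` is the covector that `B(c, ·)`
represents under `F`; raising its index by `σ` returns `dF c`, whatever `v` is. -/
theorem sharp_cotangentLift (hF : IsFlatParam (𝓡 n) (baseMetric σ) B F univ)
    {e : OpenPartialHomeomorph Q (Model n)} (he : e ∈ IsManifold.maximalAtlas (𝓡 n) ∞ Q)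
    {x : Model n} (hx : F x ∈ e.source) (b v c : Model n) :
    sharp σ e (F x) (fun i => covDeriv σ e (cotangentLift B F (x, b)) i
      (mfderiv 𝓘(ℝ, Model n × Model n) (phaseModel n) (cotangentLift B F) (x, b)
        ((v, c) : Model n × Model n))) = mfderiv 𝓘(ℝ, Model n) (𝓡 n) F x c := by
  obtain ⟨D, hbij, -, hmat, hmf, hvel⟩ := hF.exists_velocity_formula he hx b
  obtain ⟨w, rfl⟩ := hbij.2 c
  have hy : e.extend (𝓡 n) (F x) ∈ (e.extend (𝓡 n)).target :=
    (e.extend (𝓡 n)).map_source (by rwa [e.extend_source])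
  have h1 : ∀ i, ∑ j, (baseMatrix σ e (F x))⁻¹ i j * covDeriv σ e (cotangentLift B F (x, b)) j
      (mfderiv 𝓘(ℝ, Model n × Model n) (phaseModel n) (cotangentLift B F) (x, b)
        ((v, D w) : Model n × Model n)) = (stdBasis n).repr w i := by
    intro i
    rw [← sum_inv_mul_eq_repr (stdBasis n) hF.symm (isUnit_det_metricMatrix σ he hy) hmat w i]
    exact Finset.sum_congr rfl fun j _ => by rw [(hvel v (D w) j).2]; rfl
  unfold sharp
  simp only [h1]
  set T : Model n →L[ℝ] Model n :=
    mfderiv 𝓘(ℝ, Model n) (𝓡 n) (e.extend (𝓡 n)).symm (e.extend (𝓡 n) (F x)) with hT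
  have h2 : T w = ∑ i, (stdBasis n).repr w i • T (stdBasis n i) := by
    conv_lhs => rw [← (stdBasis n).sum_repr w]
    simp only [map_sum, map_smul]
  exact h2.symm.trans (hmf w).symm

/-- The two terms of the lifted metric see `dF v` and `dF c` respectively, and `F` pulls each back
to `B`. Thus `T^*Q` inherits a global flat parametrization, and everything known about geodesics of
such metrics applies to it. -/
theorem isFlatParam_cotangentLift (hF : IsFlatParam (𝓡 n) (baseMetric σ) B F univ) :
    IsFlatParam (phaseModel n) (liftedMetric σ) (sumForm B) (cotangentLift B F) univ where
  isOpen := isOpen_univ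
  contMDiffOn := hF.contMDiff_cotangentLift.contMDiffOn
  symm v w := by rw [sumForm_apply, sumForm_apply, hF.symm v.1, hF.symm v.2]
  definite v hv := by
    rw [sumForm_apply] at hv
    have h1 := hF.form_nonneg v.1
    have h2 := hF.form_nonneg v.2
    exact Prod.ext (hF.definite _ (by linarith)) (hF.definite _ (by linarith))
  isometry := by
    rintro ⟨x, b⟩ - ⟨v, c⟩ ⟨v', c'⟩
    have he : chartAt (Model n) (F x) ∈ IsManifold.maximalAtlas (𝓡 n) ∞ Q :=
      IsManifold.chart_mem_maximalAtlas _
    have hs := fun v c => sharp_cotangentLift hF he (mem_chart_source _ (F x)) b v c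
    have hp := fun v c => mfderiv_proj_cotangentLift hF x b v c
    rw [sumForm_apply, ← hF.isometry x (mem_univ x) v v', ← hF.isometry x (mem_univ x) c c']
    refine congrArg₂ (· + ·) ?_ ?_
    · exact metric_congr (g := baseMetric σ) rfl (hp v c) (hp v' c')
    · exact metric_congr (g := baseMetric σ) rfl (hs v c) (hs v' c')

/-- The hypothesis `hdF` says that `dF_x` is the coordinate frame of `e`, so the flat coordinates
have identity derivative at this point and the components of `dF v` and `dF c` are those of `v` and
`c`. -/
theorem complexCoord_cotangentLift (hF : IsFlatParam (𝓡 n) (baseMetric σ) B F univ)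
    {e : OpenPartialHomeomorph Q (Model n)} (he : e ∈ IsManifold.maximalAtlas (𝓡 n) ∞ Q)
    {x : Model n} (hx : F x ∈ e.source)
    (hdF : ∀ v : Model n, (mfderiv 𝓘(ℝ, Model n) (𝓡 n) F x v : Model n) =
      mfderiv 𝓘(ℝ, Model n) (𝓡 n) (e.extend (𝓡 n)).symm (e.extend (𝓡 n) (F x)) v)
    (b v c : Model n) :
    complexCoord σ e (cotangentLift B F (x, b))
      (mfderiv 𝓘(ℝ, Model n × Model n) (phaseModel n) (cotangentLift B F) (x, b)
        ((v, c) : Model n × Model n)) = fun i => (v i : ℂ) + Complex.I * (c i : ℂ) := by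
  obtain ⟨D, hbij, hDψ, hmat, hmf, hvel⟩ := hF.exists_velocity_formula he hx b
  have hy : e.extend (𝓡 n) (F x) ∈ (e.extend (𝓡 n)).target :=
    (e.extend (𝓡 n)).map_source (by rwa [e.extend_source])
  have hD : ∀ v, D v = v := fun v =>
    hF.injective_mfderiv (mem_univ x) ((hmf v).trans (hdF v).symm)
  have hψ : ∀ v, fderiv ℝ (fun x => e.extend (𝓡 n) (F x)) x v = v := fun v =>
    (hD _).symm.trans (hDψ v)
  ext i
  have h1 : ∑ j, (baseMatrix σ e (F x))⁻¹ i j * covDeriv σ e (cotangentLift B F (x, b)) j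
      (mfderiv 𝓘(ℝ, Model n × Model n) (phaseModel n) (cotangentLift B F) (x, b)
        ((v, c) : Model n × Model n)) = c i := by
    have h2 := sum_inv_mul_eq_repr (stdBasis n) hF.symm (isUnit_det_metricMatrix σ he hy) hmat c i
    rw [hD c] at h2
    refine Eq.trans (Finset.sum_congr rfl fun j _ => ?_) h2
    rw [(hvel v c j).2]
    rfl
  have h3 : dotQ e (cotangentLift B F (x, b)) i (mfderiv 𝓘(ℝ, Model n × Model n) (phaseModel n)
      (cotangentLift B F) (x, b) ((v, c) : Model n × Model n)) = v i := by
    rw [(hvel v c i).1, hψ]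
    rfl
  change ((dotQ e (cotangentLift B F (x, b)) i _ : ℝ) : ℂ) + Complex.I * ((∑ j,
    (baseMatrix σ e (F x))⁻¹ i j * covDeriv σ e (cotangentLift B F (x, b)) j _ : ℝ) : ℂ) = _
  rw [h1, h3]

end LiftedMetric

/-! ### The volume form -/

section Volume

set_option maxSynthPendingDepth 3

open Set Metric Filter
open scoped Topology Matrix

variable {n : ℕ} {Q : Type*} [TopologicalSpace Q] [ChartedSpace (Model n) Q]
  [IsManifold (𝓡 n) ω Q]
  {σ : ContMDiffRiemannianMetric (𝓡 n) ω (Model n) (fun q : Q => TangentSpace (𝓡 n) q)}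
  {B : Model n →L[ℝ] Model n →L[ℝ] ℝ} {F : Model n → Q}

theorem phaseBasis_repr_inl (y : Model n × (Model n →L[ℝ] ℝ)) (i : Fin n) :
    (phaseBasis n).repr y (Sum.inl i) = (stdBasis n).repr y.1 i := by
  simp [phaseBasis]

theorem phaseBasis_repr_inr (y : Model n × (Model n →L[ℝ] ℝ)) (i : Fin n) :
    (phaseBasis n).repr y (Sum.inr i) = y.2 (stdBasis n i) := by
  simp [phaseBasis]

theorem finrank_phaseModel :
    Module.finrank ℝ (Model n × Model n) = Module.finrank ℝ (Model n × (Model n →L[ℝ] ℝ)) := by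
  rw [Module.finrank_eq_card_basis (phaseBasis n),
    Module.finrank_eq_card_basis ((stdBasis n).prod (stdBasis n))]

/-- The Gram matrix of the standard basis with respect to the bilinear form `B`. -/
def gram (B : Model n →L[ℝ] Model n →L[ℝ] ℝ) : Matrix (Fin n) (Fin n) ℝ :=
  Matrix.of fun i j => B (stdBasis n i) (stdBasis n j)

theorem IsFlatParam.det_gram_pos (hF : IsFlatParam (𝓡 n) (baseMetric σ) B F univ) :
    0 < (gram B).det := by
  refine Matrix.PosDef.det_pos (Matrix.PosDef.of_dotProduct_mulVec_pos ?_ fun x hx => ?_)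
  · ext i j
    simp [gram, hF.symm (stdBasis n i)]
  · set v : Model n := ∑ i, x i • stdBasis n i with hv
    have h1 : star x ⬝ᵥ gram B *ᵥ x = B v v := by
      simp only [hv, map_sum, map_smul, sum_apply, smul_apply, dotProduct, Matrix.mulVec, gram,
        Matrix.of_apply, star_trivial, smul_eq_mul, Finset.mul_sum]
      rw [Finset.sum_comm]
      refine Finset.sum_congr rfl fun i _ => Finset.sum_congr rfl fun j _ => ?_
      ring
    rw [h1]
    refine lt_of_le_of_ne (hF.form_nonneg v) fun h => hx ?_
    have h2 : v = 0 := hF.definite v h.symm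
    ext i
    have h3 := congrArg (fun u => (stdBasis n).repr u i) h2
    simpa [hv, Finsupp.single_apply] using h3

/-- The matrix of the lift of a flat parametrization in canonical coordinates has positive
determinant. -/
theorem IsFlatParam.det_toMatrix_pos (hF : IsFlatParam (𝓡 n) (baseMetric σ) B F univ)
    (z : Model n × Model n) :
    0 < ((phaseBasis n).toMatrix fun j => fderiv ℝ (fun z' =>
      extChartAt (phaseModel n) (cotangentLift B F z) (cotangentLift B F z')) z
        ((stdBasis n).prod (stdBasis n) j)).det := by
  set e := chartAt (Model n) (F z.1) with hedef
  have he : e ∈ IsManifold.maximalAtlas (𝓡 n) ∞ Q := IsManifold.chart_mem_maximalAtlas _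
  have hsrc : F z.1 ∈ e.source := mem_chart_source _ _
  obtain ⟨χ, hχ, -, ev⟩ := hF.exists_coord_cotangent he hsrc
  obtain ⟨-, hD, -, -⟩ := ev.self_of_nhds
  have hFz : ContMDiffAt 𝓘(ℝ, Model n) (𝓡 n) ∞ F z.1 :=
    hF.contMDiffOn.contMDiffAt (hF.isOpen.mem_nhds (mem_univ _))
  set ψ : Model n → Model n := fun x => e.extend (𝓡 n) (F x) with hψdef
  have hψ : HasFDerivAt ψ (fderiv ℝ ψ z.1) z.1 :=
    ((contMDiffAt_iff_contDiffAt.1 ((e.contMDiffAt_extend he hsrc).comp z.1 hFz)).differentiableAt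
      (by simp)).hasFDerivAt
  have hDχ : HasFDerivAt (fderiv ℝ χ) (fderiv ℝ (fderiv ℝ χ) (ψ z.1)) (ψ z.1) :=
    ((hχ.fderiv_right (m := 1) (by norm_cast)).differentiableAt one_ne_zero).hasFDerivAt
  set κ : Model n × Model n → Model n × (Model n →L[ℝ] ℝ) := fun z' =>
      extChartAt (phaseModel n) (cotangentLift B F z) (cotangentLift B F z') with hκ
  have hκeq : κ =ᶠ[𝓝 z] fun z' => (ψ z'.1, (B z'.2).comp (fderiv ℝ χ (ψ z'.1))) := by
    filter_upwards [continuousAt_fst.eventually ev] with z' hz'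
    rw [hκ, FiberBundle.extChartAt]
    refine Prod.ext rfl (ContinuousLinearMap.ext fun v => ?_)
    exact (cotangent_trivializationAt_apply (F z.1) (cotangentLift B F z') hz'.1 v).trans
      (hz'.2.2.2 z'.2 v)
  have h1 : HasFDerivAt (fun z' : Model n × Model n => ψ z'.1) _ z :=
    HasFDerivAt.comp (g := ψ) z hψ hasFDerivAt_fst
  have h2 : HasFDerivAt (fun z' : Model n × Model n => fderiv ℝ χ (ψ z'.1)) _ z :=
    HasFDerivAt.comp (g := fderiv ℝ χ) z hDχ h1
  have h3 : HasFDerivAt (fun z' : Model n × Model n => B z'.2) _ z :=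
    B.hasFDerivAt.comp z hasFDerivAt_snd
  have h4 := ((h1.prodMk (h3.clm_comp h2)).congr_of_eventuallyEq hκeq).fderiv
  set A := LinearMap.toMatrix (stdBasis n) (stdBasis n) (fderiv ℝ ψ z.1).toLinearMap with hA
  set C := LinearMap.toMatrix (stdBasis n) (stdBasis n) (fderiv ℝ χ (ψ z.1)).toLinearMap with hC
  have hCA : C * A = 1 := by
    rw [hC, hA, ← LinearMap.toMatrix_comp, ← LinearMap.toMatrix_id (stdBasis n)]
    congr 1
    exact LinearMap.ext hD
  set P := (phaseBasis n).toMatrix fun j => fderiv ℝ κ z ((stdBasis n).prod (stdBasis n) j) with hP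
  -- The base coordinates do not depend on `b`, so the Jacobian is block triangular. Its diagonal
  -- blocks are `A` and `Cᵀ * gram B` with `C * A = 1`, so the determinant is that of `gram B`; the
  -- lower left block plays no role.
  have hblock : P = Matrix.fromBlocks A 0 P.toBlocks₂₁ (Cᵀ * gram B) := by
    ext (i | i) (j | j)
    · simp [hP, Module.Basis.toMatrix_apply, h4, phaseBasis_repr_inl, hA, LinearMap.toMatrix_apply]
    · simp [hP, Module.Basis.toMatrix_apply, h4, phaseBasis_repr_inl]
    · simp [Matrix.toBlocks₂₁]
    · simp only [hP, Module.Basis.toMatrix_apply, h4, phaseBasis_repr_inr, hC, gram,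
        Matrix.fromBlocks_apply₂₂, Matrix.mul_apply, Matrix.transpose_apply,
        LinearMap.toMatrix_apply, Matrix.of_apply]
      have h5 := congrArg (fun v => B (stdBasis n j) v)
        ((stdBasis n).sum_repr (fderiv ℝ χ (ψ z.1) (stdBasis n i)))
      simp only [map_sum, map_smul, smul_eq_mul] at h5
      simp [← h5, hF.symm (stdBasis n j)]
  rw [hblock, Matrix.det_fromBlocks_zero₁₂, Matrix.det_mul, Matrix.det_transpose, ← mul_assoc,
    mul_comm A.det, ← Matrix.det_mul, hCA, Matrix.det_one, one_mul]
  exact hF.det_gram_pos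

/-- If `P` is the Jacobian of the lift and `h` the matrix of the lifted metric, then `Pᵀ h P` is the
matrix of `B ⊕ B`, so `det h · (det P)² = (det gram B)²`. Positivity of `det P` fixes the sign of
the root. Each point is treated in its own distinguished chart, as in the definition of the volume
form. -/
theorem IsFlatParam.phaseVolume_comp (hF : IsFlatParam (𝓡 n) (baseMetric σ) B F univ)
    (z : Model n × Model n) :
    (phaseVolume σ (cotangentLift B F z)).compLinearMap
      (mfderiv 𝓘(ℝ, Model n × Model n) (phaseModel n) (cotangentLift B F) z).toLinearMap =
      (gram B).det • ((stdBasis n).prod (stdBasis n)).det := by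
  set m := cotangentLift B F z with hm
  set c := (stdBasis n).prod (stdBasis n) with hc
  set κ : Model n × Model n → Model n × (Model n →L[ℝ] ℝ) := fun z' =>
      extChartAt (phaseModel n) (cotangentLift B F z) (cotangentLift B F z') with hκ
  have he : chartAt (ModelProd (Model n) (Model n →L[ℝ] ℝ)) m ∈
    IsManifold.maximalAtlas (phaseModel n) ∞ (Cotangent n Q) := IsManifold.chart_mem_maximalAtlas _
  have hsrc : cotangentLift B F z ∈ (chartAt (ModelProd (Model n) (Model n →L[ℝ] ℝ)) m).source :=
    mem_chart_source _ m
  have hlm := (hF.contMDiff_cotangentLift z).mdifferentiableAt (n := ∞) (by simp)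
  have hκd : HasMFDerivAt 𝓘(ℝ, Model n × Model n) 𝓘(ℝ, Model n × (Model n →L[ℝ] ℝ)) κ z _ :=
    (mdifferentiableAt_extChartAt (I := phaseModel n) hsrc).hasMFDerivAt.comp z hlm.hasMFDerivAt
  have hκd' : HasFDerivAt κ (fderiv ℝ κ z) z := hκd.hasFDerivAt.differentiableAt.hasFDerivAt
  set P := (phaseBasis n).toMatrix fun j => fderiv ℝ κ z (c j) with hP
  set h := metricMatrix (phaseModel n) (phaseBasis n) (liftedMetric σ) (chartAt _ m)
    ((chartAt _ m).extend (phaseModel n) m) with hh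
  have hPpos : 0 < P.det := hF.det_toMatrix_pos z
  have hgram : Pᵀ * h * P = Matrix.fromBlocks (gram B) 0 0 (gram B) := by
    obtain ⟨χ, hχ, -, ev1, -, ev2⟩ := (isFlatParam_cotangentLift hF).exists_coord
      (b := phaseBasis n)
      finrank_phaseModel he (mem_univ z) hsrc
    have hinv : ∀ v, fderiv ℝ χ (κ z) (fderiv ℝ κ z v) = v := by
      intro v
      have h1 : HasFDerivAt (fun z' => χ (κ z')) _ z :=
        HasFDerivAt.comp (g := χ) z (hχ.differentiableAt (by simp)).hasFDerivAt hκd'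
      exact congrArg (fun T : Model n × Model n →L[ℝ] Model n × Model n => T v)
        (h1.unique ((hasFDerivAt_id z).congr_of_eventuallyEq ev1))
    have h2 : ∀ i j, (Pᵀ * h * P) i j = sumForm B (c i) (c j) := by
      intro i j
      have h3 : ∀ k l, h k l = sumForm B (fderiv ℝ χ (κ z) (phaseBasis n k))
        (fderiv ℝ χ (κ z) (phaseBasis n l)) := ev2.self_of_nhds.2.2.2.2
      rw [← hinv (c i), ← hinv (c j), ← bilinOf_eq_comp (phaseBasis n) h3, bilinOf_apply]
      simp only [Matrix.mul_apply, Matrix.transpose_apply, Finset.sum_mul]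
      rw [Finset.sum_comm]
      refine Finset.sum_congr rfl fun k _ => Finset.sum_congr rfl fun l _ => ?_
      rw [hP, Module.Basis.toMatrix_apply, Module.Basis.toMatrix_apply]
      ring
    ext (i | i) (j | j) <;> rw [h2] <;> simp [hc, sumForm_apply, gram]
  have hdet : h.det * P.det ^ 2 = (gram B).det ^ 2 := by
    have := congrArg Matrix.det hgram
    rw [Matrix.det_mul, Matrix.det_mul, Matrix.det_transpose, Matrix.det_fromBlocks_zero₁₂] at this
    linear_combination this
  refine (AlternatingMap.eq_smul_basis_det c _).trans ?_
  congr 1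
  have h3 : Real.sqrt h.det * P.det = (gram B).det := by
    rw [← Real.sqrt_sq hPpos.le, ← Real.sqrt_mul' _ (sq_nonneg _), hdet,
      Real.sqrt_sq hF.det_gram_pos.le]
  rw [← h3]
  change Real.sqrt h.det * (phaseBasis n).det _ = _
  rw [Module.Basis.det_apply]
  refine congrArg (fun f => Real.sqrt h.det * ((phaseBasis n).toMatrix f).det) (funext fun j => ?_)
  exact congrArg (fun T : Model n × Model n →L[ℝ] Model n × (Model n →L[ℝ] ℝ) => T (c j))
    (hasMFDerivAt_unique hκd hκd'.hasMFDerivAt)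

end Volume

/-! ### Global flat parametrizations and the exponential map -/

section Exponential

set_option maxSynthPendingDepth 3

open Set Metric Filter
open scoped Topology

variable {E : Type*} [NormedAddCommGroup E] [NormedSpace ℝ E]
  {H : Type*} [TopologicalSpace H] {I : ModelWithCorners ℝ E H}
  {M : Type*} [TopologicalSpace M] [ChartedSpace H M]
  {E' : Type*} [NormedAddCommGroup E'] [NormedSpace ℝ E']
  {ι : Type*} [Fintype ι] [DecidableEq ι] {b : Module.Basis ι ℝ E}
  {g : ∀ x : M, TangentSpace I x → TangentSpace I x → ℝ}
  {B : E' →L[ℝ] E' →L[ℝ] ℝ} {f : E' → M}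

theorem tangentBundle_mk_eq {x x' : M} (h : x = x') {v : TangentSpace I x} {v' : TangentSpace I x'}
    (hv : (v : E) = (v' : E)) : (⟨x, v⟩ : TangentBundle I M) = ⟨x', v'⟩ := by
  subst h
  exact congrArg _ hv

theorem IsFlatParam.bijective_mfderiv [FiniteDimensional ℝ E] [FiniteDimensional ℝ E']
    (hf : IsFlatParam I g B f univ)
    (hdim : Module.finrank ℝ E' = Module.finrank ℝ E) (x : E') :
    Function.Bijective (mfderiv 𝓘(ℝ, E') I f x) :=
  ⟨hf.injective_mfderiv (mem_univ x), (LinearMap.injective_iff_surjective_of_finrank_eq_finrank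
    (f := (mfderiv 𝓘(ℝ, E') I f x : E' →L[ℝ] E).toLinearMap) hdim).1
    (hf.injective_mfderiv (mem_univ x))⟩

variable [IsManifold I ∞ M] [I.Boundaryless] [FiniteDimensional ℝ E] [FiniteDimensional ℝ E']
  [T2Space M]

/-- Images of lines are geodesics, and a geodesic with the same initial velocity agrees with one
near `0`, hence on the connected set `ℝ`. Existence and uniqueness for all times come together. -/
theorem IsFlatParam.isGeodesicFrom_iff (hf : IsFlatParam I g B f univ)
    (hdim : Module.finrank ℝ E' = Module.finrank ℝ E) (x u : E') (γ : ℝ → M) :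
    IsGeodesicFrom I b g (f x) (mfderiv 𝓘(ℝ, E') I f x u) γ ↔ γ = fun t : ℝ => f (x + t • u) := by
  have h0 : x + (0 : ℝ) • u = x := by rw [zero_smul, add_zero]
  constructor
  · rintro ⟨hγ, h⟩
    have h1 := TotalSpace.mk.inj h
    have h2 : (mfderiv 𝓘(ℝ, ℝ) I γ 0 (1 : ℝ) : E) = (mfderiv 𝓘(ℝ, E') I f x u : E) :=
      eq_of_heq h1.2
    have h3 := hγ.eventuallyEq_line hf hdim (p := x) (v := u) (t₀ := 0) (mem_univ _)
      (by rw [h0, h1.1]) (by rw [h0]; exact h2)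
    funext t
    exact (hγ.eventuallyEq_line_of_isPreconnected hf hdim h3 isPreconnected_univ (mem_univ _)
      (fun _ _ => mem_univ _) t (mem_univ _)).self_of_nhds
  · rintro rfl
    refine ⟨hf.isGeodesic_line hdim x u, tangentBundle_mk_eq (congrArg f h0) ?_⟩
    have hx : HasMFDerivAt 𝓘(ℝ, E') I f (x + (0 : ℝ) • u)
        (mfderiv 𝓘(ℝ, E') I f x : E' →L[ℝ] E) := by
      rw [h0]; exact (hf.mdifferentiableAt (mem_univ x)).hasMFDerivAt
    have h5 : HasDerivAt (fun s : ℝ => x + s • u) u 0 := by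
      simpa using ((hasDerivAt_id (0 : ℝ)).smul_const u).const_add x
    have h3 : HasMFDerivAt 𝓘(ℝ, ℝ) I (fun s : ℝ => f (x + s • u)) 0 _ :=
      HasMFDerivAt.comp (g := f) (f := fun s : ℝ => x + s • u) 0 hx h5.hasFDerivAt.hasMFDerivAt
    rw [h3.mfderiv]
    have h6 : (ContinuousLinearMap.toSpanSingleton ℝ u) (1 : ℝ) = u := by simp
    exact congrArg (mfderiv 𝓘(ℝ, E') I f x : E' →L[ℝ] E) h6

/-- By uniqueness the geodesic chosen in the definition of `expMap` is the image of the line `x + t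
u`. -/
theorem IsFlatParam.expMap_eq (hf : IsFlatParam I g B f univ)
    (hdim : Module.finrank ℝ E' = Module.finrank ℝ E) (x u : E') :
    expMap I b g (f x) (mfderiv 𝓘(ℝ, E') I f x u) = f (x + u) := by
  have h : ∃ γ : ℝ → M, IsGeodesicFrom I b g (f x) (mfderiv 𝓘(ℝ, E') I f x u) γ :=
    ⟨_, (hf.isGeodesicFrom_iff hdim x u _).2 rfl⟩
  rw [expMap, dif_pos h, (hf.isGeodesicFrom_iff hdim x u _).1 h.choose_spec]
  simp only [one_smul]

end Exponential

/-! ### Complex coordinates and Lebesgue measure -/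

section ComplexSpace

variable (n : ℕ)

/-- The identification of `ℂⁿ` with `ℝⁿ × ℝⁿ`. -/
def complexSplit : (Fin n → ℂ) ≃ₗ[ℝ] Model n × Model n where
  toFun z := (WithLp.toLp 2 fun i => (z i).re, WithLp.toLp 2 fun i => (z i).im)
  map_add' z w := by ext i <;> simp
  map_smul' c z := by ext i <;> simp
  invFun p i := (p.1 i : ℂ) + Complex.I * (p.2 i : ℂ)
  left_inv z := by
    funext i
    apply Complex.ext <;> simp
  right_inv p := by ext i <;> simp

theorem det_comp_complexSplit :
    ((stdBasis n).prod (stdBasis n)).det.compLinearMap (complexSplit n).toLinearMap =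
      lebesgueForm n := by
  ext v
  rw [AlternatingMap.compLinearMap_apply, lebesgueForm, AlternatingMap.compLinearMap_apply,
    Module.Basis.det_apply, Module.Basis.det_apply]
  congr 1

theorem lebesgueForm_stdFrame : lebesgueForm n (stdFrame n) = 1 := by
  rw [lebesgueForm, AlternatingMap.compLinearMap_apply, Module.Basis.det_apply]
  convert Matrix.det_one (n := Fin n ⊕ Fin n) (R := ℝ)
  ext (i | i) (j | j) <;>
    simp [Module.Basis.toMatrix_apply, stdFrame, realCoords, Pi.single_apply, Matrix.one_apply,
      apply_ite]

theorem formMeasure_const_smul {c : ℝ} (hc : 0 ≤ c) {n : ℕ}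
    {η : (Fin n → ℂ) → (Fin n → ℂ) [⋀^Fin n ⊕ Fin n]→ₗ[ℝ] ℝ} (h : ∀ z, η z = c • lebesgueForm n) :
    formMeasure η = ENNReal.ofReal c • (volume : Measure (Fin n → ℂ)) := by
  have h1 : (fun z => ENNReal.ofReal |η z (stdFrame n)|) = fun _ => ENNReal.ofReal c := by
    funext z
    rw [h, AlternatingMap.smul_apply, lebesgueForm_stdFrame, smul_eq_mul, mul_one, abs_of_nonneg hc]
  rw [formMeasure, h1, withDensity_const]

end ComplexSpace

/-! ### A flat parametrization adapted to a point of the cotangent bundle -/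

section Lift

set_option maxSynthPendingDepth 3

open Set

variable {n : ℕ} {Q : Type*} [TopologicalSpace Q] [T2Space Q] [ChartedSpace (Model n) Q]
  [IsManifold (𝓡 n) ω Q]
  {σ : ContMDiffRiemannianMetric (𝓡 n) ω (Model n) (fun q : Q => TangentSpace (𝓡 n) q)}

/-- The exponential map of `Q` is normalized so that `dF_0` is the coordinate frame of `e` at
`π(m)`; then the Gram matrix of `B` is `σ_{ij}(π m)`. Since `B` is nondegenerate, the covector of
`m`, pulled back by `dF_0`, is `B(b, ·)` for some `b`. -/
theorem exists_cotangentLift (hflat : IsFlat (𝓡 n) (stdBasis n) (baseMetric σ))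
    (hcomplete : IsGeodesicallyComplete (𝓡 n) (stdBasis n) (baseMetric σ))
    (m : Cotangent n Q) {e : OpenPartialHomeomorph Q (Model n)}
    (he : e ∈ IsManifold.maximalAtlas (𝓡 n) ∞ Q) (hm : m.proj ∈ e.source) :
    ∃ (B : Model n →L[ℝ] Model n →L[ℝ] ℝ) (F : Model n → Q) (b : Model n),
      IsFlatParam (𝓡 n) (baseMetric σ) B F univ ∧ m = cotangentLift B F (0, b) ∧
      (∀ v : Model n, (mfderiv 𝓘(ℝ, Model n) (𝓡 n) F 0 v : Model n) =
        mfderiv 𝓘(ℝ, Model n) (𝓡 n) (e.extend (𝓡 n)).symm (e.extend (𝓡 n) (F 0)) v) ∧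
      gram B = baseMatrix σ e m.proj := by
  obtain ⟨q, p⟩ := m
  change q ∈ e.source at hm
  have hy : e.extend (𝓡 n) q ∈ (e.extend (𝓡 n)).target :=
    (e.extend (𝓡 n)).map_source (by rwa [e.extend_source])
  have hinj : Function.Injective
      (mfderiv 𝓘(ℝ, Model n) (𝓡 n) (e.extend (𝓡 n)).symm (e.extend (𝓡 n) q)) := fun v w hvw => by
    rw [← mfderiv_extend_symm_right he hy v, hvw, mfderiv_extend_symm_right he hy w]
  obtain ⟨B, F, hF, hF0, hdF⟩ := exists_isFlatParam_univ
    (exists_isFlatParam_baseMetric σ hflat) hcomplete q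
    (mfderiv 𝓘(ℝ, Model n) (𝓡 n) (e.extend (𝓡 n)).symm (e.extend (𝓡 n) q) : Model n →L[ℝ] Model n)
    hinj
  subst hF0
  have hBinj : Function.Injective B := by
    refine (injective_iff_map_eq_zero B).2 fun v hv => hF.definite v ?_
    rw [hv]
    rfl
  have hBsurj : Function.Surjective B := by
    refine (LinearMap.injective_iff_surjective_of_finrank_eq_finrank
      (f := B.toLinearMap) ?_).1 hBinj
    rw [Module.finrank_eq_card_basis (stdBasis n), Module.finrank_eq_card_basis
      ((stdBasis n).dualBasis.map LinearMap.toContinuousLinearMap)]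
  obtain ⟨b, hb⟩ := hBsurj ((p : Model n →L[ℝ] ℝ).comp
    (mfderiv 𝓘(ℝ, Model n) (𝓡 n) F 0 : Model n →L[ℝ] Model n))
  refine ⟨B, F, b, hF, ?_, hdF, ?_⟩
  · refine congrArg (TotalSpace.mk (F 0)) (ContinuousLinearMap.ext fun v => ?_)
    obtain ⟨u, rfl⟩ := (hF.bijective_mfderiv rfl 0).2 v
    refine Eq.trans ?_ (hF.cotangentLift_apply 0 b u).symm
    rw [hb]
    rfl
  · ext i j
    change B (stdBasis n i) (stdBasis n j) = _
    rw [← hF.isometry 0 (mem_univ _)]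
    exact metric_congr (e.extend_left_inv hm).symm (hdF _) (hdF _)

end Lift

end FlatPhaseSpace

end

/-! ### The exponential map and volume form of phase space -/

theorem mainTheorem3 {n : ℕ} {Q : Type*} [TopologicalSpace Q] [T2Space Q]
    [ChartedSpace (FlatPhaseSpace.Model n) Q] [IsManifold (𝓡 n) ω Q]
    (σ : ContMDiffRiemannianMetric (𝓡 n) ω (FlatPhaseSpace.Model n)
      (fun q : Q => TangentSpace (𝓡 n) q))
    (hflat : FlatPhaseSpace.IsFlat (𝓡 n) (FlatPhaseSpace.stdBasis n)
      (FlatPhaseSpace.baseMetric σ))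
    (hcomplete : FlatPhaseSpace.IsGeodesicallyComplete (𝓡 n) (FlatPhaseSpace.stdBasis n)
      (FlatPhaseSpace.baseMetric σ))
    (m : FlatPhaseSpace.Cotangent n Q)
    (e : OpenPartialHomeomorph Q (FlatPhaseSpace.Model n))
    (he : e ∈ IsManifold.maximalAtlas (𝓡 n) ω Q) (hm : m.proj ∈ e.source) :
    (∀ V : TangentSpace (FlatPhaseSpace.phaseModel n) m,
      ∃! γ : ℝ → FlatPhaseSpace.Cotangent n Q,
        FlatPhaseSpace.IsGeodesicFrom (FlatPhaseSpace.phaseModel n)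
          (FlatPhaseSpace.phaseBasis n) (FlatPhaseSpace.liftedMetric σ) m V γ) ∧
    ∃ Z : TangentSpace (FlatPhaseSpace.phaseModel n) m ≃ₗ[ℝ] (Fin n → ℂ),
      (∀ V, Z V = FlatPhaseSpace.complexCoord σ e m V) ∧
      MDifferentiable 𝓘(ℝ, Fin n → ℂ) (FlatPhaseSpace.phaseModel n)
        (fun z => FlatPhaseSpace.phaseExp σ m (Z.symm z)) ∧
      (∀ z : Fin n → ℂ,
        FlatPhaseSpace.pullbackForm (FlatPhaseSpace.phaseModel n)
            (fun z => FlatPhaseSpace.phaseExp σ m (Z.symm z)) (FlatPhaseSpace.phaseVolume σ) z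
          = (FlatPhaseSpace.baseMatrix σ e m.proj).det • FlatPhaseSpace.lebesgueForm n) ∧
      FlatPhaseSpace.formMeasure
          (FlatPhaseSpace.pullbackForm (FlatPhaseSpace.phaseModel n)
            (fun z => FlatPhaseSpace.phaseExp σ m (Z.symm z)) (FlatPhaseSpace.phaseVolume σ))
        = ENNReal.ofReal (FlatPhaseSpace.baseMatrix σ e m.proj).det •
            (volume : Measure (Fin n → ℂ)) := by
  have he' : e ∈ IsManifold.maximalAtlas (𝓡 n) ∞ Q :=
    IsManifold.maximalAtlas_subset_of_le le_top he
  obtain ⟨B, F, b, hF, rfl, hdF, hgram⟩ :=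
    FlatPhaseSpace.exists_cotangentLift hflat hcomplete m he' hm
  have hm' : F 0 ∈ e.source := hm
  have hG := FlatPhaseSpace.isFlatParam_cotangentLift hF
  have hdim := FlatPhaseSpace.finrank_phaseModel (n := n)
  have hbij := hG.bijective_mfderiv hdim (0, b)
  rw [← hgram]
  set f := FlatPhaseSpace.cotangentLift B F with hf
  let T : FlatPhaseSpace.Model n × FlatPhaseSpace.Model n →ₗ[ℝ]
      TangentSpace (FlatPhaseSpace.phaseModel n) (f (0, b)) :=
    (mfderiv 𝓘(ℝ, FlatPhaseSpace.Model n × FlatPhaseSpace.Model n) (FlatPhaseSpace.phaseModel n)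
      f (0, b)).toLinearMap
  -- The derivative of the lift at `(0, b)` identifies `ℝⁿ × ℝⁿ` with `T_mP`; the complex
  -- coordinates `Z` are its inverse followed by `(v, c) ↦ v + i c`.
  let K : (FlatPhaseSpace.Model n × FlatPhaseSpace.Model n) ≃ₗ[ℝ]
      TangentSpace (FlatPhaseSpace.phaseModel n) (f (0, b)) := LinearEquiv.ofBijective T hbij
  let Z : TangentSpace (FlatPhaseSpace.phaseModel n) (f (0, b)) ≃ₗ[ℝ] (Fin n → ℂ) :=
    K.symm.trans (FlatPhaseSpace.complexSplit n).symm
  let S : (Fin n → ℂ) →L[ℝ] FlatPhaseSpace.Model n × FlatPhaseSpace.Model n :=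
    (FlatPhaseSpace.complexSplit n).toLinearMap.toContinuousLinearMap
  -- In these coordinates the exponential map is the lift composed with a translation of a linear
  -- isomorphism, so differentiability and the constant pulled-back volume form follow from those of
  -- the lift at every point.
  have hexp : (fun z => FlatPhaseSpace.phaseExp σ (f (0, b)) (Z.symm z)) =
      fun z => f ((0, b) + S z) := by
    funext z
    exact hG.expMap_eq hdim (0, b) (S z)
  have hfd : ∀ z, HasMFDerivAt 𝓘(ℝ, Fin n → ℂ) (FlatPhaseSpace.phaseModel n)
      (fun z => f ((0, b) + S z)) z
      ((mfderiv 𝓘(ℝ, FlatPhaseSpace.Model n × FlatPhaseSpace.Model n)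
        (FlatPhaseSpace.phaseModel n) f ((0, b) + S z)).comp S) := fun z =>
    HasMFDerivAt.comp (g := f) z (hG.mdifferentiableAt (Set.mem_univ _)).hasMFDerivAt
      (S.hasFDerivAt.const_add (0, b)).hasMFDerivAt
  have hpull : ∀ z, FlatPhaseSpace.pullbackForm (FlatPhaseSpace.phaseModel n)
      (fun z => FlatPhaseSpace.phaseExp σ (f (0, b)) (Z.symm z)) (FlatPhaseSpace.phaseVolume σ) z =
      (FlatPhaseSpace.gram B).det • FlatPhaseSpace.lebesgueForm n := by
    intro z
    rw [hexp, FlatPhaseSpace.pullbackForm, (hfd z).mfderiv, ← FlatPhaseSpace.det_comp_complexSplit]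
    exact congrArg (fun η => η.compLinearMap S.toLinearMap) (hF.phaseVolume_comp ((0, b) + S z))
  refine ⟨fun V => ?_, Z, fun V => ?_, ?_, hpull,
    FlatPhaseSpace.formMeasure_const_smul hF.det_gram_pos.le hpull⟩
  · obtain ⟨u, rfl⟩ := hbij.2 V
    exact ⟨_, (hG.isGeodesicFrom_iff hdim (0, b) u _).2 rfl,
      fun γ hγ => (hG.isGeodesicFrom_iff hdim (0, b) u γ).1 hγ⟩
  · obtain ⟨u, rfl⟩ := K.surjective V
    have h1 : Z (K u) = (FlatPhaseSpace.complexSplit n).symm u :=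
      congrArg (FlatPhaseSpace.complexSplit n).symm (K.symm_apply_apply u)
    rw [h1]
    exact (FlatPhaseSpace.complexCoord_cotangentLift hF he' hm' hdF b u.1 u.2).symm
  · rw [hexp]
    exact fun z => (hfd z).mdifferentiableAt
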